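/- Let $\varphi:\mathbb R^2\to\mathbb R$ be a real polynomial in $(x,y)$ of degree $\le m$, and for $\lambda>0$ put $L_1=\partial_x+\lambda(\partial_x\varphi)$ and $L_2=\partial_y+\lambda(\partial_y\varphi)$. Let $\|\cdot\|$ be the norm of $L^2(\mathbb R^2)$, and for open $W\subset\mathbb R^2$ let $C_0^\infty(W)$ be the space of smooth complex-valued functions with compact support in $W$. For a function $f$ of one real variable, say that $f$ changes sign from $-$ to $+$ in a set $I\subset\mathbb R$ if there are $s<t$ with $[s,t]\subset I$ and $f(s)<0<f(t)$; it does so only at the point $r$ if it does so and every such pair satisfies $s<r<t$. Let $\alpha>0$ and let $\Omega_x,\Omega_y\subset\mathbb R$ be neighborhoods of $0$. We say that $\varphi$ satisfies $H_1(\alpha)$ in $\Omega_x\times\Omega_y$ if there are finitely many pairwise disjoint open sets $\omega_1,\dots,\omega_N\subset\mathbb R$ and $C^1$ functions $r_j:\omega_j\to\mathbb R$ such that (i) $\bigcup_{j}\overline{\omega_j}=\overline{\Omega_y}$; (ii) for every $j$ and every $y\in\omega_j$, either $s\mapsto\partial_x\varphi(s,y)$ does not change sign from $-$ to $+$ in $\Omega_x$,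 or it changes sign from $-$ to $+$ in $\Omega_x$ only at the point $r_j(y)$ and $s\mapsto\partial_y\varphi(r_j(y),s)$ does not change sign from $-$ to $+$ in $\Omega_y$; (iii) $|r_j'(y)|\ge\alpha$ for every $j$ and every $y\in\omega_j$. $H_2(\alpha)$ is the same condition with the roles of $x$ and $y$ exchanged. Suppose that $\varphi$ satisfies $H_1(\alpha)$ in $\Omega_x\times\Omega_y$. (1) If $k\ge0$ is an integer with $\sum_{0\le j\le k}|\partial_x^{j+1}\varphi(0,0)|\neq0$, then there are $C>0$, $\lambda_0>0$ and an open neighborhood $W\subset\Omega_x\times\Omega_y$ of $(0,0)$ such that $$\|\lambda^{1/(k+1)}u\|\le C\big(\|L_1u\|+\|L_2u\|\big)\qquad\text{for all }\lambda\ge\lambda_0,\ u\in C_0^\infty(W).$$ (2) If $\varphi$ also satisfies $H_2(\alpha)$ in $\Omega_x\times\Omega_y$, then there are $C>0$, $\lambda_0>0$ and an open neighborhood $W\subset\Omega_x\times\Omega_y$ of $(0,0)$ such that $$\|\partial_xu\|+\|\partial_yu\|+\|\lambda(\partial_x\varphi)u\|+\|\lambda(\partial_y\varphi)u\|\le C\big(\|L_1u\|+\|L_2u\|\big)\qquad\text{for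 all }\lambda\ge\lambda_0,\ u\in C_0^\infty(W).$$ -/

import Mathlib

open Set Topology MeasureTheory
open scoped ContDiff ENNReal

noncomputable section

namespace WittenSystem

/-- The partial derivative in the first variable of a function on the `(x, y)`-plane. -/
def dx {F : Type*} [NormedAddCommGroup F] [NormedSpace ℝ F] (f : ℝ × ℝ → F) (z : ℝ × ℝ) : F :=
  deriv (fun s : ℝ => f (s, z.2)) z.1

/-- The partial derivative in the second variable. -/
def dy {F : Type*} [NormedAddCommGroup F] [NormedSpace ℝ F] (f : ℝ × ℝ → F) (z : ℝ × ℝ) : F :=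
  deriv (fun s : ℝ => f (z.1, s)) z.2

/-- The set `P_m` of real polynomial functions of two variables of (total) degree at most `m`. -/
def polyDegLE (m : ℕ) : Set (ℝ × ℝ → ℝ) :=
  {φ | ∃ p : MvPolynomial (Fin 2) ℝ, p.totalDegree ≤ m ∧
    ∀ z : ℝ × ℝ, φ z = MvPolynomial.eval ![z.1, z.2] p}

/-- `f` does not change sign from `-` to `+` as the variable increases in `I`: along no segment
`[s, t]` contained in `I` does `f` go from a negative to a positive value. -/
def NoSignChange (f : ℝ → ℝ) (I : Set ℝ) : Prop :=
  ∀ s t : ℝ, s < t → Icc s t ⊆ I → f s < 0 → f t ≤ 0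

/-- `f` does change sign from `-` to `+` in `I`, and it does so only at the point `r`: each
segment of `I` along which `f` goes from negative to positive values has `r` in its interior
(so that there is no such sign change in `I` to the left of `r`, nor to the right of `r`). -/
def ChangesSignOnlyAt (f : ℝ → ℝ) (I : Set ℝ) (r : ℝ) : Prop :=
  ¬ NoSignChange f I ∧
    ∀ s t : ℝ, s < t → Icc s t ⊆ I → f s < 0 → 0 < f t → s < r ∧ r < t

/-- Assumption `H₁(α)` for `φ` in `Ωx × Ωy`. -/
def H1 (α : ℝ) (φ : ℝ × ℝ → ℝ) (Ωx Ωy : Set ℝ) : Prop :=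
  ∃ (N : ℕ) (om : Fin N → Set ℝ) (r : Fin N → ℝ → ℝ),
    (∀ j, IsOpen (om j)) ∧
    Pairwise (fun i j => Disjoint (om i) (om j)) ∧
    (∀ j, ContDiffOn ℝ 1 (r j) (om j)) ∧
    (⋃ j, closure (om j)) = closure Ωy ∧
    (∀ j, ∀ y ∈ om j,
      NoSignChange (fun s => dx φ (s, y)) Ωx ∨
      (ChangesSignOnlyAt (fun s => dx φ (s, y)) Ωx (r j y) ∧
        NoSignChange (fun s => dy φ (r j y, s)) Ωy)) ∧
    (∀ j, ∀ y ∈ om j, α ≤ |deriv (r j) y|)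

/-- Assumption `H₂(α)` for `φ` in `Ωx × Ωy`: `H₁(α)` with the roles of the variables exchanged. -/
def H2 (α : ℝ) (φ : ℝ × ℝ → ℝ) (Ωx Ωy : Set ℝ) : Prop :=
  ∃ (N : ℕ) (U : Fin N → Set ℝ) (τ : Fin N → ℝ → ℝ),
    (∀ j, IsOpen (U j)) ∧
    Pairwise (fun i j => Disjoint (U i) (U j)) ∧
    (∀ j, ContDiffOn ℝ 1 (τ j) (U j)) ∧
    (⋃ j, closure (U j)) = closure Ωx ∧
    (∀ j, ∀ x ∈ U j,
      NoSignChange (fun s => dy φ (x, s)) Ωy ∨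
      (ChangesSignOnlyAt (fun s => dy φ (x, s)) Ωy (τ j x) ∧
        NoSignChange (fun s => dx φ (s, τ j x)) Ωx)) ∧
    (∀ j, ∀ x ∈ U j, α ≤ |deriv (τ j) x|)

/-- The operator `L₁ = ∂ₓ + λ (∂ₓφ)`. -/
def L1 (φ : ℝ × ℝ → ℝ) (lam : ℝ) (u : ℝ × ℝ → ℂ) (z : ℝ × ℝ) : ℂ :=
  dx u z + (lam * dx φ z) • u z

/-- The operator `L₂ = ∂_y + λ (∂_yφ)`. -/
def L2 (φ : ℝ × ℝ → ℝ) (lam : ℝ) (u : ℝ × ℝ → ℂ) (z : ℝ × ℝ) : ℂ :=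
  dy u z + (lam * dy φ z) • u z

/-- The `L²(ℝ²)` norm, as an extended nonnegative real. -/
def normL2 (f : ℝ × ℝ → ℂ) : ℝ≥0∞ := eLpNorm f 2 volume

/-- `C₀^∞(W)`: smooth complex-valued functions with compact support contained in `W`. -/
def testFunctions (W : Set (ℝ × ℝ)) : Set (ℝ × ℝ → ℂ) :=
  {u | ContDiff ℝ ∞ u ∧ HasCompactSupport u ∧ tsupport u ⊆ W}

end WittenSystem

end

/-! Put ψ = λφ. Since ∂ₓ(e^ψ u) = e^ψ L₁u, and likewise in y, |u| at a point is bounded along any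
path of horizontal and vertical segments: by |u| at the end times e^(ψ(end) - ψ(start)), plus the
integral of e^(ψ - ψ(start)) times |L₁u| or |L₂u|. The core is a pointwise bound of |∂ₓψ||u| by
maximal functions (`exists_potX_le`), whose constants depend only on the degree and on a geometric
constant L that does not change when φ is multiplied by λ > 0.

From (x, y), walk horizontally in the direction in which ψ decreases. If ∂ₓψ keeps its sign up to
the edge of the box, where u = 0, polynomial inequalities make the weight decay at a rate comparable
to |∂ₓψ(x, y)|, and the integral is a maximal function. Otherwise the walk meets a valley point r,
and by condition (ii) ψ(r, ·) is nonincreasing upwards or downwards. Take the square of half side w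
about (r, y) on which |ψ(t, s) - ψ(r, s)| first reaches a level κ. If it is never exceeded at the
scale of the box, the weight is essentially constant there. If it is reached, go on to r + wX and
then vertically to a landing point of the square; the L₁u and L₂u terms lose only a factor depending
on κ. With b = (ψ - ψ(r, y))/κ in rescaled coordinates, the end term is averaged against |∂_X b|
min(1, b⁻). Since b⁻ e^(κb) ≤ 1/κ and |∂_X b| = w|∂ₓψ|/κ, it becomes (C₀/κ) times an iterated
maximal function of (∂ₓψ)u, with C₀ independent of κ. The L² maximal inequality and a large κ absorb
it (`exists_lintegral_potX_sq_le`).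

The average is useful only if the total landing weight is bounded below
(`exists_le_integral_landingWeight`). This is a compactness argument in a finite-dimensional space
of polynomials: the bad case is b ≥ 0 with b(0, ·) = 0, a valley that stands still. Condition (iii)
excludes it, since valleys move with speed at least α; `exists_noStay` turns this into a closed,
scale-invariant condition, using that off finitely many heights a crossing is a simple root of an
auxiliary polynomial.

Under H₂ the y-estimate follows by exchanging the variables. The gain in (1) comes from averaging on
the scale h = λ^(-1/(k+1)): where a derivative of order j + 1 ≤ k + 1 is bounded below, the mean of
|λ∂ₓφ| over [x, x + h] is at least of order 1/h. -/

open WittenSystem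

/-! ### The maximal function on the line and its L² bound -/

/-- The Hardy–Littlewood maximal function on the line, with rational radii. -/
noncomputable def hlMax (f : ℝ → ℝ≥0∞) (x : ℝ) : ℝ≥0∞ :=
  ⨆ q : {q : ℚ // 0 < q},
    (∫⁻ t in Icc (x - (q : ℚ)) (x + (q : ℚ)), f t) / ENNReal.ofReal (2 * (q : ℚ))

/-- An arbitrary radius `h` is replaced by a rational one below `2 * h`, whence the constant 4
instead of 2. -/
lemma lintegral_Icc_le_hlMax (f : ℝ → ℝ≥0∞) (x : ℝ) {h : ℝ} (hh : 0 < h) :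
    ∫⁻ t in Icc (x - h) (x + h), f t ≤ ENNReal.ofReal (4 * h) * hlMax f x := by
  obtain ⟨q, hq1, hq2⟩ := exists_rat_btwn (show h < 2 * h by linarith)
  have hq0 : (0 : ℝ) < q := hh.trans hq1
  have hq0' : (0 : ℚ) < q := by exact_mod_cast hq0
  have h1 : (∫⁻ t in Icc (x - (q : ℝ)) (x + q), f t) / ENNReal.ofReal (2 * q) ≤ hlMax f x :=
    le_iSup (fun q : {q : ℚ // 0 < q} =>
      (∫⁻ t in Icc (x - (q : ℚ)) (x + (q : ℚ)), f t) / ENNReal.ofReal (2 * (q : ℚ))) ⟨q, hq0'⟩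
  rw [ENNReal.div_le_iff (by simpa using hq0) ENNReal.ofReal_ne_top] at h1
  calc ∫⁻ t in Icc (x - h) (x + h), f t ≤ ∫⁻ t in Icc (x - (q : ℝ)) (x + q), f t :=
        lintegral_mono_set (Icc_subset_Icc (by linarith) (by linarith))
    _ ≤ _ := h1
    _ ≤ _ := by
        rw [mul_comm]
        exact mul_le_mul_left (ENNReal.ofReal_le_ofReal (by linarith)) _

/-- The weak-type (1,1) bound by the Vitali covering lemma. Any enlargement factor above 3 would do;
the choice 4 is the constant in the conclusion. -/
lemma volume_hlMax_gt_le (f : ℝ → ℝ≥0∞) {t : ℝ≥0∞} (ht : t ≠ 0) (ht' : t ≠ ⊤) :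
    t * volume {x | t < hlMax f x} ≤ 4 * ∫⁻ x, f x := by
  by_cases hf : ∫⁻ x, f x = ⊤
  · simp [hf]
  have key : ∀ x ∈ {x | t < hlMax f x}, ∃ q : ℚ, 0 < q ∧
      t * ENNReal.ofReal (2 * q) < ∫⁻ y in Icc (x - (q : ℝ)) (x + q), f y := by
    intro x hx
    obtain ⟨⟨q, hq⟩, h⟩ := lt_iSup_iff.1 (show t < hlMax f x by simpa using hx)
    have hq0 : (0 : ℝ) < q := by exact_mod_cast hq
    refine ⟨q, hq, ?_⟩
    rwa [ENNReal.lt_div_iff_mul_lt (Or.inl (by simpa using hq0))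
      (Or.inl ENNReal.ofReal_ne_top)] at h
  choose! q hq0 hq using key
  have hqR : ∀ x ∈ {x | t < hlMax f x}, (q x : ℝ) ≤ ((∫⁻ x, f x) / t).toReal := by
    intro x hx
    have h0 : (0 : ℝ) < q x := by exact_mod_cast hq0 x hx
    have h1 : ENNReal.ofReal (q x) ≤ (∫⁻ x, f x) / t := by
      rw [ENNReal.le_div_iff_mul_le (Or.inl ht) (Or.inl ht'), mul_comm]
      calc t * ENNReal.ofReal (q x) ≤ t * ENNReal.ofReal (2 * q x) := by gcongr; linarith
        _ ≤ _ := (hq x hx).le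
        _ ≤ _ := setLIntegral_le_lintegral _ _
    exact (ENNReal.ofReal_le_iff_le_toReal (ENNReal.div_ne_top hf ht)).1 h1
  obtain ⟨u, hu, hdisj, hcov⟩ := Vitali.exists_disjoint_subfamily_covering_enlargement_closedBall
    {x | t < hlMax f x} (fun x : ℝ => x) (fun x => (q x : ℝ)) _ hqR 4 (by norm_num)
  have hcount : u.Countable := by
    apply hdisj.countable_of_nonempty_interior
    intro x hx
    have h0 : (0 : ℝ) < q x := by exact_mod_cast hq0 x (hu hx)
    exact ⟨x, Metric.ball_subset_interior_closedBall (Metric.mem_ball_self h0)⟩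
  have hsub : {x | t < hlMax f x} ⊆ ⋃ b ∈ u, Metric.closedBall b (4 * q b) := by
    intro x hx
    obtain ⟨b, hb, h⟩ := hcov x hx
    have h0 : (0 : ℝ) < q x := by exact_mod_cast hq0 x hx
    exact mem_iUnion₂.2 ⟨b, hb, h (Metric.mem_closedBall_self h0.le)⟩
  calc t * volume {x | t < hlMax f x}
      ≤ t * ∑' b : u, volume (Metric.closedBall (b : ℝ) (4 * q b)) := by
        gcongr
        exact (measure_mono hsub).trans (measure_biUnion_le _ hcount _)
    _ = ∑' b : u, 4 * (t * ENNReal.ofReal (2 * q b)) := by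
        rw [← ENNReal.tsum_mul_left]
        congr 1 with b
        rw [Real.volume_closedBall, show (2 * (4 * (q b : ℝ))) = 4 * (2 * q b) by ring,
          ENNReal.ofReal_mul (by norm_num)]
        simp only [ENNReal.ofReal_ofNat]
        ring
    _ ≤ ∑' b : u, 4 * ∫⁻ y in Metric.closedBall (b : ℝ) (q b), f y := by
        gcongr with b
        rw [Real.closedBall_eq_Icc]
        exact (hq b (hu b.2)).le
    _ = 4 * ∫⁻ y in ⋃ b ∈ u, Metric.closedBall (b : ℝ) (q b), f y := by
        rw [ENNReal.tsum_mul_left, lintegral_biUnion hcount (fun _ _ => measurableSet_closedBall)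
          hdisj]
    _ ≤ _ := by gcongr; exact Measure.restrict_le_self

lemma hlMax_mono {f g : ℝ → ℝ≥0∞} (h : ∀ x, f x ≤ g x) (x : ℝ) : hlMax f x ≤ hlMax g x := by
  unfold hlMax
  gcongr with q t
  exact h t

lemma hlMax_le_of_le_const {f : ℝ → ℝ≥0∞} {c : ℝ≥0∞} (h : ∀ x, f x ≤ c) (x : ℝ) :
    hlMax f x ≤ c := by
  refine iSup_le fun q => ?_
  have hq : (0 : ℝ) < (q : ℚ) := by exact_mod_cast q.2
  rw [ENNReal.div_le_iff (by simpa using hq) ENNReal.ofReal_ne_top]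
  calc ∫⁻ t in Icc (x - (q : ℚ)) (x + (q : ℚ)), f t
      ≤ ∫⁻ t in Icc (x - (q : ℚ)) (x + (q : ℚ)), c := by gcongr with t; exact h t
    _ = _ := by
        rw [setLIntegral_const, Real.volume_Icc]
        congr 2
        ring

lemma hlMax_add_le {f g : ℝ → ℝ≥0∞} (hf : Measurable f) (x : ℝ) :
    hlMax (fun t => f t + g t) x ≤ hlMax f x + hlMax g x := by
  refine iSup_le fun q => ?_
  rw [lintegral_add_left hf, ENNReal.add_div]
  exact add_le_add (le_iSup (fun q : {q : ℚ // 0 < q} =>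
      (∫⁻ t in Icc (x - (q : ℚ)) (x + (q : ℚ)), f t) / ENNReal.ofReal (2 * (q : ℚ))) q)
    (le_iSup (fun q : {q : ℚ // 0 < q} =>
      (∫⁻ t in Icc (x - (q : ℚ)) (x + (q : ℚ)), g t) / ENNReal.ofReal (2 * (q : ℚ))) q)

lemma lintegral_Ioo_two_mul {b : ℝ} (hb : 0 ≤ b) :
    ∫⁻ t in Ioo 0 b, ENNReal.ofReal (2 * t) = ENNReal.ofReal (b ^ 2) := by
  rw [← ofReal_integral_eq_lintegral_ofReal]
  · rw [← integral_Ioc_eq_integral_Ioo, ← intervalIntegral.integral_of_le hb]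
    rw [intervalIntegral.integral_const_mul, integral_id]
    congr 1
    ring
  · exact ((continuous_const.mul continuous_id).integrableOn_Icc (a := 0) (b := b)).mono_set
      Ioo_subset_Icc_self
  · filter_upwards [ae_restrict_mem measurableSet_Ioo] with t ht
    have := ht.1
    simp; linarith

/-- One half of the layer-cake formula. Testing with finite `b` below `a` also covers `a = ⊤`. -/
lemma sq_le_lintegral_indicator (a : ℝ≥0∞) :
    a ^ 2 ≤ ∫⁻ t in Ioi (0 : ℝ), ENNReal.ofReal (2 * t) *
      {s : ℝ | ENNReal.ofReal s < a}.indicator 1 t := by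
  have key : ∀ b : ℝ, 0 ≤ b → ENNReal.ofReal b ≤ a → ENNReal.ofReal b ^ 2 ≤
      ∫⁻ t in Ioi (0 : ℝ), ENNReal.ofReal (2 * t) *
      {s : ℝ | ENNReal.ofReal s < a}.indicator 1 t := by
    intro b hb hba
    rw [← ENNReal.ofReal_pow hb, ← lintegral_Ioo_two_mul hb]
    calc ∫⁻ t in Ioo 0 b, ENNReal.ofReal (2 * t) = ∫⁻ t in Ioo 0 b, ENNReal.ofReal (2 * t) *
          {s : ℝ | ENNReal.ofReal s < a}.indicator 1 t := by
          refine setLIntegral_congr_fun measurableSet_Ioo fun t ht => ?_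
          have : ENNReal.ofReal t < a := lt_of_lt_of_le
            ((ENNReal.ofReal_lt_ofReal_iff (ht.1.trans ht.2)).2 ht.2) hba
          simp [this]
      _ ≤ _ := lintegral_mono_set Ioo_subset_Ioi_self
  by_cases ha : a = ⊤
  · subst ha
    have h1 : ∀ n : ℕ, (n : ℝ≥0∞) ≤ ∫⁻ t in Ioi (0 : ℝ), ENNReal.ofReal (2 * t) *
        {s : ℝ | ENNReal.ofReal s < ⊤}.indicator 1 t := by
      intro n
      refine le_trans ?_ (key n (by positivity) le_top)
      rw [ENNReal.ofReal_natCast]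
      exact_mod_cast Nat.le_self_pow two_ne_zero n
    rw [ENNReal.eq_top_of_forall_nnreal_le (x := ∫⁻ t in Ioi (0 : ℝ), ENNReal.ofReal (2 * t) *
        {s : ℝ | ENNReal.ofReal s < ⊤}.indicator 1 t)]
    · exact le_top
    · intro r
      obtain ⟨n, hn⟩ := exists_nat_ge r
      exact le_trans (by exact_mod_cast hn) (h1 n)
  · have := key a.toReal ENNReal.toReal_nonneg (by rw [ENNReal.ofReal_toReal ha])
    rwa [ENNReal.ofReal_toReal ha] at this

/-- Rational radii make the supremum countable. The parameter is what allows maximal functions in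
one variable of a function on the plane. -/
lemma measurable_hlMax_param {α : Type*} [MeasurableSpace α] {F : ℝ → α → ℝ≥0∞}
    (hF : Measurable (fun p : ℝ × α => F p.1 p.2)) :
    Measurable (fun p : ℝ × α => hlMax (fun t => F t p.2) p.1) := by
  refine Measurable.iSup fun q => Measurable.div_const ?_ _
  have h : ∀ p : ℝ × α, ∫⁻ t in Icc (p.1 - (q : ℚ)) (p.1 + (q : ℚ)), F t p.2 =
      ∫⁻ t, {r : (ℝ × α) × ℝ | r.2 ∈ Icc (r.1.1 - (q : ℚ)) (r.1.1 + (q : ℚ))}.indicator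
        (fun r => F r.2 r.1.2) (p, t) := by
    intro p
    rw [← lintegral_indicator measurableSet_Icc]
    rfl
  simp_rw [h]
  refine Measurable.lintegral_prod_right' (f := fun r : (ℝ × α) × ℝ =>
    {r : (ℝ × α) × ℝ | r.2 ∈ Icc (r.1.1 - (q : ℚ)) (r.1.1 + (q : ℚ))}.indicator
        (fun r => F r.2 r.1.2) r) ?_
  refine Measurable.indicator (hF.comp (measurable_snd.prodMk measurable_fst.snd)) ?_
  have h1 : MeasurableSet {r : (ℝ × α) × ℝ | r.1.1 - (q : ℚ) ≤ r.2} :=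
    measurableSet_le (by fun_prop) (by fun_prop)
  have h2 : MeasurableSet {r : (ℝ × α) × ℝ | r.2 ≤ r.1.1 + (q : ℚ)} :=
    measurableSet_le (by fun_prop) (by fun_prop)
  exact h1.inter h2

lemma measurable_hlMax_fst {f : ℝ → ℝ≥0∞} (hf : Measurable f) :
    Measurable (fun p : ℝ × ℝ => hlMax f p.1) :=
  measurable_hlMax_param (F := fun t (_ : ℝ) => f t) (hf.comp measurable_fst)

lemma measurable_hlMax {f : ℝ → ℝ≥0∞} (hf : Measurable f) : Measurable (hlMax f) := by
  have h2 : Measurable fun x : ℝ => (x, (0 : ℝ)) := by fun_prop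
  have h4 := measurable_hlMax_fst hf
  generalize hlMax f = g at *
  exact h4.comp h2

/-- The part of `f` below `t / 2` contributes at most `t / 2` to the maximal function, so the
weak-type bound at level `t / 2` is needed only for the part above. This is the interpolation step
between weak type (1,1) and the trivial bound in L^∞. -/
lemma volume_hlMax_gt_le_truncated {f : ℝ → ℝ≥0∞} (hf : Measurable f) {t : ℝ} (ht : 0 < t) :
    ENNReal.ofReal (2 * t) * volume {x | ENNReal.ofReal t < hlMax f x} ≤
      16 * ∫⁻ x, {x | ENNReal.ofReal (t / 2) < f x}.indicator f x := by
  set c := ENNReal.ofReal (t / 2) with hc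
  have hmeas : MeasurableSet {x | c < f x} := measurableSet_lt measurable_const hf
  have hsub : {x | ENNReal.ofReal t < hlMax f x} ⊆
      {x | c < hlMax ({x | c < f x}.indicator f) x} := by
    intro x hx
    by_contra hcon
    have h1 : hlMax f x ≤ hlMax ({x | c < f x}.indicator f) x + hlMax (fun _ => c) x := by
      refine (hlMax_mono (fun y => ?_) x).trans (hlMax_add_le (hf.indicator hmeas) x)
      by_cases hy : c < f y
      · simp [hy]
      · simpa [hy] using not_lt.1 hy
    have h2 := hlMax_le_of_le_const (f := fun _ => c) (c := c) (fun _ => le_rfl) x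
    have h3 : hlMax f x ≤ c + c := h1.trans (add_le_add (not_lt.1 hcon) h2)
    rw [hc, ← ENNReal.ofReal_add (by linarith) (by linarith), add_halves] at h3
    exact absurd hx (not_lt.2 h3)
  have h := volume_hlMax_gt_le ({x | c < f x}.indicator f) (t := c)
    (by simp [hc, ht]) ENNReal.ofReal_ne_top
  calc ENNReal.ofReal (2 * t) * volume {x | ENNReal.ofReal t < hlMax f x}
      ≤ (4 * c) * volume {x | c < hlMax ({x | c < f x}.indicator f) x} := by
        gcongr
        rw [hc, show (2 * t) = 4 * (t / 2) by ring, ENNReal.ofReal_mul (by norm_num)]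
        simp
    _ = 4 * (c * volume {x | c < hlMax ({x | c < f x}.indicator f) x}) := by ring
    _ ≤ 4 * (4 * _) := by gcongr
    _ = _ := by rw [← mul_assoc]; norm_num

/-- The maximal inequality in `L²`. -/
theorem lintegral_hlMax_sq_le {f : ℝ → ℝ≥0∞} (hf : Measurable f) :
    ∫⁻ x, hlMax f x ^ 2 ≤ 32 * ∫⁻ x, f x ^ 2 := by
  have hM := measurable_hlMax hf
  -- Tonelli in the form needed twice: for the superlevel sets of `hlMax f` and, in the opposite
  -- direction, for those of `f`.
  have hswap : ∀ (g : ℝ → ℝ≥0∞) (c : ℝ → ℝ≥0∞) (k : ℝ → ℝ≥0∞) (l : ℝ → ℝ), Measurable g →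
      Measurable c → Measurable k → Measurable l →
      ∫⁻ x, ∫⁻ t in Ioi (0 : ℝ), c t * (k x * {s : ℝ | ENNReal.ofReal (l s) < g x}.indicator 1 t) =
      ∫⁻ t in Ioi (0 : ℝ), c t *
        ∫⁻ x, (k x * {y : ℝ | ENNReal.ofReal (l t) < g y}.indicator 1 x) := by
    intro g c k l hg hc hk hl
    have hset : MeasurableSet {p : ℝ × ℝ | ENNReal.ofReal (l p.2) < g p.1} :=
      measurableSet_lt (by fun_prop) (by fun_prop)
    have hm : Measurable fun p : ℝ × ℝ => c p.2 * (k p.1 *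
        {p : ℝ × ℝ | ENNReal.ofReal (l p.2) < g p.1}.indicator 1 p) :=
      (hc.comp measurable_snd).mul ((hk.comp measurable_fst).mul (measurable_one.indicator hset))
    rw [lintegral_lintegral_swap]
    · refine lintegral_congr fun t => ?_
      rw [← lintegral_const_mul]
      · rfl
      · exact hk.mul (measurable_one.indicator (measurableSet_lt measurable_const hg))
    · exact hm.aemeasurable
  calc ∫⁻ x, hlMax f x ^ 2
      ≤ ∫⁻ x, ∫⁻ t in Ioi (0 : ℝ), ENNReal.ofReal (2 * t) *
        (1 * {s : ℝ | ENNReal.ofReal s < hlMax f x}.indicator 1 t) := by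
        simp only [one_mul]
        exact lintegral_mono fun x => sq_le_lintegral_indicator _
    _ = ∫⁻ t in Ioi (0 : ℝ), ENNReal.ofReal (2 * t) *
        ∫⁻ x, (1 * {y : ℝ | ENNReal.ofReal t < hlMax f y}.indicator 1 x) :=
        hswap (hlMax f) _ (fun _ => 1) (fun s => s) hM (by fun_prop) (by fun_prop) (by fun_prop)
    _ ≤ ∫⁻ t in Ioi (0 : ℝ), 16 * ∫⁻ x, (f x *
        {y : ℝ | ENNReal.ofReal (t / 2) < f y}.indicator 1 x) := by
        refine setLIntegral_mono' measurableSet_Ioi fun t ht => ?_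
        simp only [one_mul]
        rw [lintegral_indicator_one (measurableSet_lt measurable_const hM)]
        refine (volume_hlMax_gt_le_truncated hf ht).trans_eq ?_
        congr 2 with x
        by_cases hx : ENNReal.ofReal (t / 2) < f x <;> simp [hx]
    _ = ∫⁻ x, ∫⁻ t in Ioi (0 : ℝ), 16 * (f x *
        {s : ℝ | ENNReal.ofReal (s / 2) < f x}.indicator 1 t) :=
        (hswap f (fun _ => 16) f (fun s => s / 2) hf (by fun_prop) hf (by fun_prop)).symm
    _ ≤ ∫⁻ x, 32 * f x ^ 2 := by
        refine lintegral_mono fun x => ?_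
        have hms : MeasurableSet {s : ℝ | ENNReal.ofReal (s / 2) < f x} :=
          measurableSet_lt (by fun_prop) measurable_const
        -- The admissible levels form an interval of length `2 * f x`, which turns the constant 16
        -- into 32.
        have h1 : ∫⁻ t in Ioi (0 : ℝ), {s : ℝ | ENNReal.ofReal (s / 2) < f x}.indicator
            (1 : ℝ → ℝ≥0∞) t ≤ 2 * f x := by
          rw [lintegral_indicator_one hms, Measure.restrict_apply hms]
          by_cases hx : f x = ⊤
          · simp [hx]
          · calc volume ({s : ℝ | ENNReal.ofReal (s / 2) < f x} ∩ Ioi 0)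
                ≤ volume (Ioo 0 (2 * (f x).toReal)) := by
                  refine measure_mono fun s hs => ⟨hs.2, ?_⟩
                  have := (ENNReal.ofReal_lt_iff_lt_toReal (by have := hs.2; simp at this; linarith)
                    hx).1 hs.1
                  linarith
              _ = _ := by
                  rw [Real.volume_Ioo, sub_zero, ENNReal.ofReal_mul (by norm_num),
                    ENNReal.ofReal_toReal hx]
                  simp
        rw [lintegral_const_mul _ (by exact measurable_const.mul (measurable_one.indicator hms)),
          lintegral_const_mul _ (measurable_one.indicator hms)]
        calc 16 * (f x * _) ≤ 16 * (f x * (2 * f x)) := by gcongr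
          _ = _ := by ring
    _ = _ := by rw [lintegral_const_mul _ (by fun_prop)]

/-! ### Maximal functions in the plane, and integrals that they control -/

/-- The maximal function in the first variable. -/
noncomputable def maxX (F : ℝ × ℝ → ℝ≥0∞) (z : ℝ × ℝ) : ℝ≥0∞ := hlMax (fun t => F (t, z.2)) z.1

/-- The maximal function in the second variable. -/
noncomputable def maxY (F : ℝ × ℝ → ℝ≥0∞) (z : ℝ × ℝ) : ℝ≥0∞ := hlMax (fun t => F (z.1, t)) z.2

lemma measurable_maxX {F : ℝ × ℝ → ℝ≥0∞} (hF : Measurable F) : Measurable (maxX F) :=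
  measurable_hlMax_param (F := fun t y => F (t, y)) hF

lemma measurable_maxY {F : ℝ × ℝ → ℝ≥0∞} (hF : Measurable F) : Measurable (maxY F) := by
  have h : Measurable (maxX fun z => F z.swap) := measurable_maxX (hF.comp measurable_swap)
  have h2 := h.comp measurable_swap
  exact h2

lemma lintegral_maxX_sq_le {F : ℝ × ℝ → ℝ≥0∞} (hF : Measurable F) :
    ∫⁻ z, maxX F z ^ 2 ≤ 32 * ∫⁻ z, F z ^ 2 := by
  rw [Measure.volume_eq_prod, lintegral_prod_symm _ ((measurable_maxX hF).pow_const 2).aemeasurable,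
    lintegral_prod_symm _ (hF.pow_const 2).aemeasurable, ← lintegral_const_mul']
  · refine lintegral_mono fun y => ?_
    have hy : Measurable fun t : ℝ => F (t, y) := hF.comp (by fun_prop)
    exact lintegral_hlMax_sq_le hy
  · simp

lemma lintegral_maxY_sq_le {F : ℝ × ℝ → ℝ≥0∞} (hF : Measurable F) :
    ∫⁻ z, maxY F z ^ 2 ≤ 32 * ∫⁻ z, F z ^ 2 := by
  rw [Measure.volume_eq_prod, lintegral_prod _ ((measurable_maxY hF).pow_const 2).aemeasurable,
    lintegral_prod _ (hF.pow_const 2).aemeasurable, ← lintegral_const_mul']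
  · refine lintegral_mono fun x => ?_
    have hy : Measurable fun t : ℝ => F (x, t) := hF.comp (by fun_prop)
    exact lintegral_hlMax_sq_le hy
  · simp

lemma lintegral_comp_affine (g : ℝ → ℝ≥0∞) (r : ℝ) {c : ℝ} (hc : c ≠ 0) :
    ∫⁻ t, g (r + c * t) = ENNReal.ofReal |c⁻¹| * ∫⁻ t, g t := by
  have h := (Homeomorph.mulLeft₀ c hc).measurableEmbedding.lintegral_map (μ := volume)
    (fun t => g (r + t))
  simp only [Homeomorph.coe_mulLeft₀] at h
  rw [← h, Real.map_volume_mul_left hc, lintegral_smul_measure, lintegral_add_left_eq_self]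
  rfl

/-- The interval of radius `|c|` about `r` lies in the one of radius `|x - r| + |c|` about `x`. This
transfers averages near a valley point `r` to the point `x`; the loss `(|x - r| + |c|) / |c|` is
recovered later from the height of the weight above the valley. -/
lemma lintegral_Icc_affine_le_hlMax (f : ℝ → ℝ≥0∞) (x r : ℝ) {c : ℝ} (hc : c ≠ 0) :
    ∫⁻ t in Icc (-1 : ℝ) 1, f (r + c * t) ≤
      ENNReal.ofReal (4 * (|x - r| + |c|) / |c|) * hlMax f x := by
  have hc' : 0 < |c| := abs_pos.2 hc
  have hpos : 0 < |x - r| + |c| := by positivity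
  rw [← lintegral_indicator measurableSet_Icc]
  calc ∫⁻ t, (Icc (-1 : ℝ) 1).indicator (fun t => f (r + c * t)) t
      ≤ ∫⁻ t, (Icc (x - (|x - r| + |c|)) (x + (|x - r| + |c|))).indicator f (r + c * t) := by
        refine lintegral_mono fun t => ?_
        by_cases ht : t ∈ Icc (-1 : ℝ) 1
        · have h1 : |c * t| ≤ |c| := by
            rw [abs_mul]
            exact mul_le_of_le_one_right hc'.le (abs_le.2 ht)
          have h2 := abs_le.1 h1
          have h3 := abs_le.1 (le_refl |x - r|)
          rw [indicator_of_mem ht, indicator_of_mem]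
          constructor <;> linarith [h2.1, h2.2, h3.1, h3.2]
        · rw [indicator_of_notMem ht]
          exact zero_le
    _ = ENNReal.ofReal |c⁻¹| * ∫⁻ t in Icc (x - (|x - r| + |c|)) (x + (|x - r| + |c|)), f t := by
        rw [lintegral_comp_affine _ r hc, lintegral_indicator measurableSet_Icc]
    _ ≤ ENNReal.ofReal |c⁻¹| * (ENNReal.ofReal (4 * (|x - r| + |c|)) * hlMax f x) := by
        gcongr
        exact lintegral_Icc_le_hlMax f x hpos
    _ = _ := by
        rw [← mul_assoc, ← ENNReal.ofReal_mul (abs_nonneg _), abs_inv]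
        congr 2
        field_simp

/-- Cut the line according to the integer part `n` of `a * |x - t|`: the weight is at most `exp
(-n)` on an interval of radius `(n + 1) / a`, and the resulting series converges. -/
lemma exists_lintegral_exp_le_hlMax : ∃ C : ℝ, 0 < C ∧ ∀ (f : ℝ → ℝ≥0∞), Measurable f →
    ∀ (x a : ℝ), 0 < a →
    ∫⁻ t, ENNReal.ofReal (Real.exp (-(a * |x - t|))) * f t ≤
      ENNReal.ofReal (C / a) * hlMax f x := by
  have hsum : Summable fun n : ℕ => Real.exp (-(n : ℝ)) * (4 * ((n : ℝ) + 1)) := by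
    have h1 := Real.summable_pow_mul_exp_neg_nat_mul 1 (r := 1) one_pos
    have h0 := Real.summable_pow_mul_exp_neg_nat_mul 0 (r := 1) one_pos
    refine ((h1.add h0).mul_left 4).congr fun n => ?_
    simp
    ring
  have hnn : ∀ n : ℕ, 0 ≤ Real.exp (-(n : ℝ)) * (4 * ((n : ℝ) + 1)) := fun n => by positivity
  refine ⟨∑' n : ℕ, Real.exp (-(n : ℝ)) * (4 * ((n : ℝ) + 1)),
    hsum.tsum_pos hnn 0 (by simp), fun f hf x a ha => ?_⟩
  calc ∫⁻ t, ENNReal.ofReal (Real.exp (-(a * |x - t|))) * f t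
      ≤ ∫⁻ t, ∑' n : ℕ, ENNReal.ofReal (Real.exp (-(n : ℝ))) *
          (Icc (x - (n + 1) / a) (x + (n + 1) / a)).indicator f t := by
        refine lintegral_mono fun t => ?_
        set n := ⌊a * |x - t|⌋₊ with hn
        have hz : 0 ≤ a * |x - t| := by positivity
        have h1 : (n : ℝ) ≤ a * |x - t| := Nat.floor_le hz
        have h2 : a * |x - t| < n + 1 := Nat.lt_floor_add_one _
        have h3 : |x - t| ≤ (n + 1) / a := by
          rw [le_div_iff₀ ha]
          linarith
        have h4 := abs_le.1 h3
        refine le_trans ?_ (ENNReal.le_tsum n)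
        rw [indicator_of_mem (by constructor <;> linarith [h4.1, h4.2])]
        gcongr
    _ = ∑' n : ℕ, ENNReal.ofReal (Real.exp (-(n : ℝ))) *
          ∫⁻ t in Icc (x - (n + 1) / a) (x + (n + 1) / a), f t := by
        rw [lintegral_tsum fun n =>
          ((hf.indicator measurableSet_Icc).const_mul _).aemeasurable]
        congr 1 with n
        rw [lintegral_const_mul _ (hf.indicator measurableSet_Icc),
          lintegral_indicator measurableSet_Icc]
    _ ≤ ∑' n : ℕ, ENNReal.ofReal (Real.exp (-(n : ℝ))) *
          (ENNReal.ofReal (4 * ((n + 1) / a)) * hlMax f x) := by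
        gcongr with n
        exact lintegral_Icc_le_hlMax f x (by positivity)
    _ = ∑' n : ℕ, ENNReal.ofReal (Real.exp (-(n : ℝ)) * (4 * ((n : ℝ) + 1))) *
          (ENNReal.ofReal a⁻¹ * hlMax f x) := by
        congr 1 with n
        rw [← mul_assoc, ← mul_assoc, ← ENNReal.ofReal_mul (by positivity),
          ← ENNReal.ofReal_mul (by positivity)]
        congr 2
        field_simp
    _ = _ := by
        rw [ENNReal.tsum_mul_right, ← ENNReal.ofReal_tsum_of_nonneg hnn hsum, ← mul_assoc,
          ← ENNReal.ofReal_mul (tsum_nonneg hnn), div_eq_mul_inv]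

/-! ### Polynomial inequalities in one variable -/

lemma exists_pos_mul_norm_le {E : Type*} [NormedAddCommGroup E] [NormedSpace ℝ E]
    [FiniteDimensional ℝ E] (f : E → ℝ) (hf : Continuous f) (hs : ∀ (t : ℝ) a, f (t • a) = |t| * f a)
    (hpos : ∀ a, a ≠ 0 → 0 < f a) : ∃ c : ℝ, 0 < c ∧ ∀ a, c * ‖a‖ ≤ f a := by
  rcases subsingleton_or_nontrivial E with hE | hE
  · refine ⟨1, one_pos, fun a => ?_⟩
    have h0 := hs 0 0
    rw [Subsingleton.elim a 0]
    simp at h0 ⊢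
    exact h0.ge
  · obtain ⟨a0, ha0, hmin⟩ := (isCompact_sphere (0 : E) 1).exists_isMinOn
      (NormedSpace.sphere_nonempty.2 zero_le_one) hf.continuousOn
    have ha0' : ‖a0‖ = 1 := by simpa using ha0
    refine ⟨f a0, hpos a0 (by intro h; simp [h] at ha0'), fun a => ?_⟩
    by_cases ha : a = 0
    · have h0 := hs 0 0
      subst ha
      simp at h0 ⊢
      exact h0.ge
    · have hn : 0 < ‖a‖ := norm_pos_iff.2 ha
      have h1 : f a0 ≤ f (‖a‖⁻¹ • a) := hmin (by simp [norm_smul, hn.ne'])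
      rw [hs, abs_of_pos (inv_pos.2 hn)] at h1
      calc f a0 * ‖a‖ ≤ (‖a‖⁻¹ * f a) * ‖a‖ := by gcongr
        _ = f a := by field_simp

section OneVariable

open Polynomial

lemma coeff_eq_zero_of_infinite {m : ℕ} {a : Fin (m + 1) → ℝ} {S : Set ℝ} (hS : S.Infinite)
    (h : ∀ t ∈ S, ∑ i, a i * t ^ (i : ℕ) = 0) : a = 0 := by
  let p : ℝ[X] := ∑ i : Fin (m + 1), Polynomial.monomial i (a i)
  have hp : ∀ t, p.eval t = ∑ i, a i * t ^ (i : ℕ) := fun t => by simp [p, eval_finsetSum]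
  have hp0 : p = 0 := by
    refine Polynomial.eq_zero_of_infinite_isRoot p (hS.mono fun t ht => ?_)
    change p.eval t = 0
    rw [hp, h t ht]
  ext i
  have h1 : p.coeff i = a i := by
    simp only [p, finsetSum_coeff, coeff_monomial]
    rw [Finset.sum_eq_single i]
    · simp
    · intro b _ hb
      rw [if_neg]
      exact fun h => hb (Fin.ext h)
    · simp
  rw [← h1, hp0]
  simp

/-- The mean of `|p|` over `[0, 1]` is homogeneous and vanishes only for `p = 0`, hence dominates
the coefficients on the finite-dimensional space of polynomials of bounded degree. All later
one-variable inequalities are rescalings of this one. -/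
lemma exists_coeff_le_integral (m : ℕ) : ∃ C : ℝ, 0 < C ∧ ∀ p : ℝ[X], p.natDegree ≤ m →
    ∀ i, |p.coeff i| ≤ C * ∫ t in (0 : ℝ)..1, |p.eval t| := by
  let P : (Fin (m + 1) → ℝ) → ℝ → ℝ := fun a t => ∑ i, a i * t ^ (i : ℕ)
  have hcont : Continuous (Function.uncurry fun a t => |P a t|) := by
    simp only [P, Function.uncurry_def]
    fun_prop
  obtain ⟨c, hc, h⟩ := exists_pos_mul_norm_le (fun a => ∫ t in (0 : ℝ)..1, |P a t|)
    (intervalIntegral.continuous_parametric_intervalIntegral_of_continuous' hcont 0 1)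
    (fun t a => by
      rw [← intervalIntegral.integral_const_mul]
      congr 1 with s
      rw [← abs_mul, Finset.mul_sum]
      simp [P, mul_assoc])
    (fun a ha => by
      have hcont' : Continuous fun t => |P a t| := by simp only [P]; fun_prop
      have hnn : 0 ≤ ∫ t in (0 : ℝ)..1, |P a t| :=
        intervalIntegral.integral_nonneg zero_le_one fun _ _ => abs_nonneg _
      refine hnn.lt_of_ne fun h0 => ha ?_
      by_contra hne
      refine hne (coeff_eq_zero_of_infinite (Ioo_infinite (zero_lt_one' ℝ)) fun t ht => ?_)
      by_contra hpt
      have hlt : ∫ t in (0 : ℝ)..1, (0 : ℝ) < ∫ t in (0 : ℝ)..1, |P a t| :=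
        intervalIntegral.integral_lt_integral_of_continuousOn_of_le_of_exists_lt zero_lt_one
          continuousOn_const hcont'.continuousOn (fun _ _ => abs_nonneg _)
          ⟨t, Ioo_subset_Icc_self ht, abs_pos.2 hpt⟩
      simp [← h0] at hlt)
  refine ⟨c⁻¹, inv_pos.2 hc, fun p hp i => ?_⟩
  have hPp : ∀ t, P (fun i => p.coeff i) t = p.eval t := fun t => by
    rw [eval_eq_sum_range' (Nat.lt_succ_of_le hp), ← Fin.sum_univ_eq_sum_range
      (fun i => p.coeff i * t ^ i)]
  have h1 := h (fun i => p.coeff i)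
  simp only [hPp] at h1
  rw [← div_eq_inv_mul, le_div_iff₀ hc, mul_comm]
  by_cases hi : i ≤ m
  · refine le_trans ?_ h1
    gcongr
    exact norm_le_pi_norm (fun i : Fin (m + 1) => p.coeff i) ⟨i, by omega⟩
  · rw [coeff_eq_zero_of_natDegree_lt (by omega)]
    simpa using intervalIntegral.integral_nonneg zero_le_one fun _ _ => abs_nonneg _

lemma abs_eval_le_of_coeff_le {p : ℝ[X]} {m : ℕ} (hp : p.natDegree ≤ m) {K : ℝ}
    (hK : ∀ i, |p.coeff i| ≤ K) {x : ℝ} (hx : x ∈ Icc (0 : ℝ) 1) :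
    |p.eval x| ≤ (m + 1) * K := by
  have hK0 : 0 ≤ K := (abs_nonneg _).trans (hK 0)
  rw [eval_eq_sum_range' (Nat.lt_succ_of_le hp)]
  calc |∑ i ∈ Finset.range (m + 1), p.coeff i * x ^ i|
      ≤ ∑ i ∈ Finset.range (m + 1), |p.coeff i * x ^ i| := Finset.abs_sum_le_sum_abs _ _
    _ ≤ ∑ i ∈ Finset.range (m + 1), K := by
        gcongr with i
        rw [abs_mul, abs_of_nonneg (pow_nonneg hx.1 _)]
        calc |p.coeff i| * x ^ i ≤ K * 1 := by
              gcongr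
              · exact pow_nonneg hx.1 _
              · exact hK i
              · exact pow_le_one₀ hx.1 hx.2
          _ = K := mul_one K
    _ = _ := by simp

lemma exists_eval_le_integral (m : ℕ) : ∃ C : ℝ, 0 < C ∧ ∀ p : ℝ[X], p.natDegree ≤ m →
    ∀ a b : ℝ, a < b → ∀ x ∈ Icc a b, (b - a) * |p.eval x| ≤ C * ∫ t in a..b, |p.eval t| := by
  obtain ⟨C, hC, h⟩ := exists_coeff_le_integral m
  refine ⟨(m + 1) * C, by positivity, fun p hp a b hab x hx => ?_⟩
  have hba : 0 < b - a := sub_pos.2 hab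
  let q : ℝ[X] := p.comp (Polynomial.C a + Polynomial.C (b - a) * X)
  have hq : q.natDegree ≤ m := by
    refine (natDegree_comp_le).trans ?_
    calc p.natDegree * _ ≤ p.natDegree * 1 := by
          gcongr
          compute_degree
      _ ≤ m := by simpa using hp
  have hqe : ∀ t, q.eval t = p.eval (a + (b - a) * t) := fun t => by simp [q]
  have h1 := abs_eval_le_of_coeff_le hq (h q hq) (x := (x - a) / (b - a))
    ⟨div_nonneg (by linarith [hx.1]) hba.le, (div_le_one hba).2 (by linarith [hx.2])⟩
  simp only [hqe] at h1
  rw [mul_div_cancel₀ _ hba.ne', add_sub_cancel] at h1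
  have h2 := intervalIntegral.smul_integral_comp_add_mul (fun t => |p.eval t|) (b - a) a
    (a := 0) (b := 1)
  simp only [mul_zero, add_zero, mul_one, add_sub_cancel, smul_eq_mul] at h2
  rw [← h2]
  generalize ∫ t in (0 : ℝ)..1, |p.eval (a + (b - a) * t)| = J at *
  calc (b - a) * |p.eval x| ≤ (b - a) * ((m + 1) * (C * J)) := by gcongr
    _ = _ := by ring

/-- A Markov inequality: after rescaling the interval to `[0, 1]`, the coefficients of the
derivative are controlled by those of the polynomial. -/
lemma exists_derivative_le (m : ℕ) : ∃ C : ℝ, 0 < C ∧ ∀ p : ℝ[X], p.natDegree ≤ m →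
    ∀ (a b M : ℝ), a < b → (∀ x ∈ Icc a b, |p.eval x| ≤ M) →
    ∀ x ∈ Icc a b, (b - a) * |p.derivative.eval x| ≤ C * M := by
  obtain ⟨C, hC, h⟩ := exists_coeff_le_integral m
  refine ⟨(m + 1) * ((m + 1) * C), by positivity, fun p hp a b M hab hM x hx => ?_⟩
  have hba : 0 < b - a := sub_pos.2 hab
  let q : ℝ[X] := p.comp (Polynomial.C a + Polynomial.C (b - a) * X)
  have hq : q.natDegree ≤ m := by
    refine (natDegree_comp_le).trans ?_
    calc p.natDegree * _ ≤ p.natDegree * 1 := by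
          gcongr
          compute_degree
      _ ≤ m := by simpa using hp
  have hqe : ∀ t, q.eval t = p.eval (a + (b - a) * t) := fun t => by simp [q]
  have hqd : ∀ t, q.derivative.eval t = (b - a) * p.derivative.eval (a + (b - a) * t) := fun t => by
    simp [q, derivative_comp]
  have hint : ∫ t in (0 : ℝ)..1, |q.eval t| ≤ M := by
    have h1 : ∫ t in (0 : ℝ)..1, |q.eval t| ≤ ∫ t in (0 : ℝ)..1, M := by
      refine intervalIntegral.integral_mono_on zero_le_one
        (q.continuous.abs.intervalIntegrable _ _) (by simp) fun t ht => ?_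
      rw [hqe]
      refine hM _ ⟨?_, ?_⟩
      · nlinarith [ht.1]
      · nlinarith [ht.2]
    simpa using h1
  have hM0 : 0 ≤ M := (abs_nonneg _).trans (hM x hx)
  have hK : ∀ i, |q.derivative.coeff i| ≤ (m + 1) * (C * M) := by
    intro i
    rw [coeff_derivative]
    by_cases hi : i + 1 ≤ m
    · rw [abs_mul, mul_comm]
      gcongr
      · rw [abs_of_nonneg (by positivity)]
        have : ((i + 1 : ℕ) : ℝ) ≤ m := by exact_mod_cast hi
        push_cast at this
        linarith
      · exact (h q hq _).trans (by gcongr)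
    · rw [coeff_eq_zero_of_natDegree_lt (by omega)]
      simp only [zero_mul, abs_zero]
      positivity
  have h1 := abs_eval_le_of_coeff_le (m := m) ((natDegree_derivative_le q).trans (by omega)) hK
    (x := (x - a) / (b - a))
    ⟨div_nonneg (by linarith [hx.1]) hba.le, (div_le_one hba).2 (by linarith [hx.2])⟩
  rw [hqd, mul_div_cancel₀ _ hba.ne', add_sub_cancel, abs_mul, abs_of_pos hba] at h1
  calc _ ≤ _ := h1
    _ = _ := by ring

/-- Growth of a primitive of a polynomial of one sign. -/
lemma exists_mul_le_primitive_sub (m : ℕ) : ∃ C : ℝ, 0 < C ∧ ∀ p : ℝ[X], p.natDegree ≤ m →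
    ∀ F : ℝ → ℝ, (∀ t, HasDerivAt F (p.eval t) t) → ∀ t x : ℝ,
    ((∀ s ∈ Icc t x, 0 ≤ p.eval s) ∧ t ≤ x ∨ (∀ s ∈ Icc x t, p.eval s ≤ 0) ∧ x ≤ t) →
    |p.eval x| * |x - t| ≤ C * (F x - F t) := by
  obtain ⟨C, hC, h⟩ := exists_eval_le_integral m
  refine ⟨C, hC, fun p hp F hF t x hs => ?_⟩
  have hint : ∀ a b, ∫ s in a..b, p.eval s = F b - F a := fun a b =>
    intervalIntegral.integral_eq_sub_of_hasDerivAt (fun s _ => hF s)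
      (p.continuous.intervalIntegrable _ _)
  rcases eq_or_ne t x with rfl | hne
  · simp
  rcases hs with ⟨hs, htx⟩ | ⟨hs, htx⟩
  · have hlt := lt_of_le_of_ne htx hne
    have h1 := h p hp t x hlt x (right_mem_Icc.2 htx)
    rw [abs_of_pos (sub_pos.2 hlt), mul_comm, ← hint]
    convert h1 using 2
    refine intervalIntegral.integral_congr fun s hs' => ?_
    rw [uIcc_of_le htx] at hs'
    exact (abs_of_nonneg (hs s hs')).symm
  · have hlt := lt_of_le_of_ne htx hne.symm
    have h1 := h p hp x t hlt x (left_mem_Icc.2 htx)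
    rw [abs_sub_comm, abs_of_pos (sub_pos.2 hlt), mul_comm, ← hint,
      intervalIntegral.integral_symm, ← intervalIntegral.integral_neg]
    convert h1 using 2
    refine intervalIntegral.integral_congr fun s hs' => ?_
    rw [uIcc_of_le htx] at hs'
    exact (abs_of_nonpos (hs s hs')).symm

end OneVariable

/-! ### Polynomials in two variables, through their coefficients -/

/-- The polynomial function of two variables with coefficients `a`. -/
def bipoly {m : ℕ} (a : Fin (m + 1) → Fin (m + 1) → ℝ) (x s : ℝ) : ℝ :=
  ∑ i, (∑ j, a i j * s ^ (j : ℕ)) * x ^ (i : ℕ)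

/-- The coefficients of the derivative in the first variable. -/
def bipolyDeriv {m : ℕ} (a : Fin (m + 1) → Fin (m + 1) → ℝ) : Fin (m + 1) → Fin (m + 1) → ℝ :=
  Fin.lastCases 0 fun i j => ((i : ℕ) + 1) * a i.succ j

section

variable {m : ℕ}

lemma continuous_bipoly_uncurry :
    Continuous fun p : (Fin (m + 1) → Fin (m + 1) → ℝ) × ℝ × ℝ => bipoly p.1 p.2.1 p.2.2 := by
  unfold bipoly
  fun_prop

lemma continuous_bipoly (a : Fin (m + 1) → Fin (m + 1) → ℝ) :
    Continuous fun z : ℝ × ℝ => bipoly a z.1 z.2 := by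
  unfold bipoly
  fun_prop

lemma bipolyDeriv_last (a : Fin (m + 1) → Fin (m + 1) → ℝ) : bipolyDeriv a (Fin.last m) = 0 := by
  simp [bipolyDeriv]

lemma bipolyDeriv_castSucc (a : Fin (m + 1) → Fin (m + 1) → ℝ) (i : Fin m) (j : Fin (m + 1)) :
    bipolyDeriv a i.castSucc j = ((i : ℕ) + 1) * a i.succ j := by
  simp [bipolyDeriv]

lemma continuous_bipolyDeriv :
    Continuous (bipolyDeriv : (Fin (m + 1) → Fin (m + 1) → ℝ) → _) := by
  refine continuous_pi fun i => ?_
  unfold bipolyDeriv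
  refine Fin.lastCases ?_ (fun i => ?_) i
  · simp only [Fin.lastCases_last]
    exact continuous_const
  · simp only [Fin.lastCases_castSucc]
    fun_prop

lemma hasDerivAt_bipoly (a : Fin (m + 1) → Fin (m + 1) → ℝ) (x s : ℝ) :
    HasDerivAt (fun x => bipoly a x s) (bipoly (bipolyDeriv a) x s) x := by
  have h : HasDerivAt (fun x => bipoly a x s)
      (∑ i : Fin (m + 1), (∑ j, a i j * s ^ (j : ℕ)) * ((i : ℕ) * x ^ ((i : ℕ) - 1))) x :=
    HasDerivAt.fun_sum fun i _ => (hasDerivAt_pow (i : ℕ) x).const_mul _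
  convert h using 1
  rw [bipoly, Fin.sum_univ_castSucc, bipolyDeriv_last]
  refine Eq.trans ?_ (Fin.sum_univ_succ _).symm
  simp only [bipolyDeriv_castSucc]
  simp only [Fin.val_castSucc, Pi.zero_apply, zero_mul, Finset.sum_const_zero, Fin.val_last,
    add_zero, Fin.val_zero, Nat.cast_zero, mul_zero, Fin.val_succ, Nat.cast_add,
    Nat.cast_one, add_tsub_cancel_right, zero_add]
  refine Finset.sum_congr rfl fun i _ => ?_
  rw [Finset.sum_mul, Finset.sum_mul]
  refine Finset.sum_congr rfl fun j _ => ?_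
  ring

lemma abs_bipoly_le (a : Fin (m + 1) → Fin (m + 1) → ℝ) {x s : ℝ} (hx : |x| ≤ 1) (hs : |s| ≤ 1) :
    |bipoly a x s| ≤ ((m : ℝ) + 1) ^ 2 * ‖a‖ := by
  have hpow : ∀ {y : ℝ}, |y| ≤ 1 → ∀ k : ℕ, |y ^ k| ≤ 1 := fun hy k => by
    rw [abs_pow]; exact pow_le_one₀ (abs_nonneg _) hy
  calc |bipoly a x s| ≤ ∑ i, |(∑ j, a i j * s ^ (j : ℕ)) * x ^ (i : ℕ)| :=
        Finset.abs_sum_le_sum_abs _ _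
    _ ≤ ∑ i : Fin (m + 1), ∑ j : Fin (m + 1), ‖a‖ := by
        refine Finset.sum_le_sum fun i _ => ?_
        rw [abs_mul]
        refine (mul_le_of_le_one_right (abs_nonneg _) (hpow hx _)).trans ?_
        refine (Finset.abs_sum_le_sum_abs _ _).trans (Finset.sum_le_sum fun j _ => ?_)
        rw [abs_mul]
        refine (mul_le_of_le_one_right (abs_nonneg _) (hpow hs _)).trans ?_
        exact (norm_le_pi_norm (a i) j).trans (norm_le_pi_norm a i)
    _ = _ := by simp; ring

lemma bipoly_coeff_eq_zero {a : Fin (m + 1) → Fin (m + 1) → ℝ} {S T : Set ℝ} (hS : S.Infinite)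
    (hT : T.Infinite) (h : ∀ x ∈ S, ∀ s ∈ T, bipoly a x s = 0) : a = 0 := by
  have h1 : ∀ s ∈ T, (fun i => ∑ j, a i j * s ^ (j : ℕ)) = 0 := fun s hs =>
    coeff_eq_zero_of_infinite hS fun x hx => h x hx s hs
  ext1 i
  exact coeff_eq_zero_of_infinite hT fun s hs => congrFun (h1 s hs) i

end

lemma eq_zero_of_setIntegral_eq_zero {g : ℝ × ℝ → ℝ} (hg : Continuous g) (h0 : ∀ z, 0 ≤ g z)
    {Q : Set (ℝ × ℝ)} (hQ : IsCompact Q) (h : ∫ z in Q, g z = 0) {z : ℝ × ℝ}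
    (hz : z ∈ interior Q) : g z = 0 := by
  rw [setIntegral_eq_zero_iff_of_nonneg_ae (Filter.Eventually.of_forall h0)
    (hg.continuousOn.integrableOn_compact hQ)] at h
  have h1 : g =ᵐ[volume.restrict (interior Q)] 0 :=
    ae_restrict_of_ae_restrict_of_subset interior_subset h
  exact Measure.eqOn_open_of_ae_eq h1 isOpen_interior hg.continuousOn continuousOn_const hz

/-- Equivalence of norms again, on a box with an arbitrary time interval: the landing argument uses
the first and the second half of `[0, 1]` separately. -/
lemma exists_norm_le_integral_bipoly (m : ℕ) {t₀ t₁ : ℝ} (ht : t₀ < t₁) :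
    ∃ c : ℝ, 0 < c ∧ ∀ a : Fin (m + 1) → Fin (m + 1) → ℝ,
      c * ‖a‖ ≤ ∫ z in Icc (-1 : ℝ) 1 ×ˢ Icc t₀ t₁, |bipoly a z.1 z.2| := by
  have hQ : IsCompact (Icc (-1 : ℝ) 1 ×ˢ Icc t₀ t₁) := isCompact_Icc.prod isCompact_Icc
  refine exists_pos_mul_norm_le _ ?_ ?_ ?_
  · exact continuous_parametric_integral_of_continuous
      (f := fun (a : Fin (m + 1) → Fin (m + 1) → ℝ) (z : ℝ × ℝ) => |bipoly a z.1 z.2|)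
      continuous_bipoly_uncurry.abs hQ
  · intro t a
    rw [← integral_const_mul]
    congr 1 with z
    rw [← abs_mul, bipoly, bipoly, Finset.mul_sum]
    congr 2 with i
    rw [← mul_assoc, Finset.mul_sum]
    simp [mul_assoc]
  · intro a ha
    refine lt_of_le_of_ne (integral_nonneg fun _ => abs_nonneg _) fun h0 => ha ?_
    refine bipoly_coeff_eq_zero (Ioo_infinite (show (-1 : ℝ) < 1 by norm_num)) (Ioo_infinite ht)
      fun x hx s hs => abs_eq_zero.1 ?_
    refine eq_zero_of_setIntegral_eq_zero (g := fun z => |bipoly a z.1 z.2|) (z := (x, s))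
      (continuous_bipoly a).abs (fun _ => abs_nonneg _) hQ h0.symm ?_
    rw [interior_prod_eq, interior_Icc, interior_Icc]
    exact ⟨hx, hs⟩

/-! ### The landing region: a lower bound by compactness -/

section

variable {m : ℕ}

/-- On no time interval longer than `L * δ` is the origin strictly below both points `± δ`. -/
def NoStay (L : ℝ) (f : ℝ → ℝ → ℝ) : Prop :=
  ∀ δ s₁ s₂ : ℝ, 0 < δ → δ ≤ 1 → 0 ≤ s₁ → s₂ ≤ 1 → s₁ < s₂ → L * δ < s₂ - s₁ →
    ∃ s ∈ Icc s₁ s₂, f δ s ≤ f 0 s ∨ f (-δ) s ≤ f 0 s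

/-- A violation consists of strict inequalities on a compact time interval, so it persists for
nearby coefficients. -/
lemma isClosed_noStay (L : ℝ) :
    IsClosed {a : Fin (m + 1) → Fin (m + 1) → ℝ | NoStay L (bipoly a)} := by
  simp only [NoStay, ofPred_forall]
  refine isClosed_iInter fun δ => isClosed_iInter fun s₁ => isClosed_iInter fun s₂ =>
    isClosed_iInter fun _ => isClosed_iInter fun _ => isClosed_iInter fun _ =>
    isClosed_iInter fun _ => isClosed_iInter fun _ => isClosed_iInter fun _ => ?_
  rw [← isOpen_compl_iff, isOpen_iff_eventually]
  intro a ha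
  have hcont : ∀ y : ℝ, Continuous fun p : (Fin (m + 1) → Fin (m + 1) → ℝ) × ℝ =>
      bipoly p.1 y p.2 := fun y =>
    continuous_bipoly_uncurry.comp (by fun_prop : Continuous fun p :
      (Fin (m + 1) → Fin (m + 1) → ℝ) × ℝ => (p.1, y, p.2))
  have h1 : ∀ᶠ b in 𝓝 a, ∀ s ∈ Icc s₁ s₂, bipoly b 0 s < bipoly b δ s ∧
      bipoly b 0 s < bipoly b (-δ) s := by
    refine isCompact_Icc.eventually_forall_of_forall_eventually fun s hs => ?_
    have h2 : bipoly a 0 s < bipoly a δ s ∧ bipoly a 0 s < bipoly a (-δ) s := by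
      by_contra hcon
      apply ha
      refine ⟨s, hs, ?_⟩
      by_contra hcon2
      push Not at hcon2
      exact hcon hcon2
    exact ((hcont 0).continuousAt.eventually_lt (hcont δ).continuousAt h2.1).and
      ((hcont 0).continuousAt.eventually_lt (hcont (-δ)).continuousAt h2.2)
  filter_upwards [h1] with b hb
  rintro ⟨s, hs, h | h⟩
  · exact absurd (hb s hs).1 (not_lt.2 h)
  · exact absurd (hb s hs).2 (not_lt.2 h)

/-- If the polynomial were nonnegative, it would vanish on the axis `x = 0`, since there it starts
at 0 and does not increase. Dividing by the lowest power of `x`, it would be strictly positive off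
the axis near some point of it: the origin would be a valley during a fixed time in arbitrarily
narrow windows. -/
lemma exists_neg_of_noStay {L : ℝ} (hL : 0 ≤ L) {a : Fin (m + 1) → Fin (m + 1) → ℝ}
    (h00 : bipoly a 0 0 = 0) (ha : a ≠ 0) (hanti : AntitoneOn (bipoly a 0) (Icc 0 1))
    (hstay : NoStay L (bipoly a)) :
    ∃ x ∈ Ioo (-1 : ℝ) 1, ∃ s ∈ Ioo (0 : ℝ) 1, bipoly a x s < 0 := by
  by_contra! hcon
  have hq : ∀ s ∈ Ioo (0 : ℝ) 1, bipoly a 0 s = 0 := fun s hs => by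
    refine le_antisymm ?_ (hcon 0 (by norm_num) s hs)
    exact (hanti (by norm_num) (Ioo_subset_Icc_self hs) hs.1.le).trans_eq h00
  have hex : ∃ k : ℕ, ∃ h : k < m + 1, a ⟨k, h⟩ ≠ 0 := by
    by_contra! h
    exact ha (funext fun i => h i i.2)
  classical
  obtain ⟨hk, hak⟩ := Nat.find_spec hex
  -- The lowest power of `x` that occurs; below, `V` is the quotient by `x ^ k`, and `V (0, ·)` is a
  -- nonzero polynomial.
  set k := Nat.find hex with hkdef
  have hmin : ∀ i : Fin (m + 1), (i : ℕ) < k → a i = 0 := by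
    intro i hi
    by_contra h
    exact Nat.find_min hex hi ⟨i.2, h⟩
  obtain ⟨s₀, hs₀, hne⟩ : ∃ s ∈ Ioo (0 : ℝ) 1, ∑ j, a ⟨k, hk⟩ j * s ^ (j : ℕ) ≠ 0 := by
    by_contra! h
    exact hak (coeff_eq_zero_of_infinite (Ioo_infinite (zero_lt_one' ℝ)) h)
  let V : ℝ × ℝ → ℝ := fun z => ∑ i : Fin (m + 1),
    if k ≤ i then (∑ j, a i j * z.2 ^ (j : ℕ)) * z.1 ^ ((i : ℕ) - k) else 0
  have hV : ∀ x s, bipoly a x s = x ^ k * V (x, s) := by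
    intro x s
    simp only [bipoly, V, Finset.mul_sum]
    refine Finset.sum_congr rfl fun i _ => ?_
    by_cases hi : k ≤ i
    · rw [if_pos hi, mul_left_comm, ← pow_add, Nat.add_sub_cancel' hi]
    · rw [if_neg hi, hmin i (not_le.1 hi)]
      simp
  have hVc : Continuous V := by
    refine continuous_finsetSum _ fun i _ => ?_
    by_cases hi : k ≤ i
    · simp only [if_pos hi]
      fun_prop
    · simp only [if_neg hi]
      fun_prop
  have hV0 : V (0, s₀) ≠ 0 := by
    have : V (0, s₀) = ∑ j, a ⟨k, hk⟩ j * s₀ ^ (j : ℕ) := by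
      simp only [V]
      rw [Finset.sum_eq_single ⟨k, hk⟩]
      · simp
      · intro i _ hi
        by_cases hik : k ≤ i
        · have : (i : ℕ) - k ≠ 0 := fun h => hi (Fin.ext (by simp; omega))
          simp [hik, this]
        · rw [if_neg hik]
      · simp
    rwa [this]
  have hev : ∀ᶠ z in 𝓝 ((0 : ℝ), s₀), V z ≠ 0 ∧ z.2 ∈ Ioo (0 : ℝ) 1 :=
    (hVc.continuousAt.eventually_ne hV0).and
      (continuous_snd.continuousAt.eventually (isOpen_Ioo.mem_nhds hs₀))
  obtain ⟨ε, hε, hball⟩ := Metric.eventually_nhds_iff.1 hev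
  have hsq : ∀ x s : ℝ, |x| < ε → |s - s₀| < ε → V (x, s) ≠ 0 ∧ s ∈ Ioo (0 : ℝ) 1 := by
    intro x s hx hs
    refine hball (y := (x, s)) ?_
    rw [Prod.dist_eq]
    simpa [Real.dist_eq] using ⟨hx, hs⟩
  set η := min ε 1 with hη
  have hη0 : 0 < η := lt_min hε one_pos
  have hηε : η ≤ ε := min_le_left _ _
  have hη1 : η ≤ 1 := min_le_right _ _
  -- With this half width, `L` times it is less than `η`, the length of the time interval used.
  have hδ : 0 < η / (2 * (L + 1)) := by positivity
  have hδ2 : η / (2 * (L + 1)) ≤ η / 2 := by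
    apply div_le_div_of_nonneg_left hη0.le (by norm_num)
    linarith
  have hm1 := (hsq 0 (s₀ - η / 2) (by simpa using hε) (by
    rw [sub_sub_cancel_left, abs_neg, abs_of_pos (by linarith)]; linarith)).2.1
  have hm2 := (hsq 0 (s₀ + η / 2) (by simpa using hε) (by
    rw [add_sub_cancel_left, abs_of_pos (by linarith)]; linarith)).2.2
  obtain ⟨s, hs, h⟩ := hstay (η / (2 * (L + 1))) (s₀ - η / 2) (s₀ + η / 2) hδ (by linarith) hm1.le
    hm2.le (by linarith) (by
      rw [← mul_div_assoc, div_lt_iff₀ (by linarith)]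
      nlinarith)
  have hs' : |s - s₀| < ε := by
    rw [abs_lt]
    constructor <;> linarith [hs.1, hs.2]
  have hpos : ∀ x : ℝ, x ≠ 0 → |x| ≤ η / 2 → 0 < bipoly a x s := by
    intro x hx hxη
    obtain ⟨h1, h2⟩ := hsq x s (by linarith) hs'
    have hx' := abs_le.1 hxη
    refine lt_of_le_of_ne (hcon x ⟨by linarith, by linarith⟩ s h2) ?_
    rw [hV]
    exact (mul_ne_zero (pow_ne_zero _ hx) h1).symm
  have hs01 := (hsq 0 s (by simpa using hε) hs').2
  rw [hq s hs01] at h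
  rcases h with h | h
  · exact absurd (hpos _ hδ.ne' (by rwa [abs_of_pos hδ])) (not_lt.2 h)
  · exact absurd (hpos _ (neg_ne_zero.2 hδ.ne') (by rwa [abs_neg, abs_of_pos hδ])) (not_lt.2 h)

/-- The mean value inequality trades an oscillation of size 1 for a bound on coefficients. That
bound no longer records where the oscillation occurs: it may be at negative times, while landing
takes place at positive ones. -/
lemma one_le_norm_bipolyDeriv {a : Fin (m + 1) → Fin (m + 1) → ℝ}
    (h : ∃ x ∈ Icc (-1 : ℝ) 1, ∃ s ∈ Icc (-1 : ℝ) 1, |bipoly a x s - bipoly a 0 s| = 1) :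
    1 ≤ ((m : ℝ) + 1) ^ 2 * ‖bipolyDeriv a‖ := by
  obtain ⟨x, hx, s, hs, h1⟩ := h
  have h2 := (convex_Icc (-1 : ℝ) 1).norm_image_sub_le_of_norm_hasDerivWithin_le
    (f := fun x => bipoly a x s) (f' := fun x => bipoly (bipolyDeriv a) x s)
    (C := ((m : ℝ) + 1) ^ 2 * ‖bipolyDeriv a‖) (x := 0) (y := x)
    (fun y _ => (hasDerivAt_bipoly a y s).hasDerivWithinAt)
    (fun y hy => abs_bipoly_le _ (abs_le.2 hy) (abs_le.2 hs))
    (show (0 : ℝ) ∈ Icc (-1 : ℝ) 1 by norm_num) hx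
  rw [Real.norm_eq_abs, h1, sub_zero] at h2
  refine h2.trans (mul_le_of_le_one_right (by positivity) (abs_le.2 hx))

/-- The weight of the landing region in the normalized box. -/
noncomputable def landingWeight (a : Fin (m + 1) → Fin (m + 1) → ℝ) (z : ℝ × ℝ) : ℝ :=
  |bipoly (bipolyDeriv a) z.1 z.2| * min 1 (max 0 (-bipoly a z.1 z.2))

lemma landingWeight_nonneg (a : Fin (m + 1) → Fin (m + 1) → ℝ) (z : ℝ × ℝ) :
    0 ≤ landingWeight a z :=
  mul_nonneg (abs_nonneg _) (le_min zero_le_one (le_max_left _ _))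

lemma continuous_landingWeight_uncurry :
    Continuous fun p : (Fin (m + 1) → Fin (m + 1) → ℝ) × ℝ × ℝ => landingWeight p.1 p.2 := by
  have h1 : Continuous fun p : (Fin (m + 1) → Fin (m + 1) → ℝ) × ℝ × ℝ =>
      bipoly (bipolyDeriv p.1) p.2.1 p.2.2 :=
    continuous_bipoly_uncurry.comp ((continuous_bipolyDeriv.comp continuous_fst).prodMk
      continuous_snd)
  have h2 := h1.abs.mul
    (continuous_const (y := (1 : ℝ)).min
      (continuous_const (y := (0 : ℝ)).max (continuous_bipoly_uncurry (m := m)).neg))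
  simp only [landingWeight]
  exact h2

lemma continuous_landingWeight (a : Fin (m + 1) → Fin (m + 1) → ℝ) :
    Continuous fun z => landingWeight a z := by
  simp only [landingWeight]
  exact (continuous_bipoly _).abs.mul
    (continuous_const.min (continuous_const.max (continuous_bipoly a).neg))

/-- There is an open set where the polynomial is negative; a vanishing integral would force its
`x`-derivative to vanish on that set, hence identically. -/
lemma integral_landingWeight_pos {L : ℝ} (hL : 0 ≤ L) {a : Fin (m + 1) → Fin (m + 1) → ℝ}
    (h00 : bipoly a 0 0 = 0) (ha : bipolyDeriv a ≠ 0) (hanti : AntitoneOn (bipoly a 0) (Icc 0 1))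
    (hstay : NoStay L (bipoly a)) :
    0 < ∫ z in Icc (-1 : ℝ) 1 ×ˢ Icc (0 : ℝ) 1, landingWeight a z := by
  refine lt_of_le_of_ne (integral_nonneg fun z => landingWeight_nonneg a z) fun h0 => ha ?_
  have ha' : a ≠ 0 := by
    rintro rfl
    apply ha
    ext i j
    refine Fin.lastCases ?_ (fun i => ?_) i
    · rw [bipolyDeriv_last]; rfl
    · rw [bipolyDeriv_castSucc]; simp
  obtain ⟨x, hx, s, hs, hneg⟩ := exists_neg_of_noStay hL h00 ha' hanti hstay
  have hcx : Continuous fun z : ℝ × ℝ => bipoly a z.1 z.2 := continuous_bipoly a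
  have hev1 : ∀ᶠ z : ℝ × ℝ in 𝓝 (x, s), bipoly a z.1 z.2 < 0 :=
    (hcx.tendsto (x, s)).eventually_lt_const hneg
  have hev2 : ∀ᶠ z : ℝ × ℝ in 𝓝 (x, s), z ∈ Ioo (-1 : ℝ) 1 ×ˢ Ioo (0 : ℝ) 1 :=
    (isOpen_Ioo.prod isOpen_Ioo).mem_nhds ⟨hx, hs⟩
  have hev := hev1.and hev2
  rw [nhds_prod_eq] at hev
  obtain ⟨S, hS, T, hT, hST⟩ := Filter.mem_prod_iff.1 hev
  refine bipoly_coeff_eq_zero (infinite_of_mem_nhds x hS) (infinite_of_mem_nhds s hT)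
    fun y hy t ht => ?_
  obtain ⟨h1, h2⟩ := hST (mk_mem_prod hy ht)
  have h3 : landingWeight a (y, t) = 0 :=
    eq_zero_of_setIntegral_eq_zero (g := fun z => landingWeight a z) (z := (y, t))
    (continuous_landingWeight a)
    (landingWeight_nonneg a) (isCompact_Icc.prod isCompact_Icc) h0.symm
    (by rw [interior_prod_eq, interior_Icc, interior_Icc]; exact h2)
  unfold landingWeight at h3
  rcases mul_eq_zero.1 h3 with h4 | h4
  · exact abs_eq_zero.1 h4
  · have : 0 < min 1 (max 0 (-bipoly a y t)) :=
      lt_min one_pos (lt_max_of_lt_right (by linarith [show bipoly a y t < 0 from h1]))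
    exact absurd h4 this.ne'

/-- A quantitative lower bound for the landing region. -/
theorem exists_le_integral_landingWeight (m : ℕ) {L : ℝ} (hL : 0 ≤ L) :
    ∃ c : ℝ, 0 < c ∧ ∀ a : Fin (m + 1) → Fin (m + 1) → ℝ, bipoly a 0 0 = 0 →
      (∀ x ∈ Icc (-1 : ℝ) 1, ∀ s ∈ Icc (-1 : ℝ) 1, |bipoly a x s - bipoly a 0 s| ≤ 1) →
      (∃ x ∈ Icc (-1 : ℝ) 1, ∃ s ∈ Icc (-1 : ℝ) 1, |bipoly a x s - bipoly a 0 s| = 1) →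
      AntitoneOn (bipoly a 0) (Icc 0 1) → NoStay L (bipoly a) →
      c ≤ ∫ z in Icc (-1 : ℝ) 1 ×ˢ Icc (0 : ℝ) 1, landingWeight a z := by
  obtain ⟨c₁, hc₁, h₁⟩ := exists_norm_le_integral_bipoly m (show (0 : ℝ) < 1 / 2 by norm_num)
  obtain ⟨c₂, hc₂, h₂⟩ := exists_norm_le_integral_bipoly m (show (1 / 2 : ℝ) < 1 by norm_num)
  set R := 3 * volume.real (Icc (-1 : ℝ) 1 ×ˢ Icc (0 : ℝ) (1 / 2)) / c₁ with hR
  -- All the conditions are closed, and the landing weight has positive integral on `K`. The radius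
  -- `R` is the bound on coefficients valid when the valley drops by at most 2 up to time `1 / 2`.
  let K : Set (Fin (m + 1) → Fin (m + 1) → ℝ) := Metric.closedBall 0 R ∩
    ({a | bipoly a 0 0 = 0} ∩ {a | 1 ≤ ((m : ℝ) + 1) ^ 2 * ‖bipolyDeriv a‖} ∩
      {a | AntitoneOn (bipoly a 0) (Icc 0 1)} ∩ {a | NoStay L (bipoly a)})
  have hpt : ∀ x s : ℝ, Continuous fun a : Fin (m + 1) → Fin (m + 1) → ℝ => bipoly a x s :=
    fun x s => continuous_bipoly_uncurry.comp (by fun_prop : Continuous fun a :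
      (Fin (m + 1) → Fin (m + 1) → ℝ) => (a, x, s))
  have hK : IsCompact K := by
    refine (isCompact_closedBall _ _).inter_right ?_
    refine (((isClosed_eq (hpt 0 0) continuous_const).inter
      (isClosed_le continuous_const (continuous_const.mul continuous_bipolyDeriv.norm))).inter
      ?_).inter (isClosed_noStay L)
    simp only [AntitoneOn, ofPred_forall]
    exact isClosed_iInter fun s => isClosed_iInter fun _ => isClosed_iInter fun t =>
      isClosed_iInter fun _ => isClosed_iInter fun _ => isClosed_le (hpt _ _) (hpt _ _)
  have hΘ : Continuous fun a : Fin (m + 1) → Fin (m + 1) → ℝ =>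
      ∫ z in Icc (-1 : ℝ) 1 ×ˢ Icc (0 : ℝ) 1, landingWeight a z :=
    continuous_parametric_integral_of_continuous
      (f := fun (a : Fin (m + 1) → Fin (m + 1) → ℝ) (z : ℝ × ℝ) => landingWeight a z)
      continuous_landingWeight_uncurry (isCompact_Icc.prod isCompact_Icc)
  have hΘpos : ∀ a ∈ K, 0 < ∫ z in Icc (-1 : ℝ) 1 ×ˢ Icc (0 : ℝ) 1, landingWeight a z := by
    rintro a ⟨-, ⟨⟨h00, hD⟩, hanti⟩, hstay⟩
    refine integral_landingWeight_pos hL h00 (fun h => ?_) hanti hstay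
    rw [mem_ofPred_eq, h, norm_zero, mul_zero] at hD
    linarith
  obtain ⟨c₃, hc₃, h₃⟩ : ∃ c : ℝ, 0 < c ∧ ∀ a ∈ K,
      c ≤ ∫ z in Icc (-1 : ℝ) 1 ×ˢ Icc (0 : ℝ) 1, landingWeight a z := by
    rcases K.eq_empty_or_nonempty with hE | hE
    · exact ⟨1, one_pos, fun a ha => by simp [hE] at ha⟩
    · obtain ⟨a, ha, hmin⟩ := hK.exists_isMinOn hE hΘ.continuousOn
      exact ⟨_, hΘpos a ha, fun b hb => hmin hb⟩
  refine ⟨min c₃ (c₂ / ((m : ℝ) + 1) ^ 2), lt_min hc₃ (by positivity),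
    fun a h00 hW hW1 hanti hstay => ?_⟩
  have hD := one_le_norm_bipolyDeriv hW1
  have hq0 : ∀ s ∈ Icc (0 : ℝ) 1, bipoly a 0 s ≤ 0 := fun s hs => by
    exact (hanti (by norm_num) hs hs.1).trans_eq h00
  -- After a deep drop the coefficients may be unbounded, but at times after `1 / 2` the polynomial
  -- is below -1 throughout the box, so the truncation is inactive and the weight is just the
  -- modulus of the derivative.
  by_cases hq : bipoly a 0 (1 / 2) < -2
  · refine (min_le_right _ _).trans ?_
    calc c₂ / ((m : ℝ) + 1) ^ 2 ≤ c₂ * ‖bipolyDeriv a‖ := by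
          rw [div_le_iff₀ (by positivity), mul_assoc]
          refine le_mul_of_one_le_right hc₂.le ?_
          rwa [mul_comm]
      _ ≤ _ := h₂ (bipolyDeriv a)
      _ = ∫ z in Icc (-1 : ℝ) 1 ×ˢ Icc (1 / 2 : ℝ) 1, landingWeight a z := by
          refine setIntegral_congr_fun (measurableSet_Icc.prod measurableSet_Icc) fun z hz => ?_
          have hz2 : z.2 ∈ Icc (0 : ℝ) 1 := ⟨by linarith [hz.2.1], hz.2.2⟩
          have h1 : bipoly a 0 z.2 ≤ bipoly a 0 (1 / 2) := hanti (by norm_num) hz2 hz.2.1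
          have h2 := (abs_le.1 (hW z.1 hz.1 z.2 ⟨by linarith [hz2.1], hz2.2⟩)).2
          have h3 : min 1 (max 0 (-bipoly a z.1 z.2)) = 1 :=
            min_eq_left (le_max_of_le_right (by linarith))
          simp only [landingWeight]
          rw [h3, mul_one]
      _ ≤ _ := by
          refine setIntegral_mono_set ((continuous_landingWeight a).continuousOn.integrableOn_compact
            (isCompact_Icc.prod isCompact_Icc))
            (Filter.Eventually.of_forall fun z => landingWeight_nonneg a z) ?_
          exact (prod_mono le_rfl (Icc_subset_Icc (by norm_num) le_rfl)).eventuallyLE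
  · refine (min_le_left _ _).trans (h₃ a ⟨?_, ⟨⟨h00, hD⟩, hanti⟩, hstay⟩)
    rw [mem_closedBall_zero_iff, hR, le_div_iff₀ hc₁, mul_comm]
    refine (h₁ a).trans ((le_abs_self _).trans ?_)
    have hfin : volume (Icc (-1 : ℝ) 1 ×ˢ Icc (0 : ℝ) (1 / 2)) < ⊤ :=
      (isCompact_Icc.prod isCompact_Icc).measure_lt_top
    refine norm_setIntegral_le_of_norm_le_const (C := 3)
      (f := fun z : ℝ × ℝ => |bipoly a z.1 z.2|) hfin fun z hz => ?_
    have hz2 : z.2 ∈ Icc (0 : ℝ) 1 := ⟨hz.2.1, by linarith [hz.2.2]⟩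
    have h1 : bipoly a 0 (1 / 2) ≤ bipoly a 0 z.2 := hanti hz2 (by norm_num) hz.2.2
    have h2 := abs_le.1 (hW z.1 hz.1 z.2 ⟨by linarith [hz2.1], hz2.2⟩)
    have h3 := hq0 z.2 hz2
    rw [Real.norm_eq_abs, abs_abs, abs_le]
    constructor <;> linarith [h2.1, h2.2]

end

/-! ### Roots of polynomials depending on a parameter -/

section

open Polynomial

/-- Outside the zeros of a nonzero polynomial in the parameter, the roots of a polynomial depending
polynomially on a parameter are simple roots of another such polynomial. -/
lemma exists_simple_roots {B : ℝ[X][X]} (hB : B ≠ 0) : ∃ (G : ℝ[X][X]) (d : ℝ[X]), d ≠ 0 ∧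
    ∀ s : ℝ, d.eval s ≠ 0 → ∀ x : ℝ, (B.map (evalRingHom s)).eval x = 0 →
      (G.map (evalRingHom s)).eval x = 0 ∧ (G.map (evalRingHom s)).derivative.eval x ≠ 0 := by
  classical
  let K := FractionRing ℝ[X]
  have hinj : Function.Injective (algebraMap ℝ[X] K) := IsFractionRing.injective _ _
  have hinj' : Function.Injective (Polynomial.map (algebraMap ℝ[X] K)) := map_injective _ hinj
  have hnorm : ∀ p : K[X], ∃ (d : ℝ[X]) (P : ℝ[X][X]), d ≠ 0 ∧
      P.map (algebraMap ℝ[X] K) = C (algebraMap ℝ[X] K d) * p := by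
    intro p
    obtain ⟨b, hb, hbp⟩ := IsLocalization.integerNormalization_spec (nonZeroDivisors ℝ[X]) p
    refine ⟨b, _, nonZeroDivisors.ne_zero hb, hbp.trans ?_⟩
    ext i
    rw [coeff_smul, coeff_C_mul, Algebra.smul_def]
  set Bt := B.map (algebraMap ℝ[X] K) with hBt
  have hBt0 : Bt ≠ 0 := by
    rw [hBt, Polynomial.map_ne_zero_iff hinj]
    exact hB
  -- Over the field of rational functions of the parameter, in characteristic zero, the radical is
  -- separable. The Bézout identity `huv` and the divisibility `hH` become polynomial identities
  -- once denominators are cleared, and can be specialized at each `s` that is not a zero of the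
  -- cleared factors.
  set g := UniqueFactorizationMonoid.radical Bt with hg
  have hsep : g.Separable :=
    PerfectField.separable_iff_squarefree.2 UniqueFactorizationMonoid.squarefree_radical
  obtain ⟨u, v, huv⟩ := hsep
  obtain ⟨n, H, hH⟩ := UniqueFactorizationMonoid.exists_dvd_radical_self_pow hBt0
  obtain ⟨d₁, G, hd₁, hG⟩ := hnorm g
  obtain ⟨d₂, U, hd₂, hU⟩ := hnorm u
  obtain ⟨d₃, V, hd₃, hV⟩ := hnorm v
  obtain ⟨d₄, H₀, hd₄, hH₀⟩ := hnorm H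
  have e1 : C d₃ * U * G + C d₂ * V * derivative G = C (d₁ * d₂ * d₃) := by
    apply hinj'
    simp only [Polynomial.map_add, Polynomial.map_mul, map_C, ← derivative_map, hG, hU, hV,
      map_mul, derivative_mul, derivative_C, zero_mul, zero_add]
    linear_combination (C (algebraMap ℝ[X] K d₁) * C (algebraMap ℝ[X] K d₂) *
      C (algebraMap ℝ[X] K d₃)) * huv
  have e2 : C d₄ * G ^ n = C (d₁ ^ n) * (B * H₀) := by
    apply hinj'
    simp only [Polynomial.map_mul, Polynomial.map_pow, map_C, hG, hH₀, map_pow, mul_pow]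
    rw [← hBt]
    linear_combination (C (algebraMap ℝ[X] K d₄) * C (algebraMap ℝ[X] K d₁) ^ n) * hH
  refine ⟨G, d₁ * d₂ * d₃ * d₄, by simp [hd₁, hd₂, hd₃, hd₄], fun s hs x hx => ?_⟩
  rw [eval_mul, mul_ne_zero_iff] at hs
  have e1' := congrArg (fun P => (P.map (evalRingHom s)).eval x) e1
  have e2' := congrArg (fun P => (P.map (evalRingHom s)).eval x) e2
  simp only [Polynomial.map_add, Polynomial.map_mul, map_C, eval_add, eval_mul, eval_C,
    coe_evalRingHom, ← derivative_map] at e1'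
  simp only [Polynomial.map_mul, Polynomial.map_pow, map_C, eval_mul, eval_C, eval_pow,
    coe_evalRingHom, hx, zero_mul, mul_zero] at e2'
  have hG0 : (G.map (evalRingHom s)).eval x = 0 := by
    rcases mul_eq_zero.1 e2' with h | h
    · exact absurd h hs.2
    · exact eq_zero_of_pow_eq_zero h
  refine ⟨hG0, fun h => hs.1 ?_⟩
  rw [hG0, h] at e1'
  simpa using e1'.symm

lemma exists_bipoly_eq (G : ℝ[X][X]) : ∃ (n : ℕ) (b : Fin (n + 1) → Fin (n + 1) → ℝ),
    ∀ x s : ℝ, (G.map (evalRingHom s)).eval x = bipoly b x s := by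
  set n := max G.natDegree (G.support.sup fun i => (G.coeff i).natDegree) with hn
  refine ⟨n, fun i j => (G.coeff i).coeff j, fun x s => ?_⟩
  have h1 : (G.map (evalRingHom s)).natDegree < n + 1 :=
    Nat.lt_succ_of_le ((natDegree_map_le).trans (le_max_left _ _))
  rw [eval_eq_sum_range' h1, bipoly, ← Fin.sum_univ_eq_sum_range
    (fun i => (G.map (evalRingHom s)).coeff i * x ^ i)]
  refine Finset.sum_congr rfl fun i _ => ?_
  congr 1
  rw [coeff_map, coe_evalRingHom]
  have h2 : (G.coeff i).natDegree < n + 1 := by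
    by_cases hi : (i : ℕ) ∈ G.support
    · exact Nat.lt_succ_of_le
        ((Finset.le_sup (f := fun i => (G.coeff i).natDegree) hi).trans (le_max_right _ _))
    · rw [notMem_support_iff.1 hi]; simp
  rw [eval_eq_sum_range' h2, ← Fin.sum_univ_eq_sum_range
    (fun j => (G.coeff i).coeff j * s ^ j)]

/-- The polynomial with coefficients `a` as a polynomial whose coefficients are polynomials. -/
noncomputable def bipolyPoly {m : ℕ} (a : Fin (m + 1) → Fin (m + 1) → ℝ) : ℝ[X][X] :=
  ∑ i : Fin (m + 1), monomial (i : ℕ) (∑ j : Fin (m + 1), monomial (j : ℕ) (a i j))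

lemma eval_bipolyPoly {m : ℕ} (a : Fin (m + 1) → Fin (m + 1) → ℝ) (x s : ℝ) :
    ((bipolyPoly a).map (evalRingHom s)).eval x = bipoly a x s := by
  simp [bipolyPoly, bipoly, Polynomial.map_sum, eval_finsetSum, Finset.sum_mul]

lemma natDegree_bipolyPoly_map_le {m : ℕ} (a : Fin (m + 1) → Fin (m + 1) → ℝ) (s : ℝ) :
    ((bipolyPoly a).map (evalRingHom s)).natDegree ≤ m := by
  refine natDegree_map_le.trans (natDegree_sum_le_of_forall_le _ _ fun i _ => ?_)
  exact (natDegree_monomial_le _).trans (by omega)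

end

/-- Implicit differentiation along a root already known to be continuous: write the increment of `g`
in `x` as `(x - r s₀)` times the mean `H` of `gx` over the segment, then pass to the limit in the
difference quotient. -/
lemma hasDerivAt_of_root {g gx : ℝ → ℝ → ℝ} {gs : ℝ} {r : ℝ → ℝ} {s₀ : ℝ}
    (hgx : ∀ x s, HasDerivAt (fun x => g x s) (gx x s) x)
    (hc : Continuous fun z : ℝ × ℝ => gx z.1 z.2)
    (hgs : HasDerivAt (fun s => g (r s₀) s) gs s₀) (hr : ContinuousAt r s₀)
    (h0 : ∀ᶠ s in 𝓝 s₀, g (r s) s = 0) (hne : gx (r s₀) s₀ ≠ 0) :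
    HasDerivAt r (-gs / gx (r s₀) s₀) s₀ := by
  let H : ℝ × ℝ → ℝ := fun z => ∫ θ in (0 : ℝ)..1, gx (r s₀ + θ * (z.1 - r s₀)) z.2
  have hH : Continuous H := by
    refine intervalIntegral.continuous_parametric_intervalIntegral_of_continuous'
      (f := fun (z : ℝ × ℝ) (θ : ℝ) => gx (r s₀ + θ * (z.1 - r s₀)) z.2) ?_ 0 1
    exact hc.comp (by fun_prop : Continuous fun p : (ℝ × ℝ) × ℝ =>
      (r s₀ + p.2 * (p.1.1 - r s₀), p.1.2))
  have hH0 : H (r s₀, s₀) = gx (r s₀) s₀ := by simp [H]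
  have hfac : ∀ x s, g x s - g (r s₀) s = (x - r s₀) * H (x, s) := by
    intro x s
    have h1 : ∀ θ : ℝ, HasDerivAt (fun θ => g (r s₀ + θ * (x - r s₀)) s)
        (gx (r s₀ + θ * (x - r s₀)) s * (x - r s₀)) θ := by
      intro θ
      have h2 : HasDerivAt (fun θ : ℝ => r s₀ + θ * (x - r s₀)) (x - r s₀) θ := by
        simpa using ((hasDerivAt_id θ).mul_const (x - r s₀)).const_add (r s₀)
      exact (hgx _ s).comp θ h2
    have hcont : Continuous fun θ : ℝ => gx (r s₀ + θ * (x - r s₀)) s :=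
      hc.comp (by fun_prop : Continuous fun θ : ℝ => (r s₀ + θ * (x - r s₀), s))
    have h3 := intervalIntegral.integral_eq_sub_of_hasDerivAt (a := 0) (b := 1) (fun θ _ => h1 θ)
      ((hcont.mul continuous_const).intervalIntegrable _ _)
    rw [intervalIntegral.integral_mul_const] at h3
    simp only [one_mul, add_sub_cancel, zero_mul, add_zero] at h3
    rw [← h3, mul_comm]
  have hD : Filter.Tendsto (fun s => H (r s, s)) (𝓝 s₀) (𝓝 (gx (r s₀) s₀)) := by
    rw [← hH0]
    exact (hH.tendsto _).comp (hr.tendsto.prodMk_nhds Filter.tendsto_id)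
  have hg0 : g (r s₀) s₀ = 0 := h0.self_of_nhds
  rw [hasDerivAt_iff_tendsto_slope] at hgs ⊢
  have hlim := (hgs.neg).div (hD.mono_left nhdsWithin_le_nhds) hne
  refine hlim.congr' ?_
  filter_upwards [nhdsWithin_le_nhds h0, nhdsWithin_le_nhds (hD.eventually_ne hne)] with s hs1 hs2
  have h4 := hfac (r s) s
  rw [hs1, zero_sub] at h4
  simp only [Pi.div_apply, slope, vsub_eq_sub, smul_eq_mul, hg0, sub_zero]
  rw [div_eq_iff hs2, mul_assoc, ← h4]
  ring

/-- Pigeonhole: `F.card + 1` disjoint pieces of equal length cannot all contain a point of `F`. -/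
lemma exists_subinterval_avoiding (F : Finset ℝ) {s₁ s₂ : ℝ} (h : s₁ < s₂) :
    ∃ c d : ℝ, s₁ ≤ c ∧ c < d ∧ d ≤ s₂ ∧ (∀ x ∈ F, x ∉ Ioo c d) ∧
      (s₂ - s₁) = (F.card + 1) * (d - c) := by
  set n := F.card with hn
  set e := (s₂ - s₁) / (n + 1) with he
  have he0 : 0 < e := div_pos (sub_pos.2 h) (by positivity)
  have hen : (n + 1) * e = s₂ - s₁ := by rw [he]; field_simp
  have key : ∃ k : Fin (n + 1), ∀ x ∈ F, x ∉ Ioo (s₁ + k * e) (s₁ + (k + 1) * e) := by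
    by_contra! hcon
    choose f hf hf' using hcon
    have hinj : Function.Injective f := by
      intro i j hij
      by_contra hne
      rcases lt_or_gt_of_ne hne with hlt | hlt
      · have h1 := (hf' i).2
        have h2 := (hf' j).1
        rw [hij] at h1
        have h3 : ((i : ℕ) : ℝ) + 1 ≤ (j : ℕ) := by exact_mod_cast hlt
        nlinarith
      · have h1 := (hf' j).2
        have h2 := (hf' i).1
        rw [hij] at h2
        have h3 : ((j : ℕ) : ℝ) + 1 ≤ (i : ℕ) := by exact_mod_cast hlt
        nlinarith
    have h4 := Finset.card_le_card_of_injOn (s := Finset.univ) (t := F) f (fun i _ => hf i)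
      hinj.injOn
    simp at h4
    omega
  obtain ⟨k, hk⟩ := key
  have hk1 : ((k : ℕ) : ℝ) + 1 ≤ n + 1 := by exact_mod_cast k.2
  have hk0 : (0 : ℝ) ≤ (k : ℕ) := by positivity
  refine ⟨_, _, ?_, ?_, ?_, hk, ?_⟩
  · nlinarith
  · nlinarith
  · nlinarith
  · rw [← hen]; ring

/-! ### The weight in coordinates: affine changes of variables and partial derivatives -/

section

variable {m : ℕ}

lemma bipoly_smul (t : ℝ) (a : Fin (m + 1) → Fin (m + 1) → ℝ) (x s : ℝ) :
    bipoly (t • a) x s = t * bipoly a x s := by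
  simp [bipoly, Finset.mul_sum, mul_assoc, Finset.sum_mul]

lemma bipoly_add (a b : Fin (m + 1) → Fin (m + 1) → ℝ) (x s : ℝ) :
    bipoly (a + b) x s = bipoly a x s + bipoly b x s := by
  simp [bipoly, add_mul, Finset.sum_add_distrib]

lemma exists_bipoly_monomial {i j : ℕ} (hi : i ≤ m) (hj : j ≤ m) (c : ℝ) :
    ∃ a : Fin (m + 1) → Fin (m + 1) → ℝ, ∀ x s, bipoly a x s = c * (x ^ i * s ^ j) := by
  refine ⟨Pi.single ⟨i, by omega⟩ (Pi.single ⟨j, by omega⟩ c), fun x s => ?_⟩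
  rw [bipoly, Finset.sum_eq_single ⟨i, by omega⟩, Finset.sum_eq_single ⟨j, by omega⟩]
  · simp; ring
  · intro b _ hb
    simp [hb]
  · simp
  · intro b _ hb
    simp [hb]
  · simp

lemma exists_bipoly_sum {ι : Type*} (S : Finset ι) (f : ι → ℝ → ℝ → ℝ)
    (h : ∀ i ∈ S, ∃ a : Fin (m + 1) → Fin (m + 1) → ℝ, ∀ x s, bipoly a x s = f i x s) :
    ∃ a : Fin (m + 1) → Fin (m + 1) → ℝ, ∀ x s, bipoly a x s = ∑ i ∈ S, f i x s := by
  classical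
  induction S using Finset.induction_on with
  | empty => exact ⟨0, fun x s => by simp [bipoly]⟩
  | insert i S hi ih =>
    obtain ⟨a, ha⟩ := ih fun j hj => h j (Finset.mem_insert_of_mem hj)
    obtain ⟨b, hb⟩ := h i (Finset.mem_insert_self _ _)
    exact ⟨b + a, fun x s => by rw [bipoly_add, ha, hb, Finset.sum_insert hi]⟩

lemma exists_bipoly_of_polyDegLE {φ : ℝ × ℝ → ℝ} (hφ : φ ∈ polyDegLE m) :
    ∃ a : Fin (m + 1) → Fin (m + 1) → ℝ, ∀ z, φ z = bipoly a z.1 z.2 := by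
  obtain ⟨p, hp, hφp⟩ := hφ
  obtain ⟨a, ha⟩ := exists_bipoly_sum (m := m) p.support
    (fun d x s => p.coeff d * (x ^ d 0 * s ^ d 1)) fun d hd => by
      have h1 : d 0 + d 1 ≤ m := by
        have := (MvPolynomial.le_totalDegree hd).trans hp
        rwa [Finsupp.sum_fintype _ _ (by simp), Fin.sum_univ_two] at this
      exact exists_bipoly_monomial (by omega) (by omega) _
  refine ⟨a, fun z => ?_⟩
  rw [hφp, ha, MvPolynomial.eval_eq']
  simp [Fin.prod_univ_two]

lemma bipoly_eq_sum (a : Fin (m + 1) → Fin (m + 1) → ℝ) (x s : ℝ) :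
    bipoly a x s = ∑ i, ∑ j, a i j * (x ^ (i : ℕ) * s ^ (j : ℕ)) := by
  simp only [bipoly, Finset.sum_mul]
  refine Finset.sum_congr rfl fun i _ => Finset.sum_congr rfl fun j _ => ?_
  ring

lemma bipoly_swap (a : Fin (m + 1) → Fin (m + 1) → ℝ) (x s : ℝ) :
    bipoly (fun i j => a j i) s x = bipoly a x s := by
  rw [bipoly_eq_sum, bipoly_eq_sum, Finset.sum_comm]
  refine Finset.sum_congr rfl fun i _ => Finset.sum_congr rfl fun j _ => ?_
  ring

open Polynomial in
lemma exists_affine_pow {i : ℕ} (hi : i ≤ m) (r w : ℝ) :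
    ∃ u : Fin (m + 1) → ℝ, ∀ x, (r + w * x) ^ i = ∑ k, u k * x ^ (k : ℕ) := by
  refine ⟨fun k => ((C r + C w * X) ^ i : ℝ[X]).coeff k, fun x => ?_⟩
  have h1 : ((C r + C w * X) ^ i : ℝ[X]).natDegree < m + 1 := by
    refine Nat.lt_succ_of_le (le_trans ?_ hi)
    refine natDegree_pow_le.trans ?_
    calc i * _ ≤ i * 1 := by
          gcongr
          compute_degree
      _ = i := mul_one i
  rw [Fin.sum_univ_eq_sum_range (fun k => ((C r + C w * X) ^ i : ℝ[X]).coeff k * x ^ k),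
    ← eval_eq_sum_range' h1]
  simp

/-- The substitution does not mix the variables, so the degree in each is still at most `m`.
Normalized weights at every scale therefore lie in one finite-dimensional space. -/
lemma exists_bipoly_affine (a : Fin (m + 1) → Fin (m + 1) → ℝ) (r w y c : ℝ) :
    ∃ b : Fin (m + 1) → Fin (m + 1) → ℝ, ∀ x s,
      bipoly b x s = bipoly a (r + w * x) (y + c * s) := by
  have h : ∀ i j : Fin (m + 1), ∃ b : Fin (m + 1) → Fin (m + 1) → ℝ, ∀ x s,
      bipoly b x s = a i j * ((r + w * x) ^ (i : ℕ) * (y + c * s) ^ (j : ℕ)) := by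
    intro i j
    obtain ⟨u, hu⟩ := exists_affine_pow (Nat.le_of_lt_succ i.2) r w
    obtain ⟨v, hv⟩ := exists_affine_pow (Nat.le_of_lt_succ j.2) y c
    refine ⟨fun k l => a i j * (u k * v l), fun x s => ?_⟩
    rw [bipoly_eq_sum, hu, hv, Finset.sum_mul_sum, Finset.mul_sum]
    refine Finset.sum_congr rfl fun k _ => ?_
    rw [Finset.mul_sum]
    refine Finset.sum_congr rfl fun l _ => ?_
    ring
  obtain ⟨b, hb⟩ := exists_bipoly_sum Finset.univ _ fun i _ =>
    exists_bipoly_sum Finset.univ _ fun j _ => h i j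
  exact ⟨b, fun x s => by rw [hb, bipoly_eq_sum]⟩

variable {φ : ℝ × ℝ → ℝ} {a : Fin (m + 1) → Fin (m + 1) → ℝ}

lemma dx_eq_bipoly (ha : ∀ z, φ z = bipoly a z.1 z.2) (z : ℝ × ℝ) :
    dx φ z = bipoly (bipolyDeriv a) z.1 z.2 := by
  simp only [dx, ha]
  exact (hasDerivAt_bipoly a z.1 z.2).deriv

lemma dy_eq_bipoly (ha : ∀ z, φ z = bipoly a z.1 z.2) (z : ℝ × ℝ) :
    dy φ z = bipoly (bipolyDeriv fun i j => a j i) z.2 z.1 := by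
  simp only [dy, ha]
  simp only [← bipoly_swap a]
  exact (hasDerivAt_bipoly (fun i j => a j i) z.2 z.1).deriv

lemma continuous_dx_of_bipoly (ha : ∀ z, φ z = bipoly a z.1 z.2) : Continuous (dx φ) := by
  rw [funext (dx_eq_bipoly ha)]
  exact continuous_bipoly _

lemma continuous_dy_of_bipoly (ha : ∀ z, φ z = bipoly a z.1 z.2) : Continuous (dy φ) := by
  rw [funext (dy_eq_bipoly ha)]
  exact (continuous_bipoly _).comp continuous_swap

lemma hasDerivAt_fst_of_bipoly (ha : ∀ z, φ z = bipoly a z.1 z.2) (x y : ℝ) :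
    HasDerivAt (fun s => φ (s, y)) (dx φ (x, y)) x := by
  rw [dx_eq_bipoly ha]
  simp only [ha]
  exact hasDerivAt_bipoly a x y

lemma hasDerivAt_snd_of_bipoly (ha : ∀ z, φ z = bipoly a z.1 z.2) (x y : ℝ) :
    HasDerivAt (fun s => φ (x, s)) (dy φ (x, y)) y := by
  rw [dy_eq_bipoly ha]
  simp only [ha, ← bipoly_swap a]
  exact hasDerivAt_bipoly _ y x

/-! ### Crossings from negative to positive values -/

/-- `f` changes sign from `-` to `+` in `[-c, c]` at most at the point `r`. -/
def IsCrossing (f : ℝ → ℝ) (c r : ℝ) : Prop :=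
  ∀ s ∈ Icc (-c) c, ∀ t ∈ Icc (-c) c, s < t → f s < 0 → 0 < f t → s < r ∧ r < t

lemma IsCrossing.apply_eq_zero {f : ℝ → ℝ} {c r s t : ℝ} (h : IsCrossing f c r)
    (hs : s ∈ Icc (-c) c) (ht : t ∈ Icc (-c) c) (hst : s < t) (hfs : f s < 0) (hft : 0 < f t) :
    f r = 0 := by
  obtain ⟨h1, h2⟩ := h s hs t ht hst hfs hft
  have hr : r ∈ Icc (-c) c := ⟨hs.1.trans h1.le, h2.le.trans ht.2⟩
  by_contra hne
  rcases lt_or_gt_of_ne hne with hlt | hlt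
  · exact lt_irrefl _ (h r hr t ht h2 hlt hft).1
  · exact lt_irrefl _ (h s hs r hr h1 hfs hlt).2

/-- Between two distinct crossing points a negative value contradicts the left one and a positive
value the right one, so a polynomial would vanish on an interval. An actual sign change is required,
since otherwise every `r` qualifies. -/
lemma IsCrossing.unique {p : Polynomial ℝ} {c r r' s t : ℝ} (h : IsCrossing (fun x => p.eval x) c r)
    (h' : IsCrossing (fun x => p.eval x) c r') (hs : s ∈ Icc (-c) c) (ht : t ∈ Icc (-c) c)
    (hst : s < t) (hfs : p.eval s < 0) (hft : 0 < p.eval t) : r = r' := by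
  wlog hlt : r < r' generalizing r r'
  · rcases lt_trichotomy r r' with h1 | h1 | h1
    · exact absurd h1 hlt
    · exact h1
    · exact (this h' h h1).symm
  exfalso
  obtain ⟨h1, -⟩ := h s hs t ht hst hfs hft
  obtain ⟨-, h2⟩ := h' s hs t ht hst hfs hft
  have hzero : ∀ z ∈ Ioo r r', p.eval z = 0 := by
    intro z hz
    have hzI : z ∈ Icc (-c) c := ⟨hs.1.trans (h1.trans hz.1).le, (hz.2.trans h2).le.trans ht.2⟩
    by_contra hne
    rcases lt_or_gt_of_ne hne with hneg | hpos
    · exact absurd (h z hzI t ht (hz.2.trans h2) hneg hft).1 (not_lt.2 hz.1.le)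
    · exact absurd (h' s hs z hzI (h1.trans hz.1) hfs hpos).2 (not_lt.2 hz.2.le)
  have hp0 : p = 0 :=
    Polynomial.eq_zero_of_infinite_isRoot p ((Ioo_infinite hlt).mono fun z hz => hzero z hz)
  simp [hp0] at hfs

/-- A crossing depends continuously on a parameter. -/
lemma IsCrossing.continuousAt {R : ℝ → ℝ → ℝ} (hR : Continuous fun z : ℝ × ℝ => R z.1 z.2)
    {p : Polynomial ℝ} {c y₀ s t : ℝ} {r : ℝ → ℝ} (hp : ∀ x, R x y₀ = p.eval x)
    (h : ∀ᶠ y in 𝓝 y₀, IsCrossing (fun x => R x y) c (r y)) (hs : s ∈ Icc (-c) c)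
    (ht : t ∈ Icc (-c) c) (hst : s < t) (hfs : R s y₀ < 0) (hft : 0 < R t y₀) :
    ContinuousAt r y₀ := by
  have h0 := h.self_of_nhds
  obtain ⟨h1, h2⟩ := h0 s hs t ht hst hfs hft
  have hsec : ∀ x, Continuous fun y => R x y := fun x =>
    hR.comp (by fun_prop : Continuous fun y : ℝ => (x, y))
  -- A nonzero polynomial has nonzero values arbitrarily close to the crossing on both sides. Their
  -- signs persist for nearby parameters and squeeze the nearby crossings.
  have hinf : ∀ {u v : ℝ}, u < v → ∃ z ∈ Ioo u v, R z y₀ ≠ 0 := by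
    intro u v huv
    by_contra! hcon
    have hp0 : p = 0 := Polynomial.eq_zero_of_infinite_isRoot p
      ((Ioo_infinite huv).mono fun z hz => (hp z).symm.trans (hcon z hz))
    rw [hp, hp0] at hfs
    simp at hfs
  rw [Metric.continuousAt_iff']
  intro ε hε
  obtain ⟨u, hu, hune⟩ := hinf (show max s (r y₀ - ε) < r y₀ from max_lt h1 (by linarith))
  obtain ⟨v, hv, hvne⟩ := hinf (show r y₀ < min t (r y₀ + ε) from lt_min h2 (by linarith))
  have hsu : s < u := (le_max_left _ _).trans_lt hu.1
  have hvt : v < t := hv.2.trans_le (min_le_left _ _)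
  have huI : u ∈ Icc (-c) c := ⟨hs.1.trans hsu.le, (hu.2.trans h2).le.trans ht.2⟩
  have hvI : v ∈ Icc (-c) c := ⟨hs.1.trans (h1.trans hv.1).le, hvt.le.trans ht.2⟩
  have huneg : R u y₀ < 0 := by
    refine lt_of_le_of_ne (not_lt.1 fun hpos => ?_) hune
    exact absurd (h0 s hs u huI hsu hfs hpos).2 (not_lt.2 hu.2.le)
  have hvpos : 0 < R v y₀ := by
    refine lt_of_le_of_ne (not_lt.1 fun hneg => ?_) hvne.symm
    exact absurd (h0 v hvI t ht hvt hneg hft).1 (not_lt.2 hv.1.le)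
  filter_upwards [h, ((hsec u).tendsto y₀).eventually_lt_const huneg,
    ((hsec v).tendsto y₀).eventually_const_lt hvpos] with y hy hy1 hy2
  obtain ⟨h3, h4⟩ := hy u huI v hvI (hu.2.trans hv.1) hy1 hy2
  rw [Real.dist_eq, abs_lt]
  have h5 := (le_max_right s (r y₀ - ε)).trans_lt hu.1
  have h6 := hv.2.trans_le (min_le_right t (r y₀ + ε))
  constructor <;> linarith

/-- The condition `H₁` passes to all `y` by density. -/
lemma exists_isCrossing_of_H1 {α c : ℝ} {Ωx Ωy : Set ℝ} (hx : Icc (-c) c ⊆ Ωx)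
    (hy : Icc (-c) c ⊆ Ωy) (hR : Continuous (dx φ)) (hT : Continuous (dy φ))
    (h1 : H1 α φ Ωx Ωy) {y s₀ t₀ : ℝ} (hyc : y ∈ Icc (-c) c) (hs₀ : s₀ ∈ Icc (-c) c)
    (ht₀ : t₀ ∈ Icc (-c) c) (hst : s₀ < t₀) (hneg : dx φ (s₀, y) < 0) (hpos : 0 < dx φ (t₀, y)) :
    ∃ r, IsCrossing (fun x => dx φ (x, y)) c r ∧
      NoSignChange (fun s => dy φ (r, s)) (Icc (-c) c) := by
  obtain ⟨N, om, ρ, -, -, -, hcl, hH, -⟩ := h1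
  have hymem : y ∈ ⋃ j, closure (om j) := by
    rw [hcl]; exact subset_closure (hy hyc)
  obtain ⟨j, hj⟩ := mem_iUnion.1 hymem
  have hsec : ∀ x, Continuous fun y => dx φ (x, y) := fun x =>
    hR.comp (by fun_prop : Continuous fun y : ℝ => (x, y))
  have hsub : ∀ {s t : ℝ}, s ∈ Icc (-c) c → t ∈ Icc (-c) c → Icc s t ⊆ Icc (-c) c :=
    fun hs ht => Icc_subset_Icc hs.1 ht.2
  have : (𝓝[om j] y).NeBot := mem_closure_iff_nhdsWithin_neBot.1 hj
  have hev : ∀ {s t : ℝ}, s ∈ Icc (-c) c → t ∈ Icc (-c) c → s < t → dx φ (s, y) < 0 →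
      0 < dx φ (t, y) → ∀ᶠ y' in 𝓝[om j] y, (s < ρ j y' ∧ ρ j y' < t) ∧
        NoSignChange (fun s => dy φ (ρ j y', s)) Ωy := by
    intro s t hs ht hlt hsn htp
    filter_upwards [self_mem_nhdsWithin,
      nhdsWithin_le_nhds (((hsec s).tendsto y).eventually_lt_const hsn),
      nhdsWithin_le_nhds (((hsec t).tendsto y).eventually_const_lt htp)] with y' hy' h2 h3
    rcases hH j y' hy' with h4 | h4
    · exact absurd (h4 s t hlt ((hsub hs ht).trans hx) h2) (not_le.2 h3)
    · exact ⟨h4.1.2 s t hlt ((hsub hs ht).trans hx) h2 h3, h4.2⟩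
  -- The heights in `om j` accumulate at `y`, but nothing is known about convergence of `ρ j` there;
  -- a cluster point is enough.
  have hcomp : ∃ r ∈ Icc s₀ t₀, MapClusterPt r (𝓝[om j] y) (ρ j) := by
    refine isCompact_Icc.exists_mapClusterPt ?_
    exact Filter.tendsto_principal.2
      ((hev hs₀ ht₀ hst hneg hpos).mono fun y' h => ⟨h.1.1.le, h.1.2.le⟩)
  obtain ⟨r, hr, hclr⟩ := hcomp
  have hclosed : ∀ {s t : ℝ}, s ∈ Icc (-c) c → t ∈ Icc (-c) c → s < t → dx φ (s, y) < 0 →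
      0 < dx φ (t, y) → s ≤ r ∧ r ≤ t := by
    intro s t hs ht hlt hsn htp
    have h2 : r ∈ Icc s t := isClosed_Icc.mem_of_mapClusterPt hclr
      ((hev hs ht hlt hsn htp).mono fun y' h => ⟨h.1.1.le, h.1.2.le⟩)
    exact h2
  have hsecx : Continuous fun x => dx φ (x, y) :=
    hR.comp (by fun_prop : Continuous fun x : ℝ => (x, y))
  -- The limit yields only weak inequalities. They become strict because the sign at an endpoint
  -- persists a little further inside the interval.
  refine ⟨r, fun s hs t ht hlt hsn htp => ⟨?_, ?_⟩, ?_⟩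
  · have h2 : ∀ᶠ z in 𝓝[>] s, dx φ (z, y) < 0 ∧ z < t :=
      nhdsWithin_le_nhds (((hsecx.tendsto s).eventually_lt_const hsn).and
        (Filter.Tendsto.eventually_lt_const hlt Filter.tendsto_id))
    obtain ⟨z, ⟨hz1, hz2⟩, hz3⟩ := (h2.and self_mem_nhdsWithin).exists
    exact lt_of_lt_of_le hz3
      (hclosed ⟨hs.1.trans (le_of_lt hz3), hz2.le.trans ht.2⟩ ht hz2 hz1 htp).1
  · have h2 : ∀ᶠ z in 𝓝[<] t, 0 < dx φ (z, y) ∧ s < z :=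
      nhdsWithin_le_nhds (((hsecx.tendsto t).eventually_const_lt htp).and
        (Filter.Tendsto.eventually_const_lt hlt Filter.tendsto_id))
    obtain ⟨z, ⟨hz1, hz2⟩, hz3⟩ := (h2.and self_mem_nhdsWithin).exists
    exact lt_of_le_of_lt
      (hclosed hs ⟨hs.1.trans hz2.le, (le_of_lt hz3).trans ht.2⟩ hz2 hsn hz1).2 hz3
  · intro s t hlt hsubst hsn
    by_contra! htp
    have hT' : ∀ s, Continuous fun x => dy φ (x, s) := fun s =>
      hT.comp (by fun_prop : Continuous fun x : ℝ => (x, s))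
    have h2 : ∀ᶠ x in 𝓝 r, dy φ (x, s) < 0 ∧ 0 < dy φ (x, t) :=
      (((hT' s).tendsto r).eventually_lt_const hsn).and
        (((hT' t).tendsto r).eventually_const_lt htp)
    have h3 := mapClusterPt_iff_frequently.1 hclr _ h2
    obtain ⟨y', hy', hy''⟩ := (h3.and_eventually (hev hs₀ ht₀ hst hneg hpos)).exists
    exact absurd (hy''.2 s t hlt (hsubst.trans hy) hy'.1) (not_le.2 hy'.2)

end

/-! ### Valleys move: no valley stays long in a narrow window -/

section

variable {m : ℕ} {φ : ℝ × ℝ → ℝ} {a : Fin (m + 1) → Fin (m + 1) → ℝ}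

lemma exists_neg_pos_of_lt (ha : ∀ z, φ z = bipoly a z.1 z.2) {x δ s : ℝ} (hδ : 0 < δ)
    (h1 : φ (x, s) < φ (x + δ, s)) (h2 : φ (x, s) < φ (x - δ, s)) :
    ∃ u ∈ Ioo (x - δ) x, ∃ v ∈ Ioo x (x + δ), dx φ (u, s) < 0 ∧ 0 < dx φ (v, s) := by
  have hd := hasDerivAt_fst_of_bipoly ha
  have hcont : Continuous fun x => φ (x, s) :=
    continuous_iff_continuousAt.2 fun x => (hd x s).continuousAt
  obtain ⟨u, hu, hu'⟩ := exists_hasDerivAt_eq_slope (fun x => φ (x, s)) (fun x => dx φ (x, s))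
    (show x - δ < x by linarith) hcont.continuousOn (fun z _ => hd z s)
  obtain ⟨v, hv, hv'⟩ := exists_hasDerivAt_eq_slope (fun x => φ (x, s)) (fun x => dx φ (x, s))
    (show x < x + δ by linarith) hcont.continuousOn (fun z _ => hd z s)
  refine ⟨u, hu, v, hv, ?_, ?_⟩
  · rw [hu']
    exact div_neg_of_neg_of_pos (by linarith) (by linarith)
  · rw [hv']
    exact div_pos (by linarith) (by linarith)

/-- On an interval where the crossing is a simple root of an auxiliary polynomial, it moves with
speed at least `α`. -/
lemma mul_le_of_simple_root (ha : ∀ z, φ z = bipoly a z.1 z.2) {α c : ℝ} (hα : 0 < α)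
    {Ωx Ωy : Set ℝ} (hx : Icc (-c) c ⊆ Ωx) (hy : Icc (-c) c ⊆ Ωy) (h1 : H1 α φ Ωx Ωy)
    {n : ℕ} {b : Fin (n + 1) → Fin (n + 1) → ℝ} {r : ℝ → ℝ} {c' d' x₀ δ : ℝ}
    (hlt : c' < d') (hcd : Ioo c' d' ⊆ Icc (-c) c)
    (hpair : ∀ s ∈ Ioo c' d', ∃ u ∈ Icc (-c) c, ∃ v ∈ Icc (-c) c, u < v ∧ x₀ - δ < u ∧ v < x₀ + δ ∧
      dx φ (u, s) < 0 ∧ 0 < dx φ (v, s))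
    (hr : ∀ s ∈ Ioo c' d', IsCrossing (fun x => dx φ (x, s)) c (r s))
    (hb : ∀ s ∈ Ioo c' d', bipoly b (r s) s = 0 ∧ bipoly (bipolyDeriv b) (r s) s ≠ 0) :
    α * (d' - c') ≤ 2 * δ := by
  have hopen : ∀ s ∈ Ioo c' d', ∀ᶠ t in 𝓝 s, t ∈ Ioo c' d' := fun s hs => isOpen_Ioo.mem_nhds hs
  have hpoly : ∀ s x, dx φ (x, s) = ((bipolyPoly (bipolyDeriv a)).map
      (Polynomial.evalRingHom s)).eval x := fun s x => by
    rw [eval_bipolyPoly, dx_eq_bipoly ha]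
  have hrcont : ∀ s ∈ Ioo c' d', ContinuousAt r s := by
    intro s hs
    obtain ⟨u, hu, v, hv, huv, -, -, hneg, hpos⟩ := hpair s hs
    exact IsCrossing.continuousAt (R := fun x y => dx φ (x, y)) (continuous_dx_of_bipoly ha)
      (hpoly s) ((hopen s hs).mono fun t ht => hr t ht) hu hv huv hneg hpos
  set V : ℝ → ℝ := fun s => -bipoly (bipolyDeriv fun i j => b j i) s (r s) /
    bipoly (bipolyDeriv b) (r s) s with hV
  have hderiv : ∀ s ∈ Ioo c' d', HasDerivAt r (V s) s := by
    intro s hs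
    refine hasDerivAt_of_root (g := bipoly b) (gx := bipoly (bipolyDeriv b))
      (hasDerivAt_bipoly b) (continuous_bipoly _) ?_ (hrcont s hs)
      ((hopen s hs).mono fun t ht => (hb t ht).1) (hb s hs).2
    have h2 := hasDerivAt_bipoly (fun i j => b j i) s (r s)
    simpa only [bipoly_swap] using h2
  have hVcont : ∀ s ∈ Ioo c' d', ContinuousAt V s := by
    intro s hs
    have h2 := hrcont s hs
    have h3 : ContinuousAt (fun t => bipoly (bipolyDeriv b) (r t) t) s :=
      ContinuousAt.comp (g := fun z : ℝ × ℝ => bipoly (bipolyDeriv b) z.1 z.2)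
        (f := fun t => (r t, t)) (continuous_bipoly _).continuousAt (h2.prodMk continuousAt_id)
    have h4 : ContinuousAt (fun t => bipoly (bipolyDeriv fun i j => b j i) t (r t)) s :=
      ContinuousAt.comp (g := fun z : ℝ × ℝ => bipoly (bipolyDeriv fun i j => b j i) z.1 z.2)
        (f := fun t => (t, r t)) (continuous_bipoly _).continuousAt (continuousAt_id.prodMk h2)
    exact h4.neg.div h3 (hb s hs).2
  obtain ⟨N, om, ρ, hopenom, -, -, hcl, hH, hslope⟩ := h1
  have hVom : ∀ j, ∀ s ∈ Ioo c' d', s ∈ om j → α ≤ |V s| := by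
    intro j s hs hsj
    -- By uniqueness of crossings the chosen branch agrees locally with the branch of the
    -- hypothesis, whose slope is bounded below.
    have heq : r =ᶠ[𝓝 s] ρ j := by
      filter_upwards [hopen s hs, (hopenom j).mem_nhds hsj] with t ht htj
      obtain ⟨u, hu, v, hv, huv, -, -, hneg, hpos⟩ := hpair t ht
      have hsub : ∀ {p q : ℝ}, p ∈ Icc (-c) c → q ∈ Icc (-c) c → Icc p q ⊆ Ωx :=
        fun hp hq => (Icc_subset_Icc hp.1 hq.2).trans hx
      rcases hH j t htj with h4 | h4
      · exact absurd (h4 u v huv (hsub hu hv) hneg) (not_le.2 hpos)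
      · have h5 : IsCrossing (fun x => dx φ (x, t)) c (ρ j t) := fun p hp q hq hpq h6 h7 =>
          h4.1.2 p q hpq (hsub hp hq) h6 h7
        have h6 := hr t ht
        simp only [hpoly t] at h5 h6 hneg hpos
        exact h6.unique h5 hu hv huv hneg hpos
    have := hslope j s hsj
    rwa [← heq.deriv_eq, (hderiv s hs).deriv] at this
  -- The sets `om j` are only dense near these heights, and their branches need not match at the
  -- boundaries. The formula `V` for the slope is continuous on the whole interval, which extends
  -- the bound.
  have hVge : ∀ s ∈ Ioo c' d', α ≤ |V s| := by
    intro s hs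
    have hsmem : s ∈ ⋃ j, closure (om j) := by
      rw [hcl]; exact subset_closure (hy (hcd hs))
    obtain ⟨j, hj⟩ := mem_iUnion.1 hsmem
    have : (𝓝[om j] s).NeBot := mem_closure_iff_nhdsWithin_neBot.1 hj
    have hlim : Filter.Tendsto (fun t => |V t|) (𝓝[om j] s) (𝓝 |V s|) :=
      (hVcont s hs).abs.tendsto.mono_left nhdsWithin_le_nhds
    refine ge_of_tendsto hlim ?_
    filter_upwards [self_mem_nhdsWithin, nhdsWithin_le_nhds (hopen s hs)] with t htj ht
    exact hVom j t ht htj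
  have hmem : ∀ s ∈ Ioo c' d', r s ∈ Ioo (x₀ - δ) (x₀ + δ) := by
    intro s hs
    obtain ⟨u, hu, v, hv, huv, hu', hv', hneg, hpos⟩ := hpair s hs
    obtain ⟨h2, h3⟩ := hr s hs u hu v hv huv hneg hpos
    exact ⟨hu'.trans h2, h3.trans hv'⟩
  by_contra! hcon
  -- A quarter of the excess length is removed at each end: `r` is controlled only in the open
  -- interval, and what remains is still longer than `2 * δ / α`.
  set gap := (d' - c') - 2 * δ / α with hgap
  have hgap0 : 0 < gap := by
    rw [hgap, sub_pos, div_lt_iff₀ hα]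
    linarith
  have hδα : 0 < 2 * δ / α := by
    have hne : (Ioo c' d').Nonempty := nonempty_Ioo.2 hlt
    obtain ⟨s, hs⟩ := hne
    have := hmem s hs
    have : 0 < δ := by linarith [this.1.trans this.2]
    positivity
  have hsub : Icc (c' + gap / 4) (d' - gap / 4) ⊆ Ioo c' d' := fun z hz =>
    ⟨by linarith [hz.1], by linarith [hz.2]⟩
  have hlt' : c' + gap / 4 < d' - gap / 4 := by linarith
  obtain ⟨ξ, hξ, hξ'⟩ := exists_hasDerivAt_eq_slope r V hlt'
    (fun z hz => (hrcont z (hsub hz)).continuousWithinAt)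
    (fun z hz => hderiv z (hsub (Ioo_subset_Icc_self hz)))
  have h2 := hVge ξ (hsub (Ioo_subset_Icc_self hξ))
  have hpos : 0 < (d' - gap / 4) - (c' + gap / 4) := by linarith
  rw [hξ', abs_div, abs_of_pos hpos, le_div_iff₀ hpos] at h2
  have h3 := hmem _ (hsub (left_mem_Icc.2 hlt'.le))
  have h4 := hmem _ (hsub (right_mem_Icc.2 hlt'.le))
  have h5 : |r (d' - gap / 4) - r (c' + gap / 4)| < 2 * δ := by
    rw [abs_lt]
    constructor <;> linarith [h3.1, h3.2, h4.1, h4.2]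
  have h6 : 2 * δ < α * ((d' - gap / 4) - (c' + gap / 4)) := by
    have h7 : 2 * δ / α < (d' - gap / 4) - (c' + gap / 4) := by linarith
    rw [div_lt_iff₀ hα] at h7
    linarith
  linarith

/-- No valley stays in a window for a time long compared to the size of the window. -/
theorem exists_noStay (ha : ∀ z, φ z = bipoly a z.1 z.2) {α c : ℝ} (hα : 0 < α)
    {Ωx Ωy : Set ℝ} (hx : Icc (-c) c ⊆ Ωx) (hy : Icc (-c) c ⊆ Ωy) (h1 : H1 α φ Ωx Ωy) :
    ∃ L : ℝ, 0 ≤ L ∧ ∀ x₀ δ s₁ s₂ : ℝ, 0 < δ → Icc (x₀ - δ) (x₀ + δ) ⊆ Icc (-c) c →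
      Icc s₁ s₂ ⊆ Icc (-c) c → s₁ < s₂ → L * δ < s₂ - s₁ →
      ∃ s ∈ Icc s₁ s₂, φ (x₀ + δ, s) ≤ φ (x₀, s) ∨ φ (x₀ - δ, s) ≤ φ (x₀, s) := by
  by_cases hB : bipolyPoly (bipolyDeriv a) = 0
  · refine ⟨0, le_rfl, fun x₀ δ s₁ s₂ hδ _ _ hs _ => ?_⟩
    by_contra! hcon
    obtain ⟨h2, h3⟩ := hcon s₁ (left_mem_Icc.2 hs.le)
    obtain ⟨u, -, -, -, hneg, -⟩ := exists_neg_pos_of_lt ha hδ h2 h3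
    rw [dx_eq_bipoly ha, ← eval_bipolyPoly, hB] at hneg
    simp at hneg
  obtain ⟨G, d, hd, hG⟩ := exists_simple_roots hB
  obtain ⟨n, b, hb⟩ := exists_bipoly_eq G
  -- A stay is cut at the exceptional heights, the roots of `d`. A piece free of them has at least
  -- the fraction `1 / (card + 1)` of the total length, and the speed bound limits it to `2 * δ /
  -- α`.
  refine ⟨2 * (d.roots.toFinset.card + 1) / α, by positivity,
    fun x₀ δ s₁ s₂ hδ hxδ hs12 hs hL => ?_⟩
  by_contra! hcon
  obtain ⟨c', d', hc', hcd', hd', hF, hlen⟩ := exists_subinterval_avoiding d.roots.toFinset hs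
  have hsub : Ioo c' d' ⊆ Icc s₁ s₂ := fun z hz => ⟨hc'.trans hz.1.le, hz.2.le.trans hd'⟩
  have hpair : ∀ s ∈ Ioo c' d', ∃ u ∈ Icc (-c) c, ∃ v ∈ Icc (-c) c, u < v ∧ x₀ - δ < u ∧
      v < x₀ + δ ∧ dx φ (u, s) < 0 ∧ 0 < dx φ (v, s) := by
    intro s hs
    obtain ⟨h2, h3⟩ := hcon s (hsub hs)
    obtain ⟨u, hu, v, hv, hneg, hpos⟩ := exists_neg_pos_of_lt ha hδ h2 h3
    exact ⟨u, hxδ ⟨hu.1.le, by linarith [hu.2]⟩, v, hxδ ⟨by linarith [hv.1], hv.2.le⟩,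
      hu.2.trans hv.1, hu.1, hv.2, hneg, hpos⟩
  have hex : ∀ s, ∃ r, s ∈ Ioo c' d' → IsCrossing (fun x => dx φ (x, s)) c r := by
    intro s
    by_cases hs : s ∈ Ioo c' d'
    · obtain ⟨u, hu, v, hv, huv, -, -, hneg, hpos⟩ := hpair s hs
      obtain ⟨r, hr, -⟩ := exists_isCrossing_of_H1 hx hy (continuous_dx_of_bipoly ha)
        (continuous_dy_of_bipoly ha) h1 (hs12 (hsub hs)) hu hv huv hneg hpos
      exact ⟨r, fun _ => hr⟩
    · exact ⟨0, fun h => absurd h hs⟩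
  choose r hr using hex
  have hroot : ∀ s ∈ Ioo c' d', bipoly b (r s) s = 0 ∧ bipoly (bipolyDeriv b) (r s) s ≠ 0 := by
    intro s hs
    have hds : d.eval s ≠ 0 := by
      intro h0
      exact hF s (by simpa [hd] using h0) hs
    obtain ⟨u, hu, v, hv, huv, -, -, hneg, hpos⟩ := hpair s hs
    have h2 := (hr s hs).apply_eq_zero hu hv huv hneg hpos
    rw [dx_eq_bipoly ha, ← eval_bipolyPoly] at h2
    obtain ⟨h3, h4⟩ := hG s hds _ h2
    refine ⟨by rwa [← hb], ?_⟩
    have h5 : HasDerivAt (fun x => bipoly b x s)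
        ((G.map (Polynomial.evalRingHom s)).derivative.eval (r s)) (r s) := by
      simp only [← hb]
      exact Polynomial.hasDerivAt _ _
    rwa [(hasDerivAt_bipoly b (r s) s).unique h5]
  have h2 := mul_le_of_simple_root ha hα hx hy h1 hcd' (hsub.trans hs12) hpair hr hroot
  rw [hlen, mul_comm, mul_div_assoc', div_lt_iff₀ hα] at hL
  have h3 : (0 : ℝ) < d.roots.toFinset.card + 1 := by positivity
  nlinarith

end

/-! ### Partial derivatives, and transport along a line -/

section

variable {E : Type*} [NormedAddCommGroup E] [NormedSpace ℝ E]

lemma hasDerivAt_fst_fderiv {u : ℝ × ℝ → E} (hu : Differentiable ℝ u) (z : ℝ × ℝ) :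
    HasDerivAt (fun s => u (s, z.2)) (fderiv ℝ u z (1, 0)) z.1 := by
  have h1 : HasDerivAt (fun s : ℝ => (s, z.2)) ((1 : ℝ), (0 : ℝ)) z.1 :=
    (hasDerivAt_id z.1).prodMk (hasDerivAt_const z.1 z.2)
  exact (hu z).hasFDerivAt.comp_hasDerivAt_of_eq z.1 h1 rfl

lemma hasDerivAt_snd_fderiv {u : ℝ × ℝ → E} (hu : Differentiable ℝ u) (z : ℝ × ℝ) :
    HasDerivAt (fun s => u (z.1, s)) (fderiv ℝ u z (0, 1)) z.2 := by
  have h1 : HasDerivAt (fun s : ℝ => (z.1, s)) ((0 : ℝ), (1 : ℝ)) z.2 :=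
    (hasDerivAt_const z.2 z.1).prodMk (hasDerivAt_id z.2)
  exact (hu z).hasFDerivAt.comp_hasDerivAt_of_eq z.2 h1 rfl

lemma hasDerivAt_dx {u : ℝ × ℝ → E} (hu : Differentiable ℝ u) (x y : ℝ) :
    HasDerivAt (fun s => u (s, y)) (dx u (x, y)) x :=
  (hasDerivAt_fst_fderiv hu (x, y)).differentiableAt.hasDerivAt

lemma hasDerivAt_dy {u : ℝ × ℝ → E} (hu : Differentiable ℝ u) (x y : ℝ) :
    HasDerivAt (fun s => u (x, s)) (dy u (x, y)) y :=
  (hasDerivAt_snd_fderiv hu (x, y)).differentiableAt.hasDerivAt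

lemma continuous_dx {u : ℝ × ℝ → E} (hu : ContDiff ℝ 1 u) : Continuous (dx u) := by
  have h : dx u = fun z => fderiv ℝ u z (1, 0) :=
    funext fun z => (hasDerivAt_fst_fderiv (hu.differentiable one_ne_zero) z).deriv
  rw [h]
  exact (hu.continuous_fderiv one_ne_zero).clm_apply continuous_const

lemma continuous_dy {u : ℝ × ℝ → E} (hu : ContDiff ℝ 1 u) : Continuous (dy u) := by
  have h : dy u = fun z => fderiv ℝ u z (0, 1) :=
    funext fun z => (hasDerivAt_snd_fderiv (hu.differentiable one_ne_zero) z).deriv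
  rw [h]
  exact (hu.continuous_fderiv one_ne_zero).clm_apply continuous_const

/-- Transport along the solutions of `v' + p' v = 0`, whose size is a multiple of `exp (-p)`. -/
lemma enorm_le_add_lintegral {p p' : ℝ → ℝ} {v v' : ℝ → ℂ} (hp : ∀ t, HasDerivAt p (p' t) t)
    (hv : ∀ t, HasDerivAt v (v' t) t) (hp' : Continuous p') (hv' : Continuous v') (q x₀ x₁ : ℝ) :
    ENNReal.ofReal (Real.exp (p x₁ - q)) * ‖v x₁‖ₑ ≤
      ENNReal.ofReal (Real.exp (p x₀ - q)) * ‖v x₀‖ₑ +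
      ∫⁻ t in uIcc x₀ x₁, ENNReal.ofReal (Real.exp (p t - q)) * ‖v' t + p' t • v t‖ₑ := by
  have hpc : Continuous p := continuous_iff_continuousAt.2 fun t => (hp t).continuousAt
  have hvc : Continuous v := continuous_iff_continuousAt.2 fun t => (hv t).continuousAt
  -- The integrating factor. The constant `q` only normalizes the exponential; it is later the
  -- weight at the starting point of the path.
  have hder : ∀ t, HasDerivAt (fun t => Real.exp (p t - q) • v t)
      (Real.exp (p t - q) • (v' t + p' t • v t)) t := by
    intro t
    refine ((((hp t).sub_const q).exp).smul (hv t)).congr_deriv ?_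
    rw [smul_add, smul_smul, add_comm]
  have hint := intervalIntegral.integral_eq_sub_of_hasDerivAt (a := x₀) (b := x₁)
    (fun t _ => hder t) (Continuous.intervalIntegrable (by fun_prop) _ _)
  have hen : ∀ t, ‖Real.exp (p t - q) • (v' t + p' t • v t)‖ₑ =
      ENNReal.ofReal (Real.exp (p t - q)) * ‖v' t + p' t • v t‖ₑ := by
    intro t
    rw [enorm_smul, Real.enorm_of_nonneg (Real.exp_pos _).le]
  have hen' : ∀ t, ‖Real.exp (p t - q) • v t‖ₑ = ENNReal.ofReal (Real.exp (p t - q)) * ‖v t‖ₑ := by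
    intro t
    rw [enorm_smul, Real.enorm_of_nonneg (Real.exp_pos _).le]
  rw [← hen', ← hen', ← lintegral_congr fun t => hen t]
  have h1 : Real.exp (p x₁ - q) • v x₁ = Real.exp (p x₀ - q) • v x₀ +
      ∫ t in x₀..x₁, Real.exp (p t - q) • (v' t + p' t • v t) := by
    rw [hint]; abel
  rw [h1]
  refine (enorm_add_le _ _).trans (add_le_add le_rfl ?_)
  rw [enorm_eq_nnnorm, ← ENNReal.ofReal_coe_nnreal, coe_nnnorm, intervalIntegral.norm_intervalIntegral_eq,
    ← coe_nnnorm, ENNReal.ofReal_coe_nnreal, ← enorm_eq_nnnorm]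
  exact (enorm_integral_le_lintegral_enorm _).trans (lintegral_mono_set uIoc_subset_uIcc)

end

/-! ### Estimates along a single line -/

/-- Decay of the weight away from `x` turns the integral of `f` into a maximal function. -/
lemma exists_mul_lintegral_exp_le_hlMax (K : ℝ) (hK : 0 < K) : ∃ C : ℝ, 0 < C ∧
    ∀ (f : ℝ → ℝ≥0∞), Measurable f → ∀ (p : ℝ → ℝ) (x A : ℝ) (S : Set ℝ), MeasurableSet S →
    0 ≤ A → (∀ t ∈ S, A * |x - t| ≤ K * (p x - p t)) →
    ENNReal.ofReal A * ∫⁻ t in S, ENNReal.ofReal (Real.exp (p t - p x)) * f t ≤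
      ENNReal.ofReal C * hlMax f x := by
  obtain ⟨C, hC, h⟩ := exists_lintegral_exp_le_hlMax
  refine ⟨C * K, by positivity, fun f hf p x A S hS hA hp => ?_⟩
  rcases hA.eq_or_lt with rfl | hA
  · simp
  have hAK : 0 < A / K := by positivity
  calc ENNReal.ofReal A * ∫⁻ t in S, ENNReal.ofReal (Real.exp (p t - p x)) * f t
      ≤ ENNReal.ofReal A * ∫⁻ t, ENNReal.ofReal (Real.exp (-(A / K * |x - t|))) * f t := by
        refine mul_le_mul_right ?_ _
        refine (setLIntegral_mono' hS fun t ht => ?_).trans (setLIntegral_le_lintegral S _)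
        gcongr
        have h1 := hp t ht
        have h2 : A / K * |x - t| ≤ p x - p t := by
          rw [div_mul_eq_mul_div, div_le_iff₀ hK]
          linarith
        linarith
    _ ≤ ENNReal.ofReal A * (ENNReal.ofReal (C / (A / K)) * hlMax f x) := by
        gcongr
        exact h f hf x _ hAK
    _ = ENNReal.ofReal (C * K) * hlMax f x := by
        rw [← mul_assoc, ← ENNReal.ofReal_mul hA.le]
        congr 2
        field_simp

/-- The estimate on a line where the derivative of the weight does not change sign between the
point and an end at which the function vanishes. -/
lemma exists_mul_enorm_le_hlMax_of_sign (m : ℕ) : ∃ C : ℝ, 0 < C ∧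
    ∀ (R : Polynomial ℝ), R.natDegree ≤ m → ∀ (p : ℝ → ℝ), (∀ t, HasDerivAt p (R.eval t) t) →
    ∀ (v v' : ℝ → ℂ), (∀ t, HasDerivAt v (v' t) t) → Continuous v' → ∀ e x : ℝ, v e = 0 →
    ((∀ s ∈ Icc e x, 0 ≤ R.eval s) ∧ e ≤ x ∨ (∀ s ∈ Icc x e, R.eval s ≤ 0) ∧ x ≤ e) →
    ENNReal.ofReal |R.eval x| * ‖v x‖ₑ ≤
      ENNReal.ofReal C * hlMax (fun t => ‖v' t + R.eval t • v t‖ₑ) x := by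
  obtain ⟨K, hK, h⟩ := exists_mul_le_primitive_sub m
  obtain ⟨C, hC, h'⟩ := exists_mul_lintegral_exp_le_hlMax K hK
  refine ⟨C, hC, fun R hR p hp v v' hv hv' e x he hsign => ?_⟩
  have hvc : Continuous v := continuous_iff_continuousAt.2 fun t => (hv t).continuousAt
  have htr := enorm_le_add_lintegral hp hv R.continuous hv' (p x) e x
  rw [he, sub_self, Real.exp_zero, ENNReal.ofReal_one, one_mul, enorm_zero, mul_zero, zero_add] at htr
  have hmeas : Measurable fun t => ‖v' t + R.eval t • v t‖ₑ :=
    (hv'.add (R.continuous.smul hvc)).enorm.measurable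
  refine (mul_le_mul_right htr _).trans ?_
  refine h' _ hmeas p x _ _ measurableSet_uIcc (abs_nonneg _) fun t ht => h R hR p hp t x ?_
  rcases hsign with ⟨h1, h2⟩ | ⟨h1, h2⟩
  · rw [uIcc_of_le h2] at ht
    exact Or.inl ⟨fun s hs => h1 s ⟨ht.1.trans hs.1, hs.2⟩, ht.2⟩
  · rw [uIcc_of_ge h2] at ht
    exact Or.inr ⟨fun s hs => h1 s ⟨hs.1, hs.2.trans ht.2⟩, ht.1⟩

/-- The estimate on a line where the weight has bounded oscillation. -/
lemma exists_mul_enorm_le_hlMax_of_osc (m : ℕ) : ∃ C : ℝ, 0 < C ∧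
    ∀ (p : Polynomial ℝ), p.natDegree ≤ m → ∀ (v v' : ℝ → ℂ), (∀ t, HasDerivAt v (v' t) t) →
    Continuous v' → ∀ a b x κ q : ℝ, a < b → x ∈ Icc a b → v a = 0 →
    (∀ t ∈ Icc a b, |p.eval t - q| ≤ κ) →
    ENNReal.ofReal |p.derivative.eval x| * ‖v x‖ₑ ≤ ENNReal.ofReal (C * κ * Real.exp (2 * κ)) *
      hlMax (fun t => ‖v' t + p.derivative.eval t • v t‖ₑ) x := by
  obtain ⟨C, hC, h⟩ := exists_derivative_le m
  refine ⟨4 * C, by positivity, fun p hp v v' hv hv' a b x κ q hab hx hva hosc => ?_⟩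
  have hκ : 0 ≤ κ := (abs_nonneg _).trans (hosc x hx)
  have htr := enorm_le_add_lintegral (fun t => p.hasDerivAt t) hv p.derivative.continuous hv'
    (p.eval x) a x
  rw [hva, sub_self, Real.exp_zero, ENNReal.ofReal_one, one_mul, enorm_zero, mul_zero, zero_add,
    uIcc_of_le hx.1] at htr
  have hmark := h (p - Polynomial.C q) ((Polynomial.natDegree_sub_C).trans_le hp) a b κ hab
    (by simpa using hosc) x hx
  rw [Polynomial.derivative_sub, Polynomial.derivative_C, sub_zero] at hmark
  have hba : 0 < b - a := by linarith
  set f : ℝ → ℝ≥0∞ := fun t => ‖v' t + p.derivative.eval t • v t‖ₑ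
  calc ENNReal.ofReal |p.derivative.eval x| * ‖v x‖ₑ
      ≤ ENNReal.ofReal (C * κ / (b - a)) * (ENNReal.ofReal (Real.exp (2 * κ)) *
        (ENNReal.ofReal (4 * (b - a)) * hlMax f x)) := by
        gcongr
        · rw [le_div_iff₀ hba]; linarith
        refine htr.trans ?_
        calc ∫⁻ t in Icc a x, ENNReal.ofReal (Real.exp (p.eval t - p.eval x)) * f t
            ≤ ∫⁻ t in Icc a x, ENNReal.ofReal (Real.exp (2 * κ)) * f t := by
              refine setLIntegral_mono' measurableSet_Icc fun t ht => ?_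
              gcongr
              have h1 := abs_le.1 (hosc x hx)
              have h2 := abs_le.1 (hosc t ⟨ht.1, ht.2.trans hx.2⟩)
              linarith
          _ = ENNReal.ofReal (Real.exp (2 * κ)) * ∫⁻ t in Icc a x, f t :=
              lintegral_const_mul' _ _ ENNReal.ofReal_ne_top
          _ ≤ ENNReal.ofReal (Real.exp (2 * κ)) * ∫⁻ t in Icc (x - (b - a)) (x + (b - a)), f t := by
              gcongr
              · linarith [hx.2]
              · linarith
          _ ≤ _ := by
              gcongr
              exact lintegral_Icc_le_hlMax f x hba
    _ = _ := by
        rw [← mul_assoc, ← mul_assoc, ← ENNReal.ofReal_mul (by positivity),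
          ← ENNReal.ofReal_mul (by positivity)]
        congr 2
        field_simp

/-- A weighted landing point: `p⁻ exp (κ p)` is at most `1 / κ`. -/
lemma min_mul_exp_le {κ : ℝ} (hκ : 0 < κ) (p : ℝ) :
    min 1 (max 0 (-p)) * Real.exp (κ * p) ≤ κ⁻¹ := by
  rcases le_or_gt 0 p with hp | hp
  · rw [max_eq_left (by linarith), min_eq_right zero_le_one, zero_mul]
    positivity
  · have h1 : min 1 (max 0 (-p)) ≤ -p := (min_le_right _ _).trans (by simp [hp.le])
    have h2 := Real.add_one_le_exp (-(κ * p))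
    calc min 1 (max 0 (-p)) * Real.exp (κ * p) ≤ -p * Real.exp (κ * p) := by gcongr
      _ = κ⁻¹ * (-(κ * p) * Real.exp (κ * p)) := by field_simp
      _ ≤ κ⁻¹ * (Real.exp (-(κ * p)) * Real.exp (κ * p)) := by gcongr; linarith
      _ = κ⁻¹ := by rw [← Real.exp_add]; simp

/-! ### Paths with one horizontal and one vertical leg -/

/-- The size of `(∂ₓ + ∂ₓψ) u`. -/
noncomputable def transX (ψ : ℝ × ℝ → ℝ) (u : ℝ × ℝ → ℂ) (z : ℝ × ℝ) : ℝ≥0∞ :=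
  ‖dx u z + dx ψ z • u z‖ₑ

/-- The size of `(∂_y + ∂_yψ) u`. -/
noncomputable def transY (ψ : ℝ × ℝ → ℝ) (u : ℝ × ℝ → ℂ) (z : ℝ × ℝ) : ℝ≥0∞ :=
  ‖dy u z + dy ψ z • u z‖ₑ

/-- The size of `(∂ₓψ) u`. -/
noncomputable def potX (ψ : ℝ × ℝ → ℝ) (u : ℝ × ℝ → ℂ) (z : ℝ × ℝ) : ℝ≥0∞ :=
  ‖dx ψ z • u z‖ₑ

section

variable {ψ : ℝ × ℝ → ℝ} {u : ℝ × ℝ → ℂ}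

lemma measurable_transX (hψ : ContDiff ℝ 1 ψ) (hu : ContDiff ℝ 1 u) : Measurable (transX ψ u) :=
  ((continuous_dx hu).add ((continuous_dx hψ).smul hu.continuous)).enorm.measurable

lemma measurable_transY (hψ : ContDiff ℝ 1 ψ) (hu : ContDiff ℝ 1 u) : Measurable (transY ψ u) :=
  ((continuous_dy hu).add ((continuous_dy hψ).smul hu.continuous)).enorm.measurable

lemma measurable_potX (hψ : ContDiff ℝ 1 ψ) (hu : ContDiff ℝ 1 u) : Measurable (potX ψ u) :=
  ((continuous_dx hψ).smul hu.continuous).enorm.measurable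

lemma enorm_le_transport_horizontal (hψ : ContDiff ℝ 1 ψ) (hu : ContDiff ℝ 1 u) (q x₀ x₁ y : ℝ) :
    ENNReal.ofReal (Real.exp (ψ (x₁, y) - q)) * ‖u (x₁, y)‖ₑ ≤
      ENNReal.ofReal (Real.exp (ψ (x₀, y) - q)) * ‖u (x₀, y)‖ₑ +
      ∫⁻ t in uIcc x₀ x₁, ENNReal.ofReal (Real.exp (ψ (t, y) - q)) * transX ψ u (t, y) := by
  have hline : Continuous fun t : ℝ => (t, y) := by fun_prop
  exact enorm_le_add_lintegral (p := fun t => ψ (t, y)) (p' := fun t => dx ψ (t, y))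
    (v := fun t => u (t, y)) (v' := fun t => dx u (t, y))
    (fun t => hasDerivAt_dx (hψ.differentiable one_ne_zero) t y)
    (fun t => hasDerivAt_dx (hu.differentiable one_ne_zero) t y)
    ((continuous_dx hψ).comp hline) ((continuous_dx hu).comp hline) q x₀ x₁

lemma enorm_le_transport_vertical (hψ : ContDiff ℝ 1 ψ) (hu : ContDiff ℝ 1 u) (q x s₀ s₁ : ℝ) :
    ENNReal.ofReal (Real.exp (ψ (x, s₁) - q)) * ‖u (x, s₁)‖ₑ ≤
      ENNReal.ofReal (Real.exp (ψ (x, s₀) - q)) * ‖u (x, s₀)‖ₑ +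
      ∫⁻ t in uIcc s₀ s₁, ENNReal.ofReal (Real.exp (ψ (x, t) - q)) * transY ψ u (x, t) := by
  have hline : Continuous fun t : ℝ => (x, t) := by fun_prop
  exact enorm_le_add_lintegral (p := fun t => ψ (x, t)) (p' := fun t => dy ψ (x, t))
    (v := fun t => u (x, t)) (v' := fun t => dy u (x, t))
    (fun t => hasDerivAt_dy (hψ.differentiable one_ne_zero) x t)
    (fun t => hasDerivAt_dy (hu.differentiable one_ne_zero) x t)
    ((continuous_dy hψ).comp hline) ((continuous_dy hu).comp hline) q s₀ s₁

/-- A weight bounded on a set pulls out of an integral over it. -/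
lemma lintegral_exp_mul_le {p : ℝ → ℝ} {f : ℝ → ℝ≥0∞} {S : Set ℝ} (hS : MeasurableSet S) {c : ℝ}
    (hp : ∀ t ∈ S, p t ≤ c) : ∫⁻ t in S, ENNReal.ofReal (Real.exp (p t)) * f t ≤
      ENNReal.ofReal (Real.exp c) * ∫⁻ t in S, f t := by
  rw [← lintegral_const_mul' _ _ ENNReal.ofReal_ne_top]
  refine setLIntegral_mono' hS fun t ht => ?_
  gcongr
  exact hp t ht

/-- A path from `(x, y)` along the line of height `y`, then along the vertical line through a point
close to the valley. -/
lemma enorm_le_of_path (hψ : ContDiff ℝ 1 ψ) (hu : ContDiff ℝ 1 u) {x y r w κ σ X τ : ℝ}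
    (hw : 0 < w) (hσ : |σ| = 1) (hX : X ∈ Icc (-1 : ℝ) 1) (hτ : τ ∈ Icc (0 : ℝ) 1)
    (hbox : ∀ t ∈ Icc (r - w) (r + w), ∀ s ∈ Icc (y - w) (y + w), ψ (t, s) ≤ ψ (r, s) + κ)
    (hdesc : ∀ τ ∈ Icc (0 : ℝ) 1, ψ (r, y + σ * w * τ) ≤ ψ (r, y)) :
    ‖u (x, y)‖ₑ ≤
      ENNReal.ofReal (Real.exp (ψ (r + w * X, y + σ * w * τ) - ψ (x, y))) *
        ‖u (r + w * X, y + σ * w * τ)‖ₑ +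
      ENNReal.ofReal (Real.exp (κ - (ψ (x, y) - ψ (r, y))) * (4 * w)) *
        maxY (transY ψ u) (r + w * X, y) +
      ((∫⁻ t in uIcc x r, ENNReal.ofReal (Real.exp (ψ (t, y) - ψ (x, y))) * transX ψ u (t, y)) +
        ENNReal.ofReal (Real.exp (κ - (ψ (x, y) - ψ (r, y))) * (4 * (|x - r| + w))) *
          maxX (transX ψ u) (x, y)) := by
  have hwX : |w * X| ≤ w := by
    rw [abs_mul, abs_of_pos hw]
    nlinarith [abs_le.2 hX]
  have hX' : r + w * X ∈ Icc (r - w) (r + w) := by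
    rw [abs_le] at hwX
    constructor <;> linarith [hwX.1, hwX.2]
  have hy : y ∈ Icc (y - w) (y + w) := ⟨by linarith, by linarith⟩
  have hhor := enorm_le_transport_horizontal hψ hu (ψ (x, y)) (r + w * X) x y
  have hver := enorm_le_transport_vertical hψ hu (ψ (x, y)) (r + w * X) (y + σ * w * τ) y
  rw [sub_self, Real.exp_zero, ENNReal.ofReal_one, one_mul] at hhor
  refine hhor.trans (add_le_add (hver.trans (add_le_add le_rfl ?_)) ?_)
  -- On the vertical leg the weight exceeds its value above the valley point at the same height by
  -- at most `κ`, and that value is at most `ψ (r, y)` by the descent.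
  · have hmem : ∀ t ∈ uIcc (y + σ * w * τ) y, ∃ θ ∈ Icc (0 : ℝ) 1, t = y + σ * w * θ := by
      intro t ht
      rw [← segment_eq_uIcc, segment_symm, segment_eq_image] at ht
      obtain ⟨θ, hθ, rfl⟩ := ht
      refine ⟨θ * τ, ⟨mul_nonneg hθ.1 hτ.1, mul_le_one₀ hθ.2 hτ.1 hτ.2⟩, ?_⟩
      simp only [smul_eq_mul]
      ring
    have hsub : ∀ t ∈ uIcc (y + σ * w * τ) y, t ∈ Icc (y - w) (y + w) := by
      intro t ht
      obtain ⟨θ, hθ, rfl⟩ := hmem t ht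
      have h1 : |σ * w * θ| ≤ w := by
        rw [abs_mul, abs_mul, hσ, abs_of_pos hw, abs_of_nonneg hθ.1, one_mul]
        nlinarith [hθ.2]
      rw [abs_le] at h1
      constructor <;> linarith [h1.1, h1.2]
    calc _ ≤ ENNReal.ofReal (Real.exp (κ - (ψ (x, y) - ψ (r, y)))) *
          ∫⁻ t in uIcc (y + σ * w * τ) y, transY ψ u (r + w * X, t) := by
          refine lintegral_exp_mul_le (p := fun t => ψ (r + w * X, t) - ψ (x, y))
            measurableSet_uIcc fun t ht => ?_
          have h1 := hbox _ hX' t (hsub t ht)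
          obtain ⟨θ, hθ, rfl⟩ := hmem t ht
          have h2 := hdesc θ hθ
          linarith
      _ ≤ ENNReal.ofReal (Real.exp (κ - (ψ (x, y) - ψ (r, y)))) *
          (ENNReal.ofReal (4 * w) * maxY (transY ψ u) (r + w * X, y)) := by
          gcongr
          exact (lintegral_mono_set hsub).trans
            (lintegral_Icc_le_hlMax (fun t => transY ψ u (r + w * X, t)) y hw)
      _ = _ := by
          rw [← mul_assoc, ← ENNReal.ofReal_mul (Real.exp_pos _).le]
  · have hpos : 0 < |x - r| + w := by positivity
    -- The horizontal leg is split at the valley point: up to `r` the exact weight is kept, for the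
    -- decay estimate; beyond `r` only the bound `κ` of the window is used.
    have hsub : uIcc (r + w * X) x ⊆ uIcc x r ∪ Icc (r - w) (r + w) := by
      have h1 : uIcc (r + w * X) r ⊆ Icc (r - w) (r + w) :=
        uIcc_subset_Icc hX' ⟨by linarith, by linarith⟩
      refine (uIcc_subset_uIcc_union_uIcc (b := r)).trans ?_
      rw [union_comm, uIcc_comm r x]
      exact union_subset_union_right _ h1
    refine (lintegral_mono_set hsub).trans ((lintegral_union_le _ _ _).trans
      (add_le_add le_rfl ?_))
    calc _ ≤ ENNReal.ofReal (Real.exp (κ - (ψ (x, y) - ψ (r, y)))) *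
          ∫⁻ t in Icc (r - w) (r + w), transX ψ u (t, y) := by
          refine lintegral_exp_mul_le (p := fun t => ψ (t, y) - ψ (x, y))
            measurableSet_Icc fun t ht => ?_
          linarith [hbox t ht y hy]
      _ ≤ ENNReal.ofReal (Real.exp (κ - (ψ (x, y) - ψ (r, y)))) *
          (ENNReal.ofReal (4 * (|x - r| + w)) * maxX (transX ψ u) (x, y)) := by
          gcongr
          refine (lintegral_mono_set (Icc_subset_Icc ?_ ?_)).trans
            (lintegral_Icc_le_hlMax (fun t => transX ψ u (t, y)) x hpos)
          · linarith [neg_abs_le (x - r), le_abs_self (x - r)]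
          · linarith [neg_abs_le (x - r), le_abs_self (x - r)]
      _ = _ := by
          rw [← mul_assoc, ← ENNReal.ofReal_mul (Real.exp_pos _).le]

end

/-! ### Averaging over the landing point -/

section

lemma setLIntegral_affine_fst_le_maxX {F : ℝ × ℝ → ℝ≥0∞} (hF : Measurable F) (x r y : ℝ) {w : ℝ}
    (hw : 0 < w) :
    ∫⁻ z in Icc (-1 : ℝ) 1 ×ˢ Icc (0 : ℝ) 1, F (r + w * z.1, y) ≤
      ENNReal.ofReal (4 * (|x - r| + w) / w) * maxX F (x, y) := by
  have hmeas : Measurable fun z : ℝ × ℝ => F (r + w * z.1, y) := hF.comp (by fun_prop)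
  rw [Measure.volume_eq_prod, setLIntegral_prod _ hmeas.aemeasurable]
  simp only [lintegral_const, MeasurableSet.univ, Measure.restrict_apply, univ_inter,
    Real.volume_Icc, sub_zero, ENNReal.ofReal_one, mul_one]
  have h := lintegral_Icc_affine_le_hlMax (fun t => F (t, y)) x r hw.ne'
  rwa [abs_of_pos hw] at h

/-- The vertical average starts at height `y` itself and costs only a constant. The horizontal one
is centred at `r`, and carries the loss for moving to `x`. -/
lemma setLIntegral_affine_le_maxX_maxY {F : ℝ × ℝ → ℝ≥0∞} (hF : Measurable F) (x r y : ℝ)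
    {w σ : ℝ} (hw : 0 < w) (hσ : |σ| = 1) :
    ∫⁻ z in Icc (-1 : ℝ) 1 ×ˢ Icc (0 : ℝ) 1, F (r + w * z.1, y + σ * w * z.2) ≤
      ENNReal.ofReal (16 * (|x - r| + w) / w) * maxX (maxY F) (x, y) := by
  have hmeas : Measurable fun z : ℝ × ℝ => F (r + w * z.1, y + σ * w * z.2) :=
    hF.comp (by fun_prop)
  have hσw : |σ * w| = w := by rw [abs_mul, hσ, one_mul, abs_of_pos hw]
  have hσw0 : σ * w ≠ 0 := by
    rw [← abs_ne_zero, hσw]; exact hw.ne'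
  rw [Measure.volume_eq_prod, setLIntegral_prod _ hmeas.aemeasurable]
  calc ∫⁻ X in Icc (-1 : ℝ) 1, ∫⁻ τ in Icc (0 : ℝ) 1, F (r + w * X, y + σ * w * τ)
      ≤ ∫⁻ X in Icc (-1 : ℝ) 1, ENNReal.ofReal 4 * maxY F (r + w * X, y) := by
        refine lintegral_mono fun X => ?_
        refine (lintegral_mono_set (Icc_subset_Icc (by norm_num : (-1 : ℝ) ≤ 0) le_rfl)).trans ?_
        have h := lintegral_Icc_affine_le_hlMax (fun t => F (r + w * X, t)) y y hσw0
        rw [sub_self, abs_zero, zero_add, mul_div_assoc, div_self (by rw [hσw]; exact hw.ne'),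
          mul_one] at h
        exact h
    _ = ENNReal.ofReal 4 * ∫⁻ X in Icc (-1 : ℝ) 1, maxY F (r + w * X, y) :=
        lintegral_const_mul' _ _ ENNReal.ofReal_ne_top
    _ ≤ ENNReal.ofReal 4 * (ENNReal.ofReal (4 * (|x - r| + w) / w) * maxX (maxY F) (x, y)) := by
        gcongr
        have h := lintegral_Icc_affine_le_hlMax (fun t => maxY F (t, y)) x r hw.ne'
        rwa [abs_of_pos hw] at h
    _ = _ := by
        rw [← mul_assoc, ← ENNReal.ofReal_mul (by norm_num)]
        congr 2
        ring

variable {m : ℕ} {ψ : ℝ × ℝ → ℝ} {u : ℝ × ℝ → ℂ}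

lemma bipolyDeriv_eq_of_normalized (hψ : ContDiff ℝ 1 ψ) {b : Fin (m + 1) → Fin (m + 1) → ℝ}
    {r w y κ σ : ℝ}
    (hb : ∀ X τ, bipoly b X τ = κ⁻¹ * (ψ (r + w * X, y + σ * w * τ) - ψ (r, y))) (X τ : ℝ) :
    bipoly (bipolyDeriv b) X τ = κ⁻¹ * (w * dx ψ (r + w * X, y + σ * w * τ)) := by
  have h1 := hasDerivAt_bipoly b X τ
  have h2 := hasDerivAt_dx (hψ.differentiable one_ne_zero) (r + w * X) (y + σ * w * τ)
  have h3 : HasDerivAt (fun X => r + w * X) w X := by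
    simpa using ((hasDerivAt_id X).const_mul w).const_add r
  have h4 := (((h2.comp_of_eq X h3 rfl).sub_const (ψ (r, y))).const_mul κ⁻¹)
  have h5 : (fun x => bipoly b x τ) =
      fun x => κ⁻¹ * (ψ (r + w * x, y + σ * w * τ) - ψ (r, y)) := funext fun x => hb x τ
  rw [h5] at h1
  rw [mul_comm w]
  exact h1.unique h4

/-- Averaging over the landing point of the path. -/
lemma mul_enorm_le_of_landing (hψ : ContDiff ℝ 1 ψ) (hu : ContDiff ℝ 1 u)
    {b : Fin (m + 1) → Fin (m + 1) → ℝ} {x y r w κ σ c B : ℝ} (hw : 0 < w) (hκ : 0 < κ)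
    (hσ : |σ| = 1)
    (hb : ∀ X τ, bipoly b X τ = κ⁻¹ * (ψ (r + w * X, y + σ * w * τ) - ψ (r, y)))
    (hc : c ≤ ∫ z in Icc (-1 : ℝ) 1 ×ˢ Icc (0 : ℝ) 1, landingWeight b z)
    (hB : ∀ X ∈ Icc (-1 : ℝ) 1, ∀ τ ∈ Icc (0 : ℝ) 1, |bipoly (bipolyDeriv b) X τ| ≤ B)
    (hbox : ∀ t ∈ Icc (r - w) (r + w), ∀ s ∈ Icc (y - w) (y + w), ψ (t, s) ≤ ψ (r, s) + κ)
    (hdesc : ∀ τ ∈ Icc (0 : ℝ) 1, ψ (r, y + σ * w * τ) ≤ ψ (r, y)) :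
    ENNReal.ofReal c * ‖u (x, y)‖ₑ ≤
      ENNReal.ofReal (16 * ((|x - r| + w) * Real.exp (-(ψ (x, y) - ψ (r, y)))) / κ ^ 2) *
        maxX (maxY (potX ψ u)) (x, y) +
      ENNReal.ofReal (16 * B * Real.exp κ *
        ((|x - r| + w) * Real.exp (-(ψ (x, y) - ψ (r, y))))) *
        maxX (maxY (transY ψ u)) (x, y) +
      ENNReal.ofReal (2 * B) *
        ((∫⁻ t in uIcc x r, ENNReal.ofReal (Real.exp (ψ (t, y) - ψ (x, y))) * transX ψ u (t, y)) +
          ENNReal.ofReal (4 * Real.exp κ *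
            ((|x - r| + w) * Real.exp (-(ψ (x, y) - ψ (r, y))))) *
          maxX (transX ψ u) (x, y)) := by
  set P := ψ (x, y) - ψ (r, y) with hP
  set Q := Icc (-1 : ℝ) 1 ×ˢ Icc (0 : ℝ) 1 with hQ
  have hQm : MeasurableSet Q := measurableSet_Icc.prod measurableSet_Icc
  have hB0 : 0 ≤ B := (abs_nonneg _).trans (hB 0 (by norm_num) 0 (by norm_num))
  have hxr : 0 ≤ |x - r| + w := by positivity
  have hexp : Real.exp (κ - P) = Real.exp κ * Real.exp (-P) := by rw [← Real.exp_add]; ring_nf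
  set T : ℝ≥0∞ := (∫⁻ t in uIcc x r,
      ENNReal.ofReal (Real.exp (ψ (t, y) - ψ (x, y))) * transX ψ u (t, y)) +
    ENNReal.ofReal (Real.exp (κ - P) * (4 * (|x - r| + w))) * maxX (transX ψ u) (x, y) with hT
  have hωint : IntegrableOn (landingWeight b) Q :=
    (continuous_landingWeight b).continuousOn.integrableOn_compact
      (isCompact_Icc.prod isCompact_Icc)
  have hmD : Measurable fun z : ℝ × ℝ => potX ψ u (r + w * z.1, y + σ * w * z.2) :=
    (measurable_potX hψ hu).comp (by fun_prop)
  have hmG : Measurable fun z : ℝ × ℝ => maxY (transY ψ u) (r + w * z.1, y) :=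
    (measurable_maxY (measurable_transY hψ hu)).comp (by fun_prop)
  have hpoint : ∀ z ∈ Q, ENNReal.ofReal (landingWeight b z) * ‖u (x, y)‖ₑ ≤
      ENNReal.ofReal (w * Real.exp (-P) / κ ^ 2) *
        potX ψ u (r + w * z.1, y + σ * w * z.2) +
      ENNReal.ofReal (B * (Real.exp (κ - P) * (4 * w))) * maxY (transY ψ u) (r + w * z.1, y) +
      ENNReal.ofReal B * T := by
    rintro ⟨X, τ⟩ ⟨hX, hτ⟩
    simp only at hX hτ ⊢
    have hω : landingWeight b (X, τ) ≤ B :=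
      (mul_le_mul (hB X hX τ hτ) (min_le_left _ _) (le_min zero_le_one (le_max_left _ _))
        hB0).trans (mul_one B).le
    have hpath := enorm_le_of_path hψ hu (x := x) hw hσ hX hτ hbox hdesc
    refine (mul_le_mul_right hpath _).trans ?_
    rw [mul_add, mul_add]
    refine add_le_add (add_le_add ?_ ?_) ?_
    · have h1 : ψ (r + w * X, y + σ * w * τ) - ψ (x, y) = κ * bipoly b X τ - P := by
        rw [hb, ← mul_assoc, mul_inv_cancel₀ hκ.ne', one_mul, hP]; ring
      -- The gain of two powers of `κ`: one from the truncated negative part against `exp (κ * b)`,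
      -- one from the normalization of the derivative, which also produces the factor `|dx ψ|` at
      -- the landing point.
      have h2 : landingWeight b (X, τ) * Real.exp (κ * bipoly b X τ - P) ≤
          w * Real.exp (-P) / κ ^ 2 * |dx ψ (r + w * X, y + σ * w * τ)| := by
        have h3 := min_mul_exp_le hκ (bipoly b X τ)
        unfold landingWeight
        simp only
        rw [bipolyDeriv_eq_of_normalized hψ hb, abs_mul, abs_mul, abs_of_pos hw,
          abs_of_pos (inv_pos.2 hκ), sub_eq_add_neg, Real.exp_add]
        calc κ⁻¹ * (w * |dx ψ (r + w * X, y + σ * w * τ)|) *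
              min 1 (max 0 (-bipoly b X τ)) * (Real.exp (κ * bipoly b X τ) * Real.exp (-P))
            = κ⁻¹ * (w * |dx ψ (r + w * X, y + σ * w * τ)|) *
              (min 1 (max 0 (-bipoly b X τ)) * Real.exp (κ * bipoly b X τ)) * Real.exp (-P) := by
              ring
          _ ≤ κ⁻¹ * (w * |dx ψ (r + w * X, y + σ * w * τ)|) * κ⁻¹ * Real.exp (-P) := by gcongr
          _ = _ := by field_simp
      rw [← mul_assoc, ← ENNReal.ofReal_mul (landingWeight_nonneg _ _), h1, potX, enorm_smul,
        ← mul_assoc, Real.enorm_eq_ofReal_abs, ← ENNReal.ofReal_mul (by positivity)]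
      gcongr
    · rw [← mul_assoc, ← ENNReal.ofReal_mul (landingWeight_nonneg _ _)]
      gcongr
    · gcongr
  have hlow : ENNReal.ofReal c * ‖u (x, y)‖ₑ ≤
      ∫⁻ z in Q, ENNReal.ofReal (landingWeight b z) * ‖u (x, y)‖ₑ := by
    rw [lintegral_mul_const' _ _ enorm_ne_top,
      ← ofReal_integral_eq_lintegral_ofReal hωint (ae_of_all _ (landingWeight_nonneg b))]
    gcongr
  refine (hlow.trans (setLIntegral_mono' hQm hpoint)).trans ?_
  have hvol : volume Q = ENNReal.ofReal 2 := by
    rw [hQ, Measure.volume_eq_prod, Measure.prod_prod, Real.volume_Icc, Real.volume_Icc,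
      ← ENNReal.ofReal_mul (by norm_num)]
    norm_num
  rw [lintegral_add_right _ measurable_const, lintegral_add_right _ (hmG.const_mul _), lintegral_const_mul _ hmD, lintegral_const_mul _ hmG,
    setLIntegral_const, hvol]
  refine add_le_add (add_le_add ?_ ?_) (le_of_eq ?_)
  · refine (mul_le_mul_right (setLIntegral_affine_le_maxX_maxY (measurable_potX hψ hu) x r y hw hσ)
      _).trans (le_of_eq ?_)
    rw [← mul_assoc, ← ENNReal.ofReal_mul (by positivity)]
    congr 2
    field_simp
  · refine (mul_le_mul_right (setLIntegral_affine_fst_le_maxX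
      (measurable_maxY (measurable_transY hψ hu)) x r y hw) _).trans (le_of_eq ?_)
    rw [← mul_assoc, ← ENNReal.ofReal_mul (by positivity), hexp]
    congr 2
    field_simp
    norm_num
  · have h1 : Real.exp (κ - P) * (4 * (|x - r| + w)) =
        4 * Real.exp κ * ((|x - r| + w) * Real.exp (-P)) := by rw [hexp]; ring
    rw [hT, h1, mul_right_comm, ← ENNReal.ofReal_mul hB0, mul_comm B 2]

end

/-! ### Geometry around a valley point -/

/-- The geometric information on the valleys of `ψ` in the square of half side `c`. -/
structure ValleyControl (ψ : ℝ × ℝ → ℝ) (L c : ℝ) : Prop where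
  crossing : ∀ y ∈ Icc (-c) c, ∀ s ∈ Icc (-c) c, ∀ t ∈ Icc (-c) c, s < t →
    dx ψ (s, y) < 0 → 0 < dx ψ (t, y) →
    ∃ r, IsCrossing (fun x => dx ψ (x, y)) c r ∧ NoSignChange (fun s => dy ψ (r, s)) (Icc (-c) c)
  noStay : ∀ x₀ δ s₁ s₂ : ℝ, 0 < δ → Icc (x₀ - δ) (x₀ + δ) ⊆ Icc (-c) c →
    Icc s₁ s₂ ⊆ Icc (-c) c → s₁ < s₂ → L * δ < s₂ - s₁ →
    ∃ s ∈ Icc s₁ s₂, ψ (x₀ + δ, s) ≤ ψ (x₀, s) ∨ ψ (x₀ - δ, s) ≤ ψ (x₀, s)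

section

variable {m : ℕ} {a : Fin (m + 1) → Fin (m + 1) → ℝ} {ψ : ℝ × ℝ → ℝ} {u : ℝ × ℝ → ℂ}

lemma contDiff_of_bipoly (ha : ∀ z, ψ z = bipoly a z.1 z.2) {n : WithTop ℕ∞} : ContDiff ℝ n ψ := by
  have h : ψ = fun z => bipoly a z.1 z.2 := funext ha
  rw [h]
  unfold bipoly
  fun_prop

lemma exists_slice (ha : ∀ z, ψ z = bipoly a z.1 z.2) (y : ℝ) :
    ∃ p : Polynomial ℝ, p.natDegree ≤ m ∧ (∀ t, ψ (t, y) = p.eval t) ∧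
      ∀ t, dx ψ (t, y) = p.derivative.eval t := by
  have hp : ∀ t, ψ (t, y) = ((bipolyPoly a).map (Polynomial.evalRingHom y)).eval t := by
    intro t
    rw [ha, eval_bipolyPoly]
  refine ⟨_, natDegree_bipolyPoly_map_le a y, hp, fun t => ?_⟩
  have h1 := hasDerivAt_fst_of_bipoly ha t y
  rw [funext hp] at h1
  exact h1.unique (Polynomial.hasDerivAt _ t)

/-- Either the oscillation is small on the whole square, or it reaches the level `κ` for the first
time on the boundary of some smaller square. -/
lemma exists_window (hψ : Continuous ψ) (r y : ℝ) {ℓ κ : ℝ} (hκ : 0 < κ) :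
    (∀ t ∈ Icc (r - ℓ) (r + ℓ), ∀ s ∈ Icc (y - ℓ) (y + ℓ), |ψ (t, s) - ψ (r, s)| ≤ κ) ∨
    ∃ w, 0 < w ∧ w ≤ ℓ ∧
      (∀ t ∈ Icc (r - w) (r + w), ∀ s ∈ Icc (y - w) (y + w), |ψ (t, s) - ψ (r, s)| ≤ κ) ∧
      ∃ t ∈ Icc (r - w) (r + w), ∃ s ∈ Icc (y - w) (y + w), |ψ (t, s) - ψ (r, s)| = κ := by
  by_cases hall : ∀ t ∈ Icc (r - ℓ) (r + ℓ), ∀ s ∈ Icc (y - ℓ) (y + ℓ), |ψ (t, s) - ψ (r, s)| ≤ κ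
  · exact Or.inl hall
  right
  push Not at hall
  obtain ⟨t₀, ht₀, s₀, hs₀, hlt⟩ := hall
  let f : ℝ × ℝ → ℝ := fun z => |ψ z - ψ (r, z.2)|
  have hf : Continuous f := by
    have : Continuous fun z : ℝ × ℝ => ψ (r, z.2) := hψ.comp (by fun_prop)
    exact (hψ.sub this).abs
  let S : Set (ℝ × ℝ) := (Icc (r - ℓ) (r + ℓ) ×ˢ Icc (y - ℓ) (y + ℓ)) ∩ {z | κ ≤ f z}
  have hS : IsCompact S :=
    (isCompact_Icc.prod isCompact_Icc).inter_right (isClosed_le continuous_const hf)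
  have hSne : S.Nonempty := ⟨(t₀, s₀), ⟨ht₀, hs₀⟩, hlt.le⟩
  let N : ℝ × ℝ → ℝ := fun z => max |z.1 - r| |z.2 - y|
  have hN : Continuous N := by fun_prop
  -- A point nearest to the centre in the sup distance `N` among those with oscillation at least
  -- `κ`; its distance is the half side of the window.
  obtain ⟨z₁, ⟨⟨hz₁a, hz₁b⟩, hz₁c⟩, hmin⟩ := hS.exists_isMinOn hSne hN.continuousOn
  have hmemN : ∀ {w : ℝ} {z : ℝ × ℝ}, N z ≤ w →
      z.1 ∈ Icc (r - w) (r + w) ∧ z.2 ∈ Icc (y - w) (y + w) := by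
    intro w z h
    have h1 := abs_le.1 ((le_max_left _ _).trans h)
    have h2 := abs_le.1 ((le_max_right _ _).trans h)
    exact ⟨⟨by linarith [h1.1], by linarith [h1.2]⟩, ⟨by linarith [h2.1], by linarith [h2.2]⟩⟩
  have hNmem : ∀ {w : ℝ} {z : ℝ × ℝ}, z.1 ∈ Icc (r - w) (r + w) → z.2 ∈ Icc (y - w) (y + w) →
      N z ≤ w := by
    intro w z h1 h2
    exact max_le (abs_le.2 ⟨by linarith [h1.1], by linarith [h1.2]⟩)
      (abs_le.2 ⟨by linarith [h2.1], by linarith [h2.2]⟩)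
  have hz₁pos : 0 < N z₁ := by
    have h1 : z₁.1 ≠ r := by
      intro h
      have h2 : f z₁ = 0 := by
        have h3 : z₁ = (r, z₁.2) := Prod.ext h rfl
        simp only [f]
        rw [h3]
        simp
      have h3 : κ ≤ f z₁ := hz₁c
      linarith
    exact lt_of_lt_of_le (abs_pos.2 (sub_ne_zero.2 h1)) (le_max_left _ _)
  have hNℓ : N z₁ ≤ ℓ := hNmem hz₁a hz₁b
  have hbelow : ∀ z, N z < N z₁ → f z ≤ κ := by
    intro z hz
    by_contra! hcon
    obtain ⟨h1, h2⟩ := hmemN (hz.le.trans hNℓ)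
    exact absurd (hmin ⟨⟨h1, h2⟩, hcon.le⟩) (not_le.2 hz)
  -- Points on the boundary of the window are limits, along rays from the centre, of points inside
  -- it.
  have hle : ∀ z, N z ≤ N z₁ → f z ≤ κ := by
    intro z hz
    let g : ℝ → ℝ × ℝ := fun θ => (r + θ * (z.1 - r), y + θ * (z.2 - y))
    have hg : Continuous g := by fun_prop
    have hNg : ∀ θ ∈ Ico (0 : ℝ) 1, N (g θ) < N z₁ := by
      intro θ hθ
      have h1 : N (g θ) = θ * N z := by
        simp only [N, g, add_sub_cancel_left, abs_mul, abs_of_nonneg hθ.1]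
        rw [mul_max_of_nonneg _ _ hθ.1]
      rw [h1]
      have h2 : 0 ≤ N z := (abs_nonneg _).trans (le_max_left _ _)
      nlinarith [hθ.1, hθ.2]
    have hlim : Filter.Tendsto (fun θ => f (g θ)) (𝓝[<] (1 : ℝ)) (𝓝 (f (g 1))) :=
      ((hf.comp hg).tendsto 1).mono_left nhdsWithin_le_nhds
    have hg1 : g 1 = z := by simp [g]
    rw [hg1] at hlim
    refine le_of_tendsto hlim ?_
    filter_upwards [Ico_mem_nhdsLT (show (0 : ℝ) < 1 by norm_num)] with θ hθ
    exact hbelow _ (hNg θ hθ)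
  obtain ⟨h1, h2⟩ := hmemN (le_refl (N z₁))
  exact ⟨N z₁, hz₁pos, hNℓ, fun t ht s hs => hle (t, s) (hNmem ht hs), z₁.1, h1, z₁.2, h2,
    le_antisymm (hle z₁ le_rfl) hz₁c⟩

/-- In one of the two directions the valley goes down. -/
lemma exists_descending (ha : ∀ z, ψ z = bipoly a z.1 z.2) {c r y ℓ : ℝ}
    (h : NoSignChange (fun s => dy ψ (r, s)) (Icc (-c) c)) (hy : Icc (y - ℓ) (y + ℓ) ⊆ Icc (-c) c) :
    ∃ σ : ℝ, (σ = 1 ∨ σ = -1) ∧ AntitoneOn (fun τ => ψ (r, y + σ * τ)) (Icc 0 ℓ) := by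
  have hder : ∀ σ τ : ℝ, HasDerivAt (fun τ => ψ (r, y + σ * τ)) (dy ψ (r, y + σ * τ) * σ) τ := by
    intro σ τ
    have h1 : HasDerivAt (fun τ => y + σ * τ) σ τ := by
      simpa using ((hasDerivAt_id τ).const_mul σ).const_add y
    exact (hasDerivAt_snd_of_bipoly ha r (y + σ * τ)).comp_of_eq τ h1 rfl
  have hanti : ∀ σ : ℝ, (∀ τ ∈ Icc (0 : ℝ) ℓ, dy ψ (r, y + σ * τ) * σ ≤ 0) →
      AntitoneOn (fun τ => ψ (r, y + σ * τ)) (Icc 0 ℓ) := by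
    intro σ hσ
    refine antitoneOn_of_deriv_nonpos (convex_Icc 0 ℓ)
      (fun τ _ => (hder σ τ).continuousAt.continuousWithinAt)
      (fun τ _ => (hder σ τ).differentiableAt.differentiableWithinAt) fun τ hτ => ?_
    rw [(hder σ τ).deriv]
    exact hσ τ (interior_subset hτ)
  by_cases hdown : ∀ τ ∈ Icc (0 : ℝ) ℓ, dy ψ (r, y + 1 * τ) * 1 ≤ 0
  · exact ⟨1, Or.inl rfl, hanti 1 hdown⟩
  -- A positive derivative somewhere above forbids, by the sign condition, a negative one below; so
  -- the weight descends downwards.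
  · push Not at hdown
    obtain ⟨τ₀, hτ₀, hpos⟩ := hdown
    rw [one_mul, mul_one] at hpos
    refine ⟨-1, Or.inr rfl, hanti (-1) fun τ hτ => ?_⟩
    have h1 : 0 ≤ dy ψ (r, y + -1 * τ) := by
      by_contra! hneg
      have hlt : y + -1 * τ < y + τ₀ := by
        rcases eq_or_lt_of_le (show y + -1 * τ ≤ y + τ₀ by linarith [hτ.1, hτ₀.1]) with h2 | h2
        · rw [h2] at hneg; exact absurd hneg (not_lt.2 hpos.le)
        · exact h2
      refine absurd (h _ _ hlt ((Icc_subset_Icc ?_ ?_).trans hy) hneg) (not_le.2 hpos)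
      · linarith [hτ.2]
      · linarith [hτ₀.2]
    linarith

/-- At a point off the critical set, either the derivative of the weight keeps its sign up to an
end of the interval, or there is a valley point, and the sign is kept up to it. -/
lemma exists_end_or_valley {L c ι : ℝ} (hV : ValleyControl ψ L c) (hιc : ι ≤ c) {x y : ℝ}
    (hx : x ∈ Ioo (-ι) ι) (hy : y ∈ Ioo (-ι) ι) (hne : dx ψ (x, y) ≠ 0) :
    (∃ e, (e = -ι ∨ e = ι) ∧ ((∀ s ∈ Icc e x, 0 ≤ dx ψ (s, y)) ∧ e ≤ x ∨
      (∀ s ∈ Icc x e, dx ψ (s, y) ≤ 0) ∧ x ≤ e)) ∨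
    ∃ r ∈ Ioo (-ι) ι, NoSignChange (fun s => dy ψ (r, s)) (Icc (-c) c) ∧
      ((∀ s ∈ Icc r x, 0 ≤ dx ψ (s, y)) ∧ r ≤ x ∨ (∀ s ∈ Icc x r, dx ψ (s, y) ≤ 0) ∧ x ≤ r) := by
  have hmem : ∀ {s : ℝ}, s ∈ Icc (-ι) ι → s ∈ Icc (-c) c :=
    fun hs => ⟨by linarith [hs.1], by linarith [hs.2]⟩
  have hxι : x ∈ Icc (-ι) ι := Ioo_subset_Icc_self hx
  rcases lt_or_gt_of_ne hne with hneg | hpos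
  · by_cases hend : ∀ s ∈ Icc x ι, dx ψ (s, y) ≤ 0
    · exact Or.inl ⟨ι, Or.inr rfl, Or.inr ⟨hend, hx.2.le⟩⟩
    right
    push Not at hend
    obtain ⟨t, ht, hpos⟩ := hend
    have hxt : x < t := by
      rcases eq_or_lt_of_le ht.1 with h | h
      · rw [← h] at hpos; exact absurd hneg (not_lt.2 hpos.le)
      · exact h
    have htι : t ∈ Icc (-ι) ι := ⟨hxι.1.trans ht.1, ht.2⟩
    obtain ⟨r, hr, hns⟩ := hV.crossing y (hmem (Ioo_subset_Icc_self hy)) x (hmem hxι) t (hmem htι)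
      hxt hneg hpos
    obtain ⟨h1, h2⟩ := hr x (hmem hxι) t (hmem htι) hxt hneg hpos
    refine ⟨r, ⟨hx.1.trans h1, h2.trans_le ht.2⟩, hns, Or.inr ⟨fun s hs => ?_, h1.le⟩⟩
    by_contra! hcon
    have hxs : x < s := by
      rcases eq_or_lt_of_le hs.1 with h | h
      · rw [← h] at hcon; exact absurd hneg (not_lt.2 hcon.le)
      · exact h
    have hsι : s ∈ Icc (-ι) ι := ⟨by linarith [hxι.1], by linarith [hs.2, htι.2]⟩
    exact absurd hs.2 (not_le.2 (hr x (hmem hxι) s (hmem hsι) hxs hneg hcon).2)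
  · by_cases hend : ∀ s ∈ Icc (-ι) x, 0 ≤ dx ψ (s, y)
    · exact Or.inl ⟨-ι, Or.inl rfl, Or.inl ⟨hend, hx.1.le⟩⟩
    right
    push Not at hend
    obtain ⟨t, ht, hneg⟩ := hend
    have hxt : t < x := by
      rcases eq_or_lt_of_le ht.2 with h | h
      · rw [h] at hneg; exact absurd hneg (not_lt.2 hpos.le)
      · exact h
    have htι : t ∈ Icc (-ι) ι := ⟨ht.1, ht.2.trans hxι.2⟩
    obtain ⟨r, hr, hns⟩ := hV.crossing y (hmem (Ioo_subset_Icc_self hy)) t (hmem htι) x (hmem hxι)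
      hxt hneg hpos
    obtain ⟨h1, h2⟩ := hr t (hmem htι) x (hmem hxι) hxt hneg hpos
    refine ⟨r, ⟨ht.1.trans_lt h1, h2.trans hx.2⟩, hns, Or.inl ⟨fun s hs => ?_, h2.le⟩⟩
    by_contra! hcon
    have hxs : s < x := by
      rcases eq_or_lt_of_le hs.2 with h | h
      · rw [h] at hcon; exact absurd hcon (not_lt.2 hpos.le)
      · exact h
    have hsι : s ∈ Icc (-ι) ι := ⟨by linarith [hs.1, htι.1], by linarith [hs.2, hxι.2]⟩
    exact absurd hs.1 (not_le.2 (hr s (hmem hsι) x (hmem hxι) hxs hcon hpos).1)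

end

/-! ### Bounds for the normalized weight near a valley point -/

section

/-- The weight at height `P` above the valley compensates the distance to the valley. -/
lemma exists_mul_exp_neg_le (m : ℕ) {K : ℝ} (hK : 0 < K) : ∃ C : ℝ, 0 < C ∧
    ∀ p : Polynomial ℝ, p.natDegree ≤ m → ∀ x r w κ : ℝ, 0 < w → 1 ≤ κ →
    (∀ t ∈ Icc (r - w) (r + w), |p.eval t - p.eval r| ≤ κ) →
    |p.derivative.eval x| * |x - r| ≤ K * (p.eval x - p.eval r) →
    |p.derivative.eval x| * ((|x - r| + w) * Real.exp (-(p.eval x - p.eval r))) ≤ C * κ := by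
  obtain ⟨M, hM, h⟩ := exists_derivative_le m
  refine ⟨2 * K + M, by positivity, fun p hp x r w κ hw hκ hosc hval => ?_⟩
  set P := p.eval x - p.eval r with hP
  set A := |p.derivative.eval x| with hA
  have hA0 : 0 ≤ A := abs_nonneg _
  have hP0 : 0 ≤ P := by
    have : 0 ≤ K * P := (mul_nonneg hA0 (abs_nonneg _)).trans hval
    exact nonneg_of_mul_nonneg_right this hK
  have hexp1 : Real.exp (-P) ≤ 1 := Real.exp_le_one_iff.2 (by linarith)
  -- Away from the window the height `P` dominates the derivative times the distance, and `P * exp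
  -- (-P) ≤ 1`. Inside it the Markov inequality bounds the derivative by a multiple of `κ / w`.
  rcases le_or_gt w |x - r| with hcase | hcase
  · have h1 : P * Real.exp (-P) ≤ 1 := by
      have := Real.add_one_le_exp P
      rw [Real.exp_neg, ← div_eq_mul_inv, div_le_one (Real.exp_pos _)]
      linarith
    calc A * ((|x - r| + w) * Real.exp (-P)) ≤ A * ((|x - r| + |x - r|) * Real.exp (-P)) := by
          gcongr
      _ = 2 * (A * |x - r|) * Real.exp (-P) := by ring
      _ ≤ 2 * (K * P) * Real.exp (-P) := by gcongr
      _ = 2 * K * (P * Real.exp (-P)) := by ring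
      _ ≤ 2 * K * 1 := by gcongr
      _ ≤ (2 * K + M) * κ := by nlinarith
  · have hx : x ∈ Icc (r - w) (r + w) := by
      rw [abs_lt] at hcase
      constructor <;> linarith [hcase.1, hcase.2]
    have h1 := h (p - Polynomial.C (p.eval r)) (Polynomial.natDegree_sub_C.trans_le hp) (r - w)
      (r + w) κ (by linarith) (by simpa using hosc) x hx
    rw [Polynomial.derivative_sub, Polynomial.derivative_C, sub_zero] at h1
    calc A * ((|x - r| + w) * Real.exp (-P)) ≤ A * ((w + w) * 1) := by gcongr
      _ = (r + w - (r - w)) * A := by ring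
      _ ≤ M * κ := h1
      _ ≤ (2 * K + M) * κ := by nlinarith

variable {m : ℕ} {a : Fin (m + 1) → Fin (m + 1) → ℝ} {ψ : ℝ × ℝ → ℝ} {u : ℝ × ℝ → ℂ}

/-- The normalized weight near a valley point satisfies the assumptions of the compactness
argument. -/
lemma exists_landing_bounds (m : ℕ) {L : ℝ} (hL : 0 ≤ L) : ∃ c : ℝ, 0 < c ∧ ∃ B : ℝ, 0 < B ∧
    ∀ (a : Fin (m + 1) → Fin (m + 1) → ℝ) (ψ : ℝ × ℝ → ℝ), (∀ z, ψ z = bipoly a z.1 z.2) →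
    ∀ d : ℝ, ValleyControl ψ L d → ∀ r y w κ σ : ℝ, 0 < w → 0 < κ → (σ = 1 ∨ σ = -1) →
    Icc (r - w) (r + w) ⊆ Icc (-d) d → Icc (y - w) (y + w) ⊆ Icc (-d) d →
    (∀ t ∈ Icc (r - w) (r + w), ∀ s ∈ Icc (y - w) (y + w), |ψ (t, s) - ψ (r, s)| ≤ κ) →
    (∃ t ∈ Icc (r - w) (r + w), ∃ s ∈ Icc (y - w) (y + w), |ψ (t, s) - ψ (r, s)| = κ) →
    AntitoneOn (fun τ => ψ (r, y + σ * τ)) (Icc 0 w) →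
    ∃ b : Fin (m + 1) → Fin (m + 1) → ℝ,
      (∀ X τ, bipoly b X τ = κ⁻¹ * (ψ (r + w * X, y + σ * w * τ) - ψ (r, y))) ∧
      c ≤ (∫ z in Icc (-1 : ℝ) 1 ×ˢ Icc (0 : ℝ) 1, landingWeight b z) ∧
      ∀ X ∈ Icc (-1 : ℝ) 1, ∀ τ ∈ Icc (0 : ℝ) 1, |bipoly (bipolyDeriv b) X τ| ≤ B := by
  obtain ⟨c, hc, hland⟩ := exists_le_integral_landingWeight m hL
  obtain ⟨M, hM, hmark⟩ := exists_derivative_le m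
  refine ⟨c, hc, M, hM, fun a ψ ha d hV r y w κ σ hw hκ hσ hrd hyd hosc hatt hanti => ?_⟩
  obtain ⟨b₁, hb₁⟩ := exists_bipoly_affine a r w y (σ * w)
  obtain ⟨b₂, hb₂⟩ := exists_bipoly_monomial (m := m) (Nat.zero_le m) (Nat.zero_le m) (-ψ (r, y))
  have hb : ∀ X τ, bipoly (κ⁻¹ • (b₁ + b₂)) X τ =
      κ⁻¹ * (ψ (r + w * X, y + σ * w * τ) - ψ (r, y)) := by
    intro X τ
    rw [bipoly_smul, bipoly_add, hb₁, hb₂, ha (r + w * X, y + σ * w * τ)]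
    simp [sub_eq_add_neg]
  generalize κ⁻¹ • (b₁ + b₂) = b at hb
  have hX : ∀ {X : ℝ}, X ∈ Icc (-1 : ℝ) 1 → r + w * X ∈ Icc (r - w) (r + w) := fun h =>
    ⟨by nlinarith [h.1], by nlinarith [h.2]⟩
  have hs : ∀ {τ : ℝ}, τ ∈ Icc (-1 : ℝ) 1 → y + σ * w * τ ∈ Icc (y - w) (y + w) := by
    intro τ h
    rcases hσ with rfl | rfl
    · exact ⟨by nlinarith [h.1], by nlinarith [h.2]⟩
    · exact ⟨by nlinarith [h.2], by nlinarith [h.1]⟩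
  have hdiff : ∀ X τ, bipoly b X τ - bipoly b 0 τ =
      κ⁻¹ * (ψ (r + w * X, y + σ * w * τ) - ψ (r, y + σ * w * τ)) := by
    intro X τ
    rw [hb, hb, mul_zero, add_zero]; ring
  have hle : ∀ x ∈ Icc (-1 : ℝ) 1, ∀ s ∈ Icc (-1 : ℝ) 1, |bipoly b x s - bipoly b 0 s| ≤ 1 := by
    intro x hx s hs'
    rw [hdiff, abs_mul, abs_of_pos (inv_pos.2 hκ), inv_mul_le_iff₀ hκ, mul_one]
    exact hosc _ (hX hx) _ (hs hs')
  refine ⟨b, hb, hland b ?_ hle ?_ ?_ ?_, fun X hX' τ hτ => ?_⟩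
  · rw [hb]; simp
  · obtain ⟨t, ht, s, hs', heq⟩ := hatt
    have hσ2 : σ * σ = 1 := by rcases hσ with rfl | rfl <;> norm_num
    refine ⟨(t - r) / w, ?_, σ * (s - y) / w, ?_, ?_⟩
    · rw [mem_Icc, le_div_iff₀ hw, div_le_iff₀ hw]
      constructor <;> linarith [ht.1, ht.2]
    · rw [mem_Icc, le_div_iff₀ hw, div_le_iff₀ hw]
      rcases hσ with rfl | rfl <;> constructor <;> linarith [hs'.1, hs'.2]
    · have h1 : r + w * ((t - r) / w) = t := by field_simp; ring
      have h2 : y + σ * w * (σ * (s - y) / w) = s := by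
        rw [show σ * w * (σ * (s - y) / w) = σ * σ * (s - y) * (w / w) by ring, hσ2,
          div_self hw.ne']
        ring
      rw [hdiff, h1, h2, abs_mul, heq, abs_of_pos (inv_pos.2 hκ), inv_mul_cancel₀ hκ.ne']
  · intro s hs' t ht hst
    rw [hb, hb, mul_zero, add_zero]
    have hm : ∀ {s : ℝ}, s ∈ Icc (0 : ℝ) 1 → w * s ∈ Icc (0 : ℝ) w := fun h =>
      ⟨by nlinarith [h.1], by nlinarith [h.2]⟩
    have := hanti (hm hs') (hm ht) (mul_le_mul_of_nonneg_left hst hw.le)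
    simp only [← mul_assoc] at this
    gcongr
  -- The window is rescaled by the same factor `w` in both variables, so `L` is unchanged. For `σ =
  -- -1` the time interval is reversed.
  · intro δ s₁ s₂ hδ hδ1 hs1 hs2 hlt hLδ
    have hsub : Icc (r - w * δ) (r + w * δ) ⊆ Icc (-d) d :=
      (Icc_subset_Icc (by nlinarith) (by nlinarith)).trans hrd
    have hlong : L * (w * δ) < w * s₂ - w * s₁ := by nlinarith
    have hcmp : ∀ s : ℝ, ψ (r + w * δ, y + σ * w * s) ≤ ψ (r, y + σ * w * s) ∨
        ψ (r - w * δ, y + σ * w * s) ≤ ψ (r, y + σ * w * s) →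
        bipoly b δ s ≤ bipoly b 0 s ∨ bipoly b (-δ) s ≤ bipoly b 0 s := by
      rintro s (h | h)
      · left
        rw [← sub_nonpos, hdiff]
        exact mul_nonpos_of_nonneg_of_nonpos (inv_pos.2 hκ).le (by linarith)
      · right
        rw [← sub_nonpos, hdiff, mul_neg, ← sub_eq_add_neg]
        exact mul_nonpos_of_nonneg_of_nonpos (inv_pos.2 hκ).le (by linarith)
    rcases hσ with rfl | rfl
    · obtain ⟨s, hs', hor⟩ := hV.noStay r (w * δ) (y + w * s₁) (y + w * s₂) (by positivity) hsub
        ((Icc_subset_Icc (by nlinarith) (by nlinarith)).trans hyd) (by nlinarith) (by linarith)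
      refine ⟨(s - y) / w, ?_, hcmp _ ?_⟩
      · rw [mem_Icc, le_div_iff₀ hw, div_le_iff₀ hw]
        constructor <;> linarith [hs'.1, hs'.2]
      · have h2 : y + 1 * w * ((s - y) / w) = s := by field_simp; ring
        rwa [h2]
    · obtain ⟨s, hs', hor⟩ := hV.noStay r (w * δ) (y - w * s₂) (y - w * s₁) (by positivity) hsub
        ((Icc_subset_Icc (by nlinarith) (by nlinarith)).trans hyd) (by nlinarith) (by linarith)
      refine ⟨(y - s) / w, ?_, hcmp _ ?_⟩
      · rw [mem_Icc, le_div_iff₀ hw, div_le_iff₀ hw]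
        constructor <;> linarith [hs'.1, hs'.2]
      · have h2 : y + -1 * w * ((y - s) / w) = s := by field_simp; ring
        rwa [h2]
  · obtain ⟨p, hp, hpe, hpd⟩ := exists_slice (ψ := fun z => bipoly b z.1 z.2) (a := b)
      (fun z => rfl) τ
    have hτ' : τ ∈ Icc (-1 : ℝ) 1 := ⟨by linarith [hτ.1], hτ.2⟩
    have h1 := hmark (p - Polynomial.C (p.eval 0)) (Polynomial.natDegree_sub_C.trans_le hp) (-1) 1
      1 (by norm_num) (by
        intro x hx
        rw [Polynomial.eval_sub, Polynomial.eval_C, ← hpe, ← hpe]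
        exact hle x hx τ hτ') X hX'
    rw [Polynomial.derivative_sub, Polynomial.derivative_C, sub_zero, ← hpd,
      dx_eq_bipoly (a := b) (fun z => rfl)] at h1
    simp only at h1
    nlinarith [abs_nonneg (bipoly (bipolyDeriv b) X τ)]

end

/-! ### The pointwise estimate by maximal functions -/

section

lemma eq_zero_of_mem_testFunctions {W : Set (ℝ × ℝ)} {u : ℝ × ℝ → ℂ} (hu : u ∈ testFunctions W)
    {z : ℝ × ℝ} (hz : z ∉ W) : u z = 0 :=
  image_eq_zero_of_notMem_tsupport fun h => hz (hu.2.2 h)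

lemma contDiff_one_of_mem_testFunctions {W : Set (ℝ × ℝ)} {u : ℝ × ℝ → ℂ}
    (hu : u ∈ testFunctions W) : ContDiff ℝ 1 u := hu.1.of_le (by exact_mod_cast le_top)

lemma ofReal_mul_le_ofReal_mul {s t : ℝ} (h : s ≤ t) (X : ℝ≥0∞) :
    ENNReal.ofReal s * X ≤ ENNReal.ofReal t * X := by gcongr

lemma ofReal_mul_ofReal_mul {s t : ℝ} (hs : 0 ≤ s) (X : ℝ≥0∞) :
    ENNReal.ofReal s * (ENNReal.ofReal t * X) = ENNReal.ofReal (s * t) * X := by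
  rw [← mul_assoc, ← ENNReal.ofReal_mul hs]

/-- The pointwise estimate of `(∂ₓψ) u` by maximal functions. -/
theorem exists_potX_le (m : ℕ) {L : ℝ} (hL : 0 ≤ L) : ∃ C₀ : ℝ, 0 < C₀ ∧ ∀ κ : ℝ, 1 ≤ κ →
    ∃ C : ℝ, 0 < C ∧ ∀ (a : Fin (m + 1) → Fin (m + 1) → ℝ) (ψ : ℝ × ℝ → ℝ),
    (∀ z, ψ z = bipoly a z.1 z.2) → ∀ ι : ℝ, 0 < ι → ValleyControl ψ L (3 * ι) →
    ∀ u ∈ testFunctions (Ioo (-ι) ι ×ˢ Ioo (-ι) ι), ∀ z,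
    potX ψ u z ≤ ENNReal.ofReal C * (maxX (transX ψ u) z + maxX (maxY (transY ψ u)) z) +
      ENNReal.ofReal (C₀ / κ) * maxX (maxY (potX ψ u)) z := by
  obtain ⟨K, hK, hprim⟩ := exists_mul_le_primitive_sub m
  obtain ⟨C₁, hC₁, hsign⟩ := exists_mul_enorm_le_hlMax_of_sign m
  obtain ⟨C₂, hC₂, hosc⟩ := exists_mul_enorm_le_hlMax_of_osc m
  obtain ⟨C₃, hC₃, hheight⟩ := exists_mul_exp_neg_le m hK
  obtain ⟨c, hc, B, hB, hland⟩ := exists_landing_bounds m hL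
  obtain ⟨C₅, hC₅, hdecay⟩ := exists_mul_lintegral_exp_le_hlMax K hK
  -- Neither `C₃` nor `c` involves `κ`: this is what makes the last term small for large `κ`, while
  -- the other constants may grow with it.
  refine ⟨16 * C₃ / c, by positivity, fun κ hκ => ?_⟩
  have hκ0 : 0 < κ := by linarith
  set D₁ := 16 * B * Real.exp κ * (C₃ * κ) / c with hD₁
  set D₂ := 2 * B * (C₅ + 4 * Real.exp κ * (C₃ * κ)) / c with hD₂
  have hD₁0 : 0 < D₁ := by positivity
  have hD₂0 : 0 < D₂ := by positivity
  refine ⟨C₁ + C₂ * κ * Real.exp (2 * κ) + D₁ + D₂, by positivity,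
    fun a ψ ha ι hι hV u hu => ?_⟩
  have hexp0 : 0 < C₂ * κ * Real.exp (2 * κ) := by positivity
  rintro ⟨x, y⟩
  have hu1 := contDiff_one_of_mem_testFunctions hu
  have hψ1 : ContDiff ℝ 1 ψ := contDiff_of_bipoly ha
  have hpot : potX ψ u (x, y) = ENNReal.ofReal |dx ψ (x, y)| * ‖u (x, y)‖ₑ := by
    rw [potX, enorm_smul, Real.enorm_eq_ofReal_abs]
  by_cases hmem : (x, y) ∈ Ioo (-ι) ι ×ˢ Ioo (-ι) ι
  swap
  · rw [hpot, eq_zero_of_mem_testFunctions hu hmem, enorm_zero, mul_zero]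
    exact zero_le
  obtain ⟨hx, hy⟩ : x ∈ Ioo (-ι) ι ∧ y ∈ Ioo (-ι) ι := hmem
  by_cases hne : dx ψ (x, y) = 0
  · rw [hpot, hne, abs_zero, ENNReal.ofReal_zero, zero_mul]
    exact zero_le
  obtain ⟨p, hp, hpe, hpd⟩ := exists_slice ha y
  have hline : Continuous fun t : ℝ => (t, y) := by fun_prop
  have hp' : p.derivative.natDegree ≤ m :=
    (Polynomial.natDegree_derivative_le p).trans ((Nat.sub_le _ _).trans hp)
  have hpder : ∀ t, HasDerivAt (fun t => p.eval t) (p.derivative.eval t) t :=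
    fun t => p.hasDerivAt t
  have huder : ∀ t, HasDerivAt (fun t => u (t, y)) (dx u (t, y)) t :=
    fun t => hasDerivAt_dx (hu1.differentiable one_ne_zero) t y
  have hucont : Continuous fun t => dx u (t, y) := (continuous_dx hu1).comp hline
  have htrans : (fun t => ‖dx u (t, y) + p.derivative.eval t • u (t, y)‖ₑ) =
      fun t => transX ψ u (t, y) := by
    funext t
    rw [transX, hpd]
  have hsmall : ∀ D : ℝ, D ≤ C₁ + C₂ * κ * Real.exp (2 * κ) + D₁ + D₂ →
      ENNReal.ofReal |dx ψ (x, y)| * ‖u (x, y)‖ₑ ≤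
        ENNReal.ofReal D * maxX (transX ψ u) (x, y) →
      potX ψ u (x, y) ≤ ENNReal.ofReal (C₁ + C₂ * κ * Real.exp (2 * κ) + D₁ + D₂) *
        (maxX (transX ψ u) (x, y) + maxX (maxY (transY ψ u)) (x, y)) +
        ENNReal.ofReal (16 * C₃ / c / κ) * maxX (maxY (potX ψ u)) (x, y) := by
    intro D hD h
    rw [hpot]
    refine h.trans ((ofReal_mul_le_ofReal_mul hD _).trans ?_)
    rw [mul_add]
    exact le_self_add.trans le_self_add
  rcases exists_end_or_valley hV (by linarith) hx hy hne with
    ⟨e, he, hes⟩ | ⟨r, hr, hns, hrs⟩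
  · refine hsmall C₁ (by linarith) ?_
    have hue : u (e, y) = 0 := by
      refine eq_zero_of_mem_testFunctions hu fun h => ?_
      have h1 : e ∈ Ioo (-ι) ι := h.1
      rcases he with rfl | rfl
      · exact lt_irrefl _ h1.1
      · exact lt_irrefl _ h1.2
    have h := hsign p.derivative hp' (fun t => p.eval t) hpder (fun t => u (t, y))
      (fun t => dx u (t, y)) huder hucont e x hue (by simpa only [hpd] using hes)
    rw [htrans, ← hpd] at h
    exact h
  -- Windows of half side up to `2 * ι` about `(r, y)` stay in the square of half side `3 * ι`, and
  -- the largest one contains the square that supports `u`.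
  have hrmem : Icc (r - 2 * ι) (r + 2 * ι) ⊆ Icc (-(3 * ι)) (3 * ι) :=
    Icc_subset_Icc (by linarith [hr.1]) (by linarith [hr.2])
  have hymem : Icc (y - 2 * ι) (y + 2 * ι) ⊆ Icc (-(3 * ι)) (3 * ι) :=
    Icc_subset_Icc (by linarith [hy.1]) (by linarith [hy.2])
  rcases exists_window hψ1.continuous r y (ℓ := 2 * ι) hκ0 with hbounded | ⟨w, hw, hwι, hle, hatt⟩
  · refine hsmall (C₂ * κ * Real.exp (2 * κ)) (by linarith) ?_
    have hue : u (-ι, y) = 0 :=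
      eq_zero_of_mem_testFunctions hu fun h => lt_irrefl (-ι) (show -ι ∈ Ioo (-ι) ι from h.1).1
    have h := hosc p hp (fun t => u (t, y)) (fun t => dx u (t, y)) huder hucont (-ι) ι x κ
      (p.eval r) (by linarith) (Ioo_subset_Icc_self hx) hue (fun t ht => by
        rw [← hpe, ← hpe]
        exact hbounded t ⟨by linarith [ht.1, hr.2], by linarith [ht.2, hr.1]⟩ y
          ⟨by linarith, by linarith⟩)
    rw [htrans, ← hpd] at h
    exact h
  have hrw : Icc (r - w) (r + w) ⊆ Icc (r - 2 * ι) (r + 2 * ι) :=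
    Icc_subset_Icc (by linarith) (by linarith)
  have hyw : Icc (y - w) (y + w) ⊆ Icc (y - 2 * ι) (y + 2 * ι) :=
    Icc_subset_Icc (by linarith) (by linarith)
  obtain ⟨σ, hσ, hanti⟩ := exists_descending ha hns hymem
  have hanti' : AntitoneOn (fun τ => ψ (r, y + σ * τ)) (Icc 0 w) :=
    hanti.mono (Icc_subset_Icc le_rfl hwι)
  have hσ1 : |σ| = 1 := by rcases hσ with rfl | rfl <;> simp
  obtain ⟨b, hb, hcb, hBb⟩ := hland a ψ ha (3 * ι) hV r y w κ σ hw hκ0 hσ (hrw.trans hrmem)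
    (hyw.trans hymem) hle hatt hanti'
  have hdesc : ∀ τ ∈ Icc (0 : ℝ) 1, ψ (r, y + σ * w * τ) ≤ ψ (r, y) := by
    intro τ hτ
    have := hanti' (left_mem_Icc.2 hw.le)
      (show w * τ ∈ Icc 0 w from ⟨by nlinarith [hτ.1], by nlinarith [hτ.2]⟩)
      (by nlinarith [hτ.1])
    simpa [← mul_assoc] using this
  have hbox : ∀ t ∈ Icc (r - w) (r + w), ∀ s ∈ Icc (y - w) (y + w), ψ (t, s) ≤ ψ (r, s) + κ :=
    fun t ht s hs => by linarith [(abs_le.1 (hle t ht s hs)).2]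
  have hmain := mul_enorm_le_of_landing hψ1 hu1 (x := x) hw hκ0 hσ1 hb hcb hBb hbox hdesc
  set Y := (|x - r| + w) * Real.exp (-(ψ (x, y) - ψ (r, y))) with hY
  set A := |dx ψ (x, y)| with hA
  have hA0 : 0 ≤ A := abs_nonneg _
  have hY0 : 0 ≤ Y := by positivity
  have hval : ∀ t ∈ uIcc x r, A * |x - t| ≤ K * (ψ (x, y) - ψ (t, y)) := by
    intro t ht
    rw [hA, hpd, hpe, hpe]
    refine hprim p.derivative hp' (fun t => p.eval t) hpder t x ?_
    simp only [hpd] at hrs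
    rcases hrs with ⟨h1, h2⟩ | ⟨h1, h2⟩
    · rw [uIcc_of_ge h2] at ht
      exact Or.inl ⟨fun s hs => h1 s ⟨ht.1.trans hs.1, hs.2⟩, ht.2⟩
    · rw [uIcc_of_le h2] at ht
      exact Or.inr ⟨fun s hs => h1 s ⟨hs.1, hs.2.trans ht.2⟩, ht.1⟩
  -- The height above the valley pays for averaging at distance `|x - r| + w`, up to one factor `κ`;
  -- against the `κ ^ 2` gained at landing this leaves `1 / κ`.
  have hAY : A * Y ≤ C₃ * κ := by
    have h := hheight p hp x r w κ hw hκ (fun t ht => by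
      rw [← hpe, ← hpe]
      exact hle t ht y ⟨by linarith, by linarith⟩) (by
      rw [← hpd, ← hpe, ← hpe]
      exact hval r right_mem_uIcc)
    rwa [← hpd, ← hpe, ← hpe] at h
  have hI := hdecay (fun t => transX ψ u (t, y))
    ((measurable_transX hψ1 hu1).comp (by fun_prop)) (fun t => ψ (t, y)) x A (uIcc x r)
    measurableSet_uIcc hA0 hval
  change ENNReal.ofReal A * _ ≤ ENNReal.ofReal C₅ * maxX (transX ψ u) (x, y) at hI
  set I := ∫⁻ t in uIcc x r, ENNReal.ofReal (Real.exp (ψ (t, y) - ψ (x, y))) * transX ψ u (t, y)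
  clear_value Y I
  have hsplit : potX ψ u (x, y) = ENNReal.ofReal (A / c) * (ENNReal.ofReal c * ‖u (x, y)‖ₑ) := by
    rw [hpot, ← mul_assoc, ← ENNReal.ofReal_mul (by positivity), div_mul_cancel₀ _ hc.ne']
  rw [hsplit]
  refine (mul_le_mul_right hmain _).trans ?_
  have e₁ : A / c * (16 * Y / κ ^ 2) ≤ 16 * C₃ / c / κ := by
    calc A / c * (16 * Y / κ ^ 2) = 16 / (c * κ ^ 2) * (A * Y) := by field_simp
      _ ≤ 16 / (c * κ ^ 2) * (C₃ * κ) := by gcongr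
      _ = _ := by field_simp
  have e₂ : A / c * (16 * B * Real.exp κ * Y) ≤ D₁ := by
    calc A / c * (16 * B * Real.exp κ * Y) = 16 * B * Real.exp κ / c * (A * Y) := by field_simp
      _ ≤ 16 * B * Real.exp κ / c * (C₃ * κ) := by gcongr
      _ = _ := by rw [hD₁]; field_simp
  have e₃ : ENNReal.ofReal (A / c) * (ENNReal.ofReal (2 * B) *
      (I + ENNReal.ofReal (4 * Real.exp κ * Y) * maxX (transX ψ u) (x, y))) ≤
      ENNReal.ofReal D₂ * maxX (transX ψ u) (x, y) := by
    calc ENNReal.ofReal (A / c) * (ENNReal.ofReal (2 * B) *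
        (I + ENNReal.ofReal (4 * Real.exp κ * Y) * maxX (transX ψ u) (x, y)))
        = ENNReal.ofReal (2 * B / c) * (ENNReal.ofReal A *
          (I + ENNReal.ofReal (4 * Real.exp κ * Y) * maxX (transX ψ u) (x, y))) := by
          rw [ofReal_mul_ofReal_mul (by positivity), ofReal_mul_ofReal_mul (by positivity)]
          congr 2
          field_simp
      _ = ENNReal.ofReal (2 * B / c) * (ENNReal.ofReal A * I +
          ENNReal.ofReal (4 * Real.exp κ * (A * Y)) * maxX (transX ψ u) (x, y)) := by
          rw [mul_add (ENNReal.ofReal A), ofReal_mul_ofReal_mul hA0,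
            mul_left_comm A (4 * Real.exp κ) Y]
      _ ≤ ENNReal.ofReal (2 * B / c) * (ENNReal.ofReal C₅ * maxX (transX ψ u) (x, y) +
          ENNReal.ofReal (4 * Real.exp κ * (C₃ * κ)) * maxX (transX ψ u) (x, y)) := by
          gcongr
      _ = ENNReal.ofReal D₂ * maxX (transX ψ u) (x, y) := by
          rw [← add_mul, ← ENNReal.ofReal_add hC₅.le (by positivity),
            ofReal_mul_ofReal_mul (by positivity), hD₂]
          congr 2
          field_simp
  have hAc : 0 ≤ A / c := by positivity
  rw [mul_add, mul_add, ofReal_mul_ofReal_mul hAc, ofReal_mul_ofReal_mul hAc]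
  calc _ ≤ ENNReal.ofReal (16 * C₃ / c / κ) * maxX (maxY (potX ψ u)) (x, y) +
        ENNReal.ofReal D₁ * maxX (maxY (transY ψ u)) (x, y) +
        ENNReal.ofReal D₂ * maxX (transX ψ u) (x, y) := by
        exact add_le_add (add_le_add (ofReal_mul_le_ofReal_mul e₁ _)
          (ofReal_mul_le_ofReal_mul e₂ _)) e₃
    _ ≤ ENNReal.ofReal (16 * C₃ / c / κ) * maxX (maxY (potX ψ u)) (x, y) +
        ENNReal.ofReal (C₁ + C₂ * κ * Real.exp (2 * κ) + D₁ + D₂) *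
          maxX (maxY (transY ψ u)) (x, y) +
        ENNReal.ofReal (C₁ + C₂ * κ * Real.exp (2 * κ) + D₁ + D₂) *
          maxX (transX ψ u) (x, y) :=
        add_le_add (add_le_add le_rfl (ofReal_mul_le_ofReal_mul (by linarith) _))
          (ofReal_mul_le_ofReal_mul (by linarith) _)
    _ = _ := by ring

end

/-! ### The L² estimate by absorption -/

section

lemma ennreal_add_sq_le (s t : ℝ≥0∞) : (s + t) ^ 2 ≤ 4 * (s ^ 2 + t ^ 2) := by
  wlog h : s ≤ t generalizing s t
  · rw [add_comm s, add_comm (s ^ 2)]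
    exact this t s (le_of_not_ge h)
  calc (s + t) ^ 2 ≤ (t + t) ^ 2 := by gcongr
    _ = 4 * t ^ 2 := by ring
    _ ≤ 4 * (s ^ 2 + t ^ 2) := by gcongr; exact le_add_self

lemma normL2_sq (f : ℝ × ℝ → ℂ) : normL2 f ^ 2 = ∫⁻ z, ‖f z‖ₑ ^ 2 := by
  rw [normL2, eLpNorm_eq_lintegral_rpow_enorm_toReal two_ne_zero ENNReal.ofNat_ne_top,
    ← ENNReal.rpow_natCast, ← ENNReal.rpow_mul]
  simp

/-- Square root of an estimate of squares of norms. -/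
lemma normL2_le_of_lintegral {f g₁ g₂ : ℝ × ℝ → ℂ} {K : ℝ} (hK : 0 ≤ K)
    (h : ∫⁻ z, ‖f z‖ₑ ^ 2 ≤ ENNReal.ofReal K * ((∫⁻ z, ‖g₁ z‖ₑ ^ 2) + ∫⁻ z, ‖g₂ z‖ₑ ^ 2)) :
    normL2 f ≤ ENNReal.ofReal (√K) * (normL2 g₁ + normL2 g₂) := by
  rw [← normL2_sq, ← normL2_sq, ← normL2_sq] at h
  refine (ENNReal.pow_le_pow_left_iff two_ne_zero).1 (h.trans ?_)
  rw [mul_pow, ← ENNReal.ofReal_pow (Real.sqrt_nonneg _), Real.sq_sqrt hK]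
  gcongr
  rw [add_sq]
  exact add_le_add le_self_add le_rfl

/-- Absorption in the extended reals, where finiteness of `N` is indispensable;
`lintegral_potX_sq_ne_top` provides it for compactly supported `u`. -/
lemma le_two_mul_of_le_add {N T : ℝ≥0∞} (hN : N ≠ ⊤) (h : N ≤ T + ENNReal.ofReal (1 / 4) * N) :
    N ≤ 2 * T := by
  by_cases hT : T = ⊤
  · rw [hT, ENNReal.mul_top two_ne_zero]
    exact le_top
  have h1 : N.toReal ≤ T.toReal + 1 / 4 * N.toReal := by
    have h2 := ENNReal.toReal_mono
      (ENNReal.add_ne_top.2 ⟨hT, ENNReal.mul_ne_top ENNReal.ofReal_ne_top hN⟩) h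
    rwa [ENNReal.toReal_add hT (ENNReal.mul_ne_top ENNReal.ofReal_ne_top hN), ENNReal.toReal_mul,
      ENNReal.toReal_ofReal (by norm_num)] at h2
  rw [← ENNReal.toReal_le_toReal hN (ENNReal.mul_ne_top ENNReal.ofNat_ne_top hT),
    ENNReal.toReal_mul, ENNReal.toReal_ofNat]
  linarith [ENNReal.toReal_nonneg (a := T)]

lemma lintegral_potX_sq_ne_top {ψ : ℝ × ℝ → ℝ} {u : ℝ × ℝ → ℂ} (hψ : ContDiff ℝ 1 ψ)
    (hu : Continuous u) (hc : HasCompactSupport u) : ∫⁻ z, potX ψ u z ^ 2 ≠ ⊤ := by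
  have hcont : Continuous (dx ψ • u) := (continuous_dx hψ).smul hu
  have hcs : HasCompactSupport (dx ψ • u) := hc.smul_left
  have h : MemLp (dx ψ • u) 2 volume := hcont.memLp_of_hasCompactSupport hcs
  have h1 : normL2 (dx ψ • u) ≠ ⊤ := h.2.ne
  have h2 := normL2_sq (dx ψ • u)
  have h3 : ∀ z, potX ψ u z = ‖(dx ψ • u) z‖ₑ := fun z => rfl
  simp only [h3]
  rw [← h2]
  exact ENNReal.pow_ne_top h1

/-- The maximal estimate for `∂ₓψ`. -/
theorem exists_lintegral_potX_sq_le (m : ℕ) {L : ℝ} (hL : 0 ≤ L) : ∃ K : ℝ, 0 < K ∧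
    ∀ (a : Fin (m + 1) → Fin (m + 1) → ℝ) (ψ : ℝ × ℝ → ℝ), (∀ z, ψ z = bipoly a z.1 z.2) →
    ∀ ι : ℝ, 0 < ι → ValleyControl ψ L (3 * ι) →
    ∀ u ∈ testFunctions (Ioo (-ι) ι ×ˢ Ioo (-ι) ι),
    ∫⁻ z, potX ψ u z ^ 2 ≤
      ENNReal.ofReal K * ((∫⁻ z, transX ψ u z ^ 2) + ∫⁻ z, transY ψ u z ^ 2) := by
  obtain ⟨C₀, hC₀, h⟩ := exists_potX_le m hL
  -- The coefficient of the last term is then at most `1 / 128`. Squaring a sum costs 4 and the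
  -- iterated maximal function costs at most 1024, so `4 * 1024 / 128 ^ 2 = 1 / 4` of the left side
  -- is absorbed.
  obtain ⟨C, hC, h⟩ := h (1 + 128 * C₀) (by linarith)
  refine ⟨32768 * C ^ 2, by positivity, fun a ψ ha ι hι hV u hu => ?_⟩
  have h := h a ψ ha ι hι hV u hu
  have hu1 := contDiff_one_of_mem_testFunctions hu
  have hψ1 : ContDiff ℝ 1 ψ := contDiff_of_bipoly ha
  have hfin := lintegral_potX_sq_ne_top hψ1 hu1.continuous hu.2.1
  have hmX := measurable_transX hψ1 hu1
  have hmY := measurable_transY hψ1 hu1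
  have hmD := measurable_potX hψ1 hu1
  have hε : ENNReal.ofReal (C₀ / (1 + 128 * C₀)) ≤ ENNReal.ofReal (1 / 128) := by
    refine ENNReal.ofReal_le_ofReal ?_
    rw [div_le_div_iff₀ (by positivity) (by norm_num)]
    linarith
  have hX : ∫⁻ z, maxX (transX ψ u) z ^ 2 ≤ 1024 * ∫⁻ z, transX ψ u z ^ 2 :=
    (lintegral_maxX_sq_le hmX).trans (by gcongr; norm_num)
  have hXY : ∀ {F : ℝ × ℝ → ℝ≥0∞}, Measurable F →
      ∫⁻ z, maxX (maxY F) z ^ 2 ≤ 1024 * ∫⁻ z, F z ^ 2 := by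
    intro F hF
    calc ∫⁻ z, maxX (maxY F) z ^ 2 ≤ 32 * ∫⁻ z, maxY F z ^ 2 :=
          lintegral_maxX_sq_le (measurable_maxY hF)
      _ ≤ 32 * (32 * ∫⁻ z, F z ^ 2) := by gcongr; exact lintegral_maxY_sq_le hF
      _ = _ := by rw [← mul_assoc]; norm_num
  have hpoint : ∀ z, potX ψ u z ^ 2 ≤ ENNReal.ofReal (16 * C ^ 2) * (maxX (transX ψ u) z ^ 2 +
      maxX (maxY (transY ψ u)) z ^ 2) + ENNReal.ofReal (1 / 4096) *
        maxX (maxY (potX ψ u)) z ^ 2 := by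
    intro z
    calc potX ψ u z ^ 2 ≤ (ENNReal.ofReal C * (maxX (transX ψ u) z + maxX (maxY (transY ψ u)) z) +
          ENNReal.ofReal (1 / 128) * maxX (maxY (potX ψ u)) z) ^ 2 := by
          gcongr
          exact (h z).trans (by gcongr)
      _ ≤ 4 * ((ENNReal.ofReal C * (maxX (transX ψ u) z + maxX (maxY (transY ψ u)) z)) ^ 2 +
          (ENNReal.ofReal (1 / 128) * maxX (maxY (potX ψ u)) z) ^ 2) := ennreal_add_sq_le _ _
      _ ≤ 4 * (ENNReal.ofReal (C ^ 2) * (4 * (maxX (transX ψ u) z ^ 2 +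
          maxX (maxY (transY ψ u)) z ^ 2)) +
          ENNReal.ofReal ((1 / 128) ^ 2) * maxX (maxY (potX ψ u)) z ^ 2) := by
          rw [mul_pow, mul_pow, ← ENNReal.ofReal_pow hC.le, ← ENNReal.ofReal_pow (by norm_num)]
          gcongr
          exact ennreal_add_sq_le _ _
      _ = _ := by
          rw [show 16 * C ^ 2 = 4 * (C ^ 2 * 4) by ring, ENNReal.ofReal_mul (by norm_num),
            ENNReal.ofReal_mul (by positivity),
            show (1 / 4096 : ℝ) = 4 * (1 / 128) ^ 2 by norm_num,
            ENNReal.ofReal_mul (p := 4) (by norm_num), ENNReal.ofReal_ofNat]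
          ring
  have hmX2 : Measurable fun z => maxX (transX ψ u) z ^ 2 := (measurable_maxX hmX).pow_const 2
  have hmY2 : Measurable fun z => maxX (maxY (transY ψ u)) z ^ 2 :=
    (measurable_maxX (measurable_maxY hmY)).pow_const 2
  have hmD2 : Measurable fun z => maxX (maxY (potX ψ u)) z ^ 2 :=
    (measurable_maxX (measurable_maxY hmD)).pow_const 2
  set N := ∫⁻ z, potX ψ u z ^ 2
  set n₁ := ∫⁻ z, transX ψ u z ^ 2
  set n₂ := ∫⁻ z, transY ψ u z ^ 2
  have hN : N ≤ ENNReal.ofReal (16384 * C ^ 2) * (n₁ + n₂) + ENNReal.ofReal (1 / 4) * N := by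
    calc N ≤ ENNReal.ofReal (16 * C ^ 2) * ((∫⁻ z, maxX (transX ψ u) z ^ 2) +
          ∫⁻ z, maxX (maxY (transY ψ u)) z ^ 2) + ENNReal.ofReal (1 / 4096) *
          ∫⁻ z, maxX (maxY (potX ψ u)) z ^ 2 := by
          refine (lintegral_mono hpoint).trans (le_of_eq ?_)
          rw [lintegral_add_right _ (hmD2.const_mul _),
            lintegral_const_mul' _ _ ENNReal.ofReal_ne_top,
            lintegral_const_mul' _ _ ENNReal.ofReal_ne_top, lintegral_add_right _ hmY2]
      _ ≤ ENNReal.ofReal (16 * C ^ 2) * (1024 * n₁ + 1024 * n₂) +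
          ENNReal.ofReal (1 / 4096) * (1024 * N) := by
          gcongr
          · exact hXY hmY
          · exact hXY hmD
      _ = _ := by
          rw [show 16384 * C ^ 2 = 16 * C ^ 2 * 1024 by ring,
            ENNReal.ofReal_mul (q := 1024) (by positivity),
            show (1 / 4 : ℝ) = 1 / 4096 * 1024 by norm_num,
            ENNReal.ofReal_mul (q := 1024) (by positivity), ENNReal.ofReal_ofNat]
          ring
  refine (le_two_mul_of_le_add hfin hN).trans (le_of_eq ?_)
  rw [show 32768 * C ^ 2 = 2 * (16384 * C ^ 2) by ring, ENNReal.ofReal_mul (p := 2) (by norm_num),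
    ENNReal.ofReal_ofNat, mul_assoc]

end

/-! ### From `ψ` back to `λ φ`, under either assumption -/

section

variable {m : ℕ} {φ : ℝ × ℝ → ℝ} {a : Fin (m + 1) → Fin (m + 1) → ℝ}

lemma dx_const_mul (φ : ℝ × ℝ → ℝ) (lam : ℝ) (z : ℝ × ℝ) :
    dx (fun z => lam * φ z) z = lam * dx φ z := deriv_const_mul_field lam

lemma dy_const_mul (φ : ℝ × ℝ → ℝ) (lam : ℝ) (z : ℝ × ℝ) :
    dy (fun z => lam * φ z) z = lam * dy φ z := deriv_const_mul_field lam

lemma transX_const_mul (φ : ℝ × ℝ → ℝ) (lam : ℝ) (u : ℝ × ℝ → ℂ) (z : ℝ × ℝ) :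
    transX (fun z => lam * φ z) u z = ‖L1 φ lam u z‖ₑ := by
  rw [transX, dx_const_mul, L1]

lemma transY_const_mul (φ : ℝ × ℝ → ℝ) (lam : ℝ) (u : ℝ × ℝ → ℂ) (z : ℝ × ℝ) :
    transY (fun z => lam * φ z) u z = ‖L2 φ lam u z‖ₑ := by
  rw [transY, dy_const_mul, L2]

lemma potX_const_mul (φ : ℝ × ℝ → ℝ) (lam : ℝ) (u : ℝ × ℝ → ℂ) (z : ℝ × ℝ) :
    potX (fun z => lam * φ z) u z = ‖(lam * dx φ z) • u z‖ₑ := by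
  rw [potX, dx_const_mul]

/-- The assumption `H₁` controls the valleys of all positive multiples of the weight. -/
lemma exists_valleyControl (ha : ∀ z, φ z = bipoly a z.1 z.2) {α c : ℝ} (hα : 0 < α)
    {Ωx Ωy : Set ℝ} (hx : Icc (-c) c ⊆ Ωx) (hy : Icc (-c) c ⊆ Ωy) (h1 : H1 α φ Ωx Ωy) :
    ∃ L : ℝ, 0 ≤ L ∧ ∀ lam : ℝ, 0 < lam → ValleyControl (fun z => lam * φ z) L c := by
  obtain ⟨L, hL, hstay⟩ := exists_noStay ha hα hx hy h1
  refine ⟨L, hL, fun lam hlam => ⟨fun y hyc s hs t ht hst hneg hpos => ?_, ?_⟩⟩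
  · simp only [dx_const_mul, dy_const_mul] at hneg hpos ⊢
    obtain ⟨r, hr, hns⟩ := exists_isCrossing_of_H1 hx hy (continuous_dx_of_bipoly ha)
      (continuous_dy_of_bipoly ha) h1 hyc hs ht hst (neg_of_mul_neg_right hneg hlam.le)
      (pos_of_mul_pos_right hpos hlam.le)
    refine ⟨r, fun p hp q hq hpq hfp hfq => hr p hp q hq hpq (neg_of_mul_neg_right hfp hlam.le)
      (pos_of_mul_pos_right hfq hlam.le), fun p q hpq hsub hfp => ?_⟩
    exact mul_nonpos_of_nonneg_of_nonpos hlam.le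
      (hns p q hpq hsub (neg_of_mul_neg_right hfp hlam.le))
  · intro x₀ δ s₁ s₂ hδ hx₀ hs hlt hlong
    obtain ⟨s, hs', h⟩ := hstay x₀ δ s₁ s₂ hδ hx₀ hs hlt hlong
    exact ⟨s, hs', h.imp (fun h => mul_le_mul_of_nonneg_left h hlam.le)
      (fun h => mul_le_mul_of_nonneg_left h hlam.le)⟩

/-- The estimate of `λ (∂ₓφ) u` and `∂ₓu` under `H₁`. -/
theorem exists_lintegral_dx_le (ha : ∀ z, φ z = bipoly a z.1 z.2) {α ι : ℝ} (hα : 0 < α)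
    (hι : 0 < ι) {Ωx Ωy : Set ℝ} (hx : Icc (-(3 * ι)) (3 * ι) ⊆ Ωx)
    (hy : Icc (-(3 * ι)) (3 * ι) ⊆ Ωy) (h1 : H1 α φ Ωx Ωy) :
    ∃ K : ℝ, 0 < K ∧ ∀ lam : ℝ, 0 < lam → ∀ u ∈ testFunctions (Ioo (-ι) ι ×ˢ Ioo (-ι) ι),
      (∫⁻ z, ‖(lam * dx φ z) • u z‖ₑ ^ 2 ≤
        ENNReal.ofReal K * ((∫⁻ z, ‖L1 φ lam u z‖ₑ ^ 2) + ∫⁻ z, ‖L2 φ lam u z‖ₑ ^ 2)) ∧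
      ∫⁻ z, ‖dx u z‖ₑ ^ 2 ≤
        ENNReal.ofReal K * ((∫⁻ z, ‖L1 φ lam u z‖ₑ ^ 2) + ∫⁻ z, ‖L2 φ lam u z‖ₑ ^ 2) := by
  obtain ⟨L, hL, hV⟩ := exists_valleyControl ha hα hx hy h1
  obtain ⟨K, hK, h⟩ := exists_lintegral_potX_sq_le m hL
  refine ⟨4 + 4 * K, by positivity, fun lam hlam u hu => ?_⟩
  have hb : ∀ z : ℝ × ℝ, lam * φ z = bipoly (lam • a) z.1 z.2 := fun z => by
    rw [bipoly_smul, ← ha]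
  have h := h (lam • a) (fun z => lam * φ z) hb ι hι (hV lam hlam) u hu
  simp only [potX_const_mul, transX_const_mul, transY_const_mul] at h
  have hu1 := contDiff_one_of_mem_testFunctions hu
  have hmeas : Measurable fun z => ‖(lam * dx φ z) • u z‖ₑ ^ 2 :=
    (((continuous_const.mul (continuous_dx_of_bipoly ha)).smul
      hu1.continuous).enorm.measurable).pow_const 2
  generalize hn₁ : (∫⁻ z, ‖L1 φ lam u z‖ₑ ^ 2) = n₁ at *
  generalize hn₂ : (∫⁻ z, ‖L2 φ lam u z‖ₑ ^ 2) = n₂ at *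
  refine ⟨h.trans (ofReal_mul_le_ofReal_mul (by linarith) _), ?_⟩
  calc ∫⁻ z, ‖dx u z‖ₑ ^ 2
      ≤ ∫⁻ z, 4 * (‖L1 φ lam u z‖ₑ ^ 2 + ‖(lam * dx φ z) • u z‖ₑ ^ 2) := by
        refine lintegral_mono fun z => ?_
        refine le_trans ?_ (ennreal_add_sq_le _ _)
        have h2 : dx u z = L1 φ lam u z - (lam * dx φ z) • u z := by rw [L1, add_sub_cancel_right]
        gcongr
        rw [h2]
        exact enorm_sub_le
    _ = 4 * (n₁ + ∫⁻ z, ‖(lam * dx φ z) • u z‖ₑ ^ 2) := by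
        rw [lintegral_const_mul' _ _ ENNReal.ofNat_ne_top, lintegral_add_right _ hmeas, hn₁]
    _ ≤ 4 * ((n₁ + n₂) + ENNReal.ofReal K * (n₁ + n₂)) := by
        gcongr
        exact le_self_add
    _ = _ := by
        rw [show 4 + 4 * K = 4 * (1 + K) by ring, ENNReal.ofReal_mul (by norm_num),
          ENNReal.ofReal_add zero_le_one hK.le, ENNReal.ofReal_ofNat, ENNReal.ofReal_one]
        ring

lemma lintegral_swap (f : ℝ × ℝ → ℝ≥0∞) : ∫⁻ z : ℝ × ℝ, f z.swap = ∫⁻ z, f z := by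
  rw [Measure.volume_eq_prod]
  exact lintegral_prod_swap f

lemma comp_swap_mem_testFunctions {S : Set ℝ} {u : ℝ × ℝ → ℂ} (hu : u ∈ testFunctions (S ×ˢ S)) :
    (fun z => u z.swap) ∈ testFunctions (S ×ˢ S) := by
  refine ⟨hu.1.comp (contDiff_snd.prodMk contDiff_fst),
    hu.2.1.comp_homeomorph (Homeomorph.prodComm ℝ ℝ), ?_⟩
  have h := tsupport_comp_eq_preimage u (Homeomorph.prodComm ℝ ℝ)
  intro z hz
  have hz' : z ∈ tsupport (u ∘ Homeomorph.prodComm ℝ ℝ) := hz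
  rw [h] at hz'
  exact (hu.2.2 hz').symm

/-- The estimate of `λ (∂_yφ) u` and `∂_yu` under `H₂`. -/
theorem exists_lintegral_dy_le (ha : ∀ z, φ z = bipoly a z.1 z.2) {α ι : ℝ} (hα : 0 < α)
    (hι : 0 < ι) {Ωx Ωy : Set ℝ} (hx : Icc (-(3 * ι)) (3 * ι) ⊆ Ωx)
    (hy : Icc (-(3 * ι)) (3 * ι) ⊆ Ωy) (h2 : H2 α φ Ωx Ωy) :
    ∃ K : ℝ, 0 < K ∧ ∀ lam : ℝ, 0 < lam → ∀ u ∈ testFunctions (Ioo (-ι) ι ×ˢ Ioo (-ι) ι),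
      (∫⁻ z, ‖(lam * dy φ z) • u z‖ₑ ^ 2 ≤
        ENNReal.ofReal K * ((∫⁻ z, ‖L1 φ lam u z‖ₑ ^ 2) + ∫⁻ z, ‖L2 φ lam u z‖ₑ ^ 2)) ∧
      ∫⁻ z, ‖dy u z‖ₑ ^ 2 ≤
        ENNReal.ofReal K * ((∫⁻ z, ‖L1 φ lam u z‖ₑ ^ 2) + ∫⁻ z, ‖L2 φ lam u z‖ₑ ^ 2) := by
  have hb : ∀ z : ℝ × ℝ, φ z.swap = bipoly (fun i j => a j i) z.1 z.2 := fun z => by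
    rw [ha, bipoly_swap]; rfl
  -- Exchanging the variables turns the second assumption into the first by definition.
  have h1 : H1 α (fun z => φ z.swap) Ωy Ωx := h2
  obtain ⟨K, hK, h⟩ := exists_lintegral_dx_le (φ := fun z => φ z.swap) hb hα hι hy hx h1
  refine ⟨K, hK, fun lam hlam u hu => ?_⟩
  have h := h lam hlam _ (comp_swap_mem_testFunctions hu)
  rw [add_comm, ← lintegral_swap fun z => ‖L1 φ lam u z‖ₑ ^ 2,
    ← lintegral_swap fun z => ‖L2 φ lam u z‖ₑ ^ 2, ← lintegral_swap fun z => ‖dy u z‖ₑ ^ 2,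
    ← lintegral_swap fun z => ‖(lam * dy φ z) • u z‖ₑ ^ 2]
  exact h

end

/-! ### The gain from a finite type condition -/

section

variable {m : ℕ} {φ : ℝ × ℝ → ℝ} {a : Fin (m + 1) → Fin (m + 1) → ℝ}

lemma exists_bipoly_iterate_dx (ha : ∀ z, φ z = bipoly a z.1 z.2) (n : ℕ) :
    ∃ b : Fin (m + 1) → Fin (m + 1) → ℝ, ∀ z, (dx^[n] φ) z = bipoly b z.1 z.2 := by
  induction n with
  | zero => exact ⟨a, ha⟩
  | succ n ih =>
    obtain ⟨b, hb⟩ := ih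
    refine ⟨bipolyDeriv b, fun z => ?_⟩
    rw [Function.iterate_succ_apply', dx_eq_bipoly hb]

lemma iterate_dx_eq_eval {p : Polynomial ℝ} {y : ℝ} (hp : ∀ t, φ (t, y) = p.eval t) (n : ℕ) (t : ℝ) :
    (dx^[n] φ) (t, y) = (Polynomial.derivative^[n] p).eval t := by
  induction n generalizing t with
  | zero => exact hp t
  | succ n ih =>
    rw [Function.iterate_succ_apply', Function.iterate_succ_apply', dx]
    simp only [ih]
    exact Polynomial.deriv _

open Polynomial in
/-- A polynomial whose derivative of order `j` at `x` is not small is not small in the mean on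
short intervals next to `x`. -/
lemma exists_derivative_le_integral (m j : ℕ) : ∃ C : ℝ, 0 < C ∧ ∀ p : ℝ[X], p.natDegree ≤ m →
    ∀ x h : ℝ, 0 ≤ h → h ^ j * |(derivative^[j] p).eval x| ≤
      C * ∫ t in (0 : ℝ)..1, |p.eval (x + h * t)| := by
  obtain ⟨C, hC, hcoeff⟩ := exists_coeff_le_integral m
  refine ⟨j.factorial * C, by positivity, fun p hp x h hh => ?_⟩
  let q : ℝ[X] := (taylor x p).comp (Polynomial.C h * X)
  have hq : q.natDegree ≤ m := by
    refine natDegree_comp_le.trans ?_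
    rw [natDegree_taylor]
    calc p.natDegree * _ ≤ p.natDegree * 1 := by
          gcongr
          compute_degree
      _ ≤ m := by rwa [mul_one]
  have hqe : ∀ t, q.eval t = p.eval (x + h * t) := by
    intro t
    simp only [q, eval_comp, taylor_eval, eval_mul, eval_C, eval_X]
    rw [add_comm]
  -- The Taylor coefficients at `x`, rescaled by `h`, are bounded by the mean of the polynomial over
  -- `[x, x + h]`.
  have hqc : (j.factorial : ℝ) * q.coeff j = h ^ j * (derivative^[j] p).eval x := by
    simp only [q, comp_C_mul_X_coeff, taylor_coeff]
    have h1 := congrArg (eval x) (congrFun (factorial_smul_hasseDeriv (R := ℝ) j) p)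
    rw [← h1, LinearMap.smul_apply, eval_smul, nsmul_eq_mul]
    ring
  have h2 := hcoeff q hq j
  simp only [hqe] at h2
  calc h ^ j * |(derivative^[j] p).eval x| = |(j.factorial : ℝ) * q.coeff j| := by
        rw [hqc, abs_mul, abs_of_nonneg (pow_nonneg hh j)]
    _ = j.factorial * |q.coeff j| := by rw [abs_mul, Nat.abs_cast]
    _ ≤ j.factorial * (C * ∫ t in (0 : ℝ)..1, |p.eval (x + h * t)|) := by gcongr
    _ = _ := by ring

/-- A function is controlled by its average against a weight and by its derivative. -/
lemma mul_enorm_le_of_weight {v v' : ℝ → ℂ} (hv : ∀ t, HasDerivAt v (v' t) t) (hv' : Continuous v')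
    {W : ℝ → ℝ} (hW : Continuous W) {x h A : ℝ} (hh : 0 < h) (hA : 0 < A)
    (hlow : A ≤ ∫ t in (0 : ℝ)..1, |W (x + h * t)|) :
    ‖v x‖ₑ ≤ ENNReal.ofReal (4 / A) * hlMax (fun t => ‖W t • v t‖ₑ) x +
      ENNReal.ofReal (4 * h) * hlMax (fun t => ‖v' t‖ₑ) x := by
  have hvc : Continuous v := continuous_iff_continuousAt.2 fun t => (hv t).continuousAt
  set J : ℝ≥0∞ := ∫⁻ t in Icc (0 : ℝ) 1, ‖W (x + h * t)‖ₑ with hJ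
  have hWc : Continuous fun t => W (x + h * t) := hW.comp (by fun_prop)
  have hJeq : J = ENNReal.ofReal (∫ t in (0 : ℝ)..1, |W (x + h * t)|) := by
    rw [intervalIntegral.integral_of_le zero_le_one, ← integral_Icc_eq_integral_Ioc,
      ofReal_integral_eq_lintegral_ofReal
        (hWc.abs.continuousOn.integrableOn_compact isCompact_Icc)
        (ae_of_all _ fun t => abs_nonneg _)]
    simp only [hJ, Real.enorm_eq_ofReal_abs]
  have hJtop : J ≠ ⊤ := by rw [hJeq]; exact ENNReal.ofReal_ne_top
  have hJA : ENNReal.ofReal A ≤ J := by rw [hJeq]; exact ENNReal.ofReal_le_ofReal hlow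
  have hJ0 : J ≠ 0 := (lt_of_lt_of_le (ENNReal.ofReal_pos.2 hA) hJA).ne'
  set B : ℝ≥0∞ := ENNReal.ofReal (4 * h) * hlMax (fun t => ‖v' t‖ₑ) x with hB
  have hpath : ∀ t ∈ Icc (0 : ℝ) 1, ‖v x‖ₑ ≤ ‖v (x + h * t)‖ₑ + B := by
    intro t ht
    have h1 := enorm_le_add_lintegral (p := fun _ => 0) (p' := fun _ => 0)
      (fun t => hasDerivAt_const t 0) hv continuous_const hv' 0 (x + h * t) x
    simp only [sub_self, Real.exp_zero, ENNReal.ofReal_one, one_mul, zero_smul, add_zero] at h1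
    refine h1.trans (add_le_add le_rfl ?_)
    refine (lintegral_mono_set ?_).trans (lintegral_Icc_le_hlMax _ x hh)
    refine uIcc_subset_Icc ⟨by nlinarith [ht.1], by nlinarith [ht.2]⟩ ⟨by linarith, by linarith⟩
  have hmeas : Measurable fun t => ‖W (x + h * t)‖ₑ * B :=
    hWc.enorm.measurable.mul_const _
  -- The bound `hpath` is averaged against `|W|`, whose mean `J` is at least `A`; dividing by `J`
  -- leaves the derivative term `B` without any loss.
  have hmul : J * ‖v x‖ₑ ≤ ENNReal.ofReal 4 * hlMax (fun t => ‖W t • v t‖ₑ) x + J * B := by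
    calc J * ‖v x‖ₑ = ∫⁻ t in Icc (0 : ℝ) 1, ‖W (x + h * t)‖ₑ * ‖v x‖ₑ :=
          (lintegral_mul_const' _ _ enorm_ne_top).symm
      _ ≤ ∫⁻ t in Icc (0 : ℝ) 1, (‖W (x + h * t) • v (x + h * t)‖ₑ + ‖W (x + h * t)‖ₑ * B) := by
          refine setLIntegral_mono' measurableSet_Icc fun t ht => ?_
          rw [enorm_smul, ← mul_add]
          gcongr
          exact hpath t ht
      _ = (∫⁻ t in Icc (0 : ℝ) 1, ‖W (x + h * t) • v (x + h * t)‖ₑ) + J * B := by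
          rw [lintegral_add_right _ hmeas, lintegral_mul_const _ hWc.enorm.measurable]
      _ ≤ _ := by
          gcongr
          refine (lintegral_mono_set (Icc_subset_Icc (by norm_num : (-1 : ℝ) ≤ 0) le_rfl)).trans ?_
          have h1 := lintegral_Icc_affine_le_hlMax (fun t => ‖W t • v t‖ₑ) x x hh.ne'
          rw [sub_self, abs_zero, zero_add, mul_div_assoc, div_self (abs_pos.2 hh.ne').ne',
            mul_one] at h1
          exact h1
  calc ‖v x‖ₑ = J⁻¹ * (J * ‖v x‖ₑ) := by
        rw [← mul_assoc, ENNReal.inv_mul_cancel hJ0 hJtop, one_mul]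
    _ ≤ J⁻¹ * (ENNReal.ofReal 4 * hlMax (fun t => ‖W t • v t‖ₑ) x + J * B) := by gcongr
    _ = J⁻¹ * (ENNReal.ofReal 4 * hlMax (fun t => ‖W t • v t‖ₑ) x) + B := by
        rw [mul_add, ← mul_assoc J⁻¹ J, ENNReal.inv_mul_cancel hJ0 hJtop, one_mul]
    _ ≤ (ENNReal.ofReal A)⁻¹ * (ENNReal.ofReal 4 * hlMax (fun t => ‖W t • v t‖ₑ) x) + B := by
        gcongr
    _ = _ := by
        rw [← ENNReal.ofReal_inv_of_pos hA, ofReal_mul_ofReal_mul (inv_pos.2 hA).le,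
          div_eq_inv_mul]

/-- The pointwise gain under a finite type condition at the point. -/
lemma exists_mul_enorm_le_of_iterate_dx (ha : ∀ z, φ z = bipoly a z.1 z.2) {j k : ℕ} (hjk : j ≤ k)
    {c : ℝ} (hc : 0 < c) :
    ∃ C : ℝ, 0 < C ∧ ∀ lam h : ℝ, 0 < h → h ≤ 1 → lam * h ^ (k + 1) = 1 →
    ∀ u : ℝ × ℝ → ℂ, ContDiff ℝ 1 u → ∀ z, c ≤ |(dx^[j + 1] φ) z| →
    ENNReal.ofReal h⁻¹ * ‖u z‖ₑ ≤ ENNReal.ofReal C *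
      (maxX (fun z => ‖(lam * dx φ z) • u z‖ₑ) z + maxX (fun z => ‖dx u z‖ₑ) z) := by
  obtain ⟨C, hC, hder⟩ := exists_derivative_le_integral m j
  refine ⟨4 * C / c + 4, by positivity, ?_⟩
  rintro lam h hh hh1 hlam u hu ⟨x, y⟩ hz
  obtain ⟨p, hp, hpe, hpd⟩ := exists_slice ha y
  have hline : Continuous fun t : ℝ => (t, y) := by fun_prop
  have hlam0 : 0 < lam := by
    have : 0 < lam * h ^ (k + 1) := by rw [hlam]; exact one_pos
    exact pos_of_mul_pos_left this (by positivity)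
  have hp' : p.derivative.natDegree ≤ m :=
    (Polynomial.natDegree_derivative_le p).trans ((Nat.sub_le _ _).trans hp)
  rw [iterate_dx_eq_eval hpe, Function.iterate_succ_apply] at hz
  -- From `lam * h ^ (k + 1) = 1`, the quantity `lam * h ^ k` is `1 / h`; since `h ≤ 1`, replacing
  -- `h ^ j` by `h ^ k` loses nothing for `j ≤ k`.
  have hlow : c / (C * h) ≤ ∫ t in (0 : ℝ)..1, |lam * dx φ (x + h * t, y)| := by
    have h1 := hder p.derivative hp' x h hh.le
    have h2 : h ^ k * c ≤ C * ∫ t in (0 : ℝ)..1, |p.derivative.eval (x + h * t)| := by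
      refine le_trans ?_ h1
      gcongr ?_ * ?_
      exact pow_le_pow_of_le_one hh.le hh1 hjk
    have h3 : (∫ t in (0 : ℝ)..1, |lam * dx φ (x + h * t, y)|) =
        lam * ∫ t in (0 : ℝ)..1, |p.derivative.eval (x + h * t)| := by
      simp only [abs_mul, abs_of_pos hlam0, hpd]
      exact intervalIntegral.integral_const_mul _ _
    rw [h3, div_le_iff₀ (by positivity)]
    calc c = lam * h ^ (k + 1) * c := by rw [hlam, one_mul]
      _ = lam * h * (h ^ k * c) := by ring
      _ ≤ lam * h * (C * ∫ t in (0 : ℝ)..1, |p.derivative.eval (x + h * t)|) := by gcongr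
      _ = _ := by ring
  have hmain := mul_enorm_le_of_weight (v := fun t => u (t, y)) (v' := fun t => dx u (t, y))
    (W := fun t => lam * dx φ (t, y))
    (fun t => hasDerivAt_dx (hu.differentiable one_ne_zero) t y) ((continuous_dx hu).comp hline)
    (continuous_const.mul ((continuous_dx_of_bipoly ha).comp hline)) hh
    (show 0 < c / (C * h) by positivity) hlow
  have hmain' : ‖u (x, y)‖ₑ ≤ ENNReal.ofReal (4 / (c / (C * h))) *
      maxX (fun z => ‖(lam * dx φ z) • u z‖ₑ) (x, y) +
      ENNReal.ofReal (4 * h) * maxX (fun z => ‖dx u z‖ₑ) (x, y) := hmain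
  refine (mul_le_mul_right hmain' _).trans ?_
  have hi : 0 ≤ h⁻¹ := by positivity
  rw [mul_add, mul_add, ofReal_mul_ofReal_mul hi, ofReal_mul_ofReal_mul hi]
  refine add_le_add (ofReal_mul_le_ofReal_mul ?_ _) (ofReal_mul_le_ofReal_mul ?_ _)
  · have : h⁻¹ * (4 / (c / (C * h))) = 4 * C / c := by field_simp
    linarith
  · have : h⁻¹ * (4 * h) = 4 := by field_simp
    have : 0 < 4 * C / c := by positivity
    linarith

end

/-! ### Integrated gain, and choice of the neighborhood -/

section

variable {m : ℕ} {φ : ℝ × ℝ → ℝ} {a : Fin (m + 1) → Fin (m + 1) → ℝ}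

/-- The subelliptic gain in a square where a derivative of the weight is not small. -/
lemma exists_lintegral_smul_le (ha : ∀ z, φ z = bipoly a z.1 z.2) {j k : ℕ} (hjk : j ≤ k)
    {c : ℝ} (hc : 0 < c) {W : Set (ℝ × ℝ)} (hW : ∀ z ∈ W, c ≤ |(dx^[j + 1] φ) z|) :
    ∃ C : ℝ, 0 < C ∧ ∀ lam : ℝ, 1 ≤ lam → ∀ u ∈ testFunctions W,
    ∫⁻ z, ‖(lam ^ (1 / ((k : ℝ) + 1))) • u z‖ₑ ^ 2 ≤ ENNReal.ofReal C *
      ((∫⁻ z, ‖(lam * dx φ z) • u z‖ₑ ^ 2) + ∫⁻ z, ‖dx u z‖ₑ ^ 2) := by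
  obtain ⟨C, hC, h⟩ := exists_mul_enorm_le_of_iterate_dx ha hjk hc
  refine ⟨128 * C ^ 2, by positivity, fun lam hlam u hu => ?_⟩
  have hlam0 : 0 < lam := by linarith
  have hk : (0 : ℝ) < (k : ℝ) + 1 := by positivity
  -- The averaging scale is `q⁻¹`; it is at most 1 because `lam ≥ 1`.
  set q := lam ^ (1 / ((k : ℝ) + 1)) with hq
  have hq0 : 0 < q := Real.rpow_pos_of_pos hlam0 _
  have hq1 : 1 ≤ q := Real.one_le_rpow hlam (by positivity)
  have hqk : q ^ (k + 1) = lam := by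
    rw [hq, ← Real.rpow_natCast, ← Real.rpow_mul hlam0.le]
    push_cast
    rw [one_div_mul_cancel hk.ne', Real.rpow_one]
  have hu1 := contDiff_one_of_mem_testFunctions hu
  have hm₁ : Measurable fun z => ‖(lam * dx φ z) • u z‖ₑ :=
    ((continuous_const.mul (continuous_dx_of_bipoly ha)).smul hu1.continuous).enorm.measurable
  have hm₂ : Measurable fun z => ‖dx u z‖ₑ := (continuous_dx hu1).enorm.measurable
  have hpoint : ∀ z, ‖q • u z‖ₑ ≤ ENNReal.ofReal C *
      (maxX (fun z => ‖(lam * dx φ z) • u z‖ₑ) z + maxX (fun z => ‖dx u z‖ₑ) z) := by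
    intro z
    by_cases hz : z ∈ W
    · have h1 := h lam q⁻¹ (inv_pos.2 hq0) (inv_le_one_of_one_le₀ hq1)
        (by rw [inv_pow, hqk, mul_inv_cancel₀ hlam0.ne']) u hu1 z (hW z hz)
      rwa [inv_inv, ← Real.enorm_of_nonneg hq0.le, ← enorm_smul] at h1
    · rw [eq_zero_of_mem_testFunctions hu hz, smul_zero, enorm_zero]
      exact zero_le
  have hx₁ := lintegral_maxX_sq_le hm₁
  have hx₂ := lintegral_maxX_sq_le hm₂
  have hmm : Measurable fun z => maxX (fun z => ‖dx u z‖ₑ) z ^ 2 := (measurable_maxX hm₂).pow_const 2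
  calc ∫⁻ z, ‖q • u z‖ₑ ^ 2 ≤ ∫⁻ z, ENNReal.ofReal (C ^ 2) *
        (4 * (maxX (fun z => ‖(lam * dx φ z) • u z‖ₑ) z ^ 2 +
          maxX (fun z => ‖dx u z‖ₑ) z ^ 2)) := by
        refine lintegral_mono fun z => ?_
        rw [ENNReal.ofReal_pow hC.le]
        refine (pow_le_pow_left' (hpoint z) 2).trans ?_
        rw [mul_pow]
        gcongr
        exact ennreal_add_sq_le _ _
    _ = ENNReal.ofReal (C ^ 2) * (4 * ((∫⁻ z, maxX (fun z => ‖(lam * dx φ z) • u z‖ₑ) z ^ 2) +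
          ∫⁻ z, maxX (fun z => ‖dx u z‖ₑ) z ^ 2)) := by
        rw [lintegral_const_mul' _ _ ENNReal.ofReal_ne_top,
          lintegral_const_mul' _ _ ENNReal.ofNat_ne_top, lintegral_add_right _ hmm]
    _ ≤ ENNReal.ofReal (C ^ 2) * (4 * (32 * (∫⁻ z, ‖(lam * dx φ z) • u z‖ₑ ^ 2) +
          32 * ∫⁻ z, ‖dx u z‖ₑ ^ 2)) := by gcongr
    _ = _ := by
        rw [← mul_add, show 128 * C ^ 2 = C ^ 2 * (4 * 32) by ring,
          ENNReal.ofReal_mul (by positivity), ENNReal.ofReal_mul (p := 4) (by norm_num),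
          ENNReal.ofReal_ofNat, ENNReal.ofReal_ofNat]
        ring

lemma isOpen_box (ι : ℝ) : IsOpen (Ioo (-ι) ι ×ˢ Ioo (-ι) ι) := isOpen_Ioo.prod isOpen_Ioo

lemma exists_box_subset {S : Set (ℝ × ℝ)} (hS : S ∈ 𝓝 ((0 : ℝ), (0 : ℝ))) :
    ∃ ι : ℝ, 0 < ι ∧ Icc (-(3 * ι)) (3 * ι) ×ˢ Icc (-(3 * ι)) (3 * ι) ⊆ S := by
  obtain ⟨ε, hε, h⟩ := Metric.nhds_basis_closedBall.mem_iff.1 hS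
  refine ⟨ε / 3, by positivity, fun z hz => h ?_⟩
  have h3 : 3 * (ε / 3) = ε := by ring
  rw [h3] at hz
  rw [Metric.mem_closedBall, Prod.dist_eq, max_le_iff, Real.dist_eq, Real.dist_eq, sub_zero,
    sub_zero, abs_le, abs_le]
  exact hz

end

/-! ### The two estimates -/

theorem corollary1p2 (m : ℕ) (α : ℝ) (hα : 0 < α) (φ : ℝ × ℝ → ℝ)
    (hφ : φ ∈ WittenSystem.polyDegLE m) (Ωx Ωy : Set ℝ)
    (hΩx : Ωx ∈ 𝓝 (0 : ℝ)) (hΩy : Ωy ∈ 𝓝 (0 : ℝ))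
    (h1 : WittenSystem.H1 α φ Ωx Ωy) :
    (∀ k : ℕ,
      ∑ j ∈ Finset.range (k + 1), |(WittenSystem.dx^[j + 1] φ) (0, 0)| ≠ 0 →
      ∃ C : ℝ, 0 < C ∧ ∃ lam₀ : ℝ, 0 < lam₀ ∧
        ∃ W : Set (ℝ × ℝ), IsOpen W ∧ (0, 0) ∈ W ∧ W ⊆ Ωx ×ˢ Ωy ∧
          ∀ lam : ℝ, lam₀ ≤ lam → ∀ u ∈ WittenSystem.testFunctions W,
            WittenSystem.normL2 (fun z => (lam ^ (1 / ((k : ℝ) + 1))) • u z) ≤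
              ENNReal.ofReal C *
                (WittenSystem.normL2 (WittenSystem.L1 φ lam u) +
                  WittenSystem.normL2 (WittenSystem.L2 φ lam u))) ∧
    (WittenSystem.H2 α φ Ωx Ωy →
      ∃ C : ℝ, 0 < C ∧ ∃ lam₀ : ℝ, 0 < lam₀ ∧
        ∃ W : Set (ℝ × ℝ), IsOpen W ∧ (0, 0) ∈ W ∧ W ⊆ Ωx ×ˢ Ωy ∧
          ∀ lam : ℝ, lam₀ ≤ lam → ∀ u ∈ WittenSystem.testFunctions W,
            WittenSystem.normL2 (WittenSystem.dx u) + WittenSystem.normL2 (WittenSystem.dy u) +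
              WittenSystem.normL2 (fun z => (lam * WittenSystem.dx φ z) • u z) +
              WittenSystem.normL2 (fun z => (lam * WittenSystem.dy φ z) • u z) ≤
              ENNReal.ofReal C *
                (WittenSystem.normL2 (WittenSystem.L1 φ lam u) +
                  WittenSystem.normL2 (WittenSystem.L2 φ lam u))) := by
  obtain ⟨a, ha⟩ := exists_bipoly_of_polyDegLE hφ
  have hΩ : Ωx ×ˢ Ωy ∈ 𝓝 ((0 : ℝ), (0 : ℝ)) := prod_mem_nhds hΩx hΩy
  have hfst : ∀ {ι : ℝ}, 0 < ι → Icc (-(3 * ι)) (3 * ι) ×ˢ Icc (-(3 * ι)) (3 * ι) ⊆ Ωx ×ˢ Ωy →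
      Icc (-(3 * ι)) (3 * ι) ⊆ Ωx ∧ Icc (-(3 * ι)) (3 * ι) ⊆ Ωy := by
    intro ι hι h
    have h0 : (0 : ℝ) ∈ Icc (-(3 * ι)) (3 * ι) := ⟨by linarith, by linarith⟩
    exact ⟨fun x hx => (h (mk_mem_prod hx h0)).1,
      fun x hx => (h (mk_mem_prod h0 hx)).2⟩
  have hbox : ∀ {ι : ℝ}, 0 < ι → Ioo (-ι) ι ×ˢ Ioo (-ι) ι ⊆
      Icc (-(3 * ι)) (3 * ι) ×ˢ Icc (-(3 * ι)) (3 * ι) := by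
    intro ι hι
    have h : Ioo (-ι) ι ⊆ Icc (-(3 * ι)) (3 * ι) := fun x hx =>
      ⟨by linarith [hx.1], by linarith [hx.2]⟩
    exact prod_mono h h
  have hzero : ∀ {ι : ℝ}, 0 < ι → ((0 : ℝ), (0 : ℝ)) ∈ Ioo (-ι) ι ×ˢ Ioo (-ι) ι := fun hι =>
    ⟨⟨by linarith, hι⟩, ⟨by linarith, hι⟩⟩
  constructor
  · intro k hk
    obtain ⟨j, hj, hj0⟩ := Finset.exists_ne_zero_of_sum_ne_zero hk
    have hjk : j ≤ k := Nat.le_of_lt_succ (Finset.mem_range.1 hj)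
    -- Half the value at the origin remains a lower bound in a small box, by continuity.
    set c := |(WittenSystem.dx^[j + 1] φ) (0, 0)| / 2 with hc
    have hcpos : 0 < |(WittenSystem.dx^[j + 1] φ) (0, 0)| :=
      lt_of_le_of_ne (abs_nonneg _) (Ne.symm hj0)
    have hc0 : 0 < c := half_pos hcpos
    obtain ⟨b, hb⟩ := exists_bipoly_iterate_dx ha (j + 1)
    have hcont : Continuous fun z => |(WittenSystem.dx^[j + 1] φ) z| := by
      have h : (WittenSystem.dx^[j + 1] φ) = fun z => bipoly b z.1 z.2 := funext hb
      rw [h]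
      exact (continuous_bipoly b).abs
    have hnear : {z | c < |(WittenSystem.dx^[j + 1] φ) z|} ∈ 𝓝 ((0 : ℝ), (0 : ℝ)) :=
      (isOpen_lt continuous_const hcont).mem_nhds (half_lt_self hcpos)
    obtain ⟨ι, hι, hsub⟩ := exists_box_subset (Filter.inter_mem hΩ hnear)
    obtain ⟨hx, hy⟩ := hfst hι (hsub.trans inter_subset_left)
    obtain ⟨K, hK, hdx⟩ := exists_lintegral_dx_le ha hα hι hx hy h1
    obtain ⟨C, hC, hgain⟩ := exists_lintegral_smul_le ha hjk hc0
      (W := Ioo (-ι) ι ×ˢ Ioo (-ι) ι) fun z hz => (hsub (hbox hι hz)).2.le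
    refine ⟨√(C * (K + K)), Real.sqrt_pos.2 (by positivity), 1, one_pos, _, isOpen_box ι,
      hzero hι, (hbox hι).trans (hsub.trans inter_subset_left), fun lam hlam u hu => ?_⟩
    obtain ⟨e₁, e₂⟩ := hdx lam (by linarith) u hu
    refine normL2_le_of_lintegral (by positivity) ((hgain lam hlam u hu).trans ?_)
    rw [ENNReal.ofReal_mul hC.le, ENNReal.ofReal_add hK.le hK.le, mul_assoc, add_mul]
    gcongr
  · intro h2
    obtain ⟨ι, hι, hsub⟩ := exists_box_subset hΩ
    obtain ⟨hx, hy⟩ := hfst hι hsub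
    obtain ⟨K, hK, hdx⟩ := exists_lintegral_dx_le ha hα hι hx hy h1
    obtain ⟨K', hK', hdy⟩ := exists_lintegral_dy_le ha hα hι hx hy h2
    -- Each of the four norms has its own constant; here any positive `lam` would do, and the
    -- threshold 1 is a default.
    refine ⟨√K + √K' + √K + √K', by positivity, 1, one_pos, _, isOpen_box ι, hzero hι,
      (hbox hι).trans hsub, fun lam hlam u hu => ?_⟩
    obtain ⟨e₁, e₂⟩ := hdx lam (by linarith) u hu
    obtain ⟨e₃, e₄⟩ := hdy lam (by linarith) u hu
    rw [ENNReal.ofReal_add (by positivity) (by positivity),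
      ENNReal.ofReal_add (by positivity) (by positivity),
      ENNReal.ofReal_add (by positivity) (by positivity), add_mul, add_mul, add_mul]
    exact add_le_add (add_le_add (add_le_add (normL2_le_of_lintegral hK.le e₂)
      (normL2_le_of_lintegral hK'.le e₄)) (normL2_le_of_lintegral hK.le e₁))
      (normL2_le_of_lintegral hK'.le e₃)
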